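/- Let $\mathbb{K}$ be a field of characteristic $0$ and $G$ a group acting linearly, by maps of degree $0$, on a graded $\mathbb{K}$-vector space $V=\bigoplus_{i\in\mathbb{Z}}V^i$. Let $S^c(V)=\bigoplus_{n\ge0}V^{\odot n}$ be the graded symmetric coalgebra of $V$ and $p\colon S^c(V)\to V$ the projection onto $V^{\odot1}=V$. An $L_\infty[1]$ algebra structure on $V$ is a coderivation $Q$ of degree $1$ of $S^c(V)$ with $Q\circ Q=0$ and $p(Q(1))=0$; its Taylor coefficients are $q_n=p\circ Q|_{V^{\odot n}}\colon V^{\odot n}\to V$, and $H(V,q_1)$ is the cohomology of the complex $(V,q_1)$. An $L_\infty[1]$ morphism $F\colon(V,Q)\dashrightarrow(W,R)$ is a morphism of counital coaugmented DG coalgebras $(S^c(V),Q)\to(S^c(W),R)$, with Taylor coefficients $f_n=p\circ F|_{V^{\odot n}}\colon V^{\odot n}\to W$; it is a weak equivalence if $f_1\colon(V,q_1)\to(W,r_1)$ is a quasi-isomorphism. Structures and morphisms are called $G$-equivariant if all their Taylor coefficients with $n\ge1$ are $G$-equivariant. The bracket $q_2$ induces a bracket $r_2\colon H(V,q_1)^{\odot2}\to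 H(V,q_1)$, $r_2([x],[y])=[q_2(x,y)]$, and $(H(V,q_1),r_2)$ denotes the $L_\infty[1]$ algebra on $H(V,q_1)$ whose only nonzero Taylor coefficient is $r_2$. The $L_\infty[1]$ algebra $(V,Q)$ is formal if there exists a weak equivalence $(V,Q)\dashrightarrow(H(V,q_1),r_2)$. If $Q$ is $G$-equivariant, then $G$ acts on $H(V,q_1)$, and $(V,Q)$ is $G$-equivariantly formal if there exists a $G$-equivariant weak equivalence $(H(V,q_1),r_2)\dashrightarrow(V,Q)$. Theorem. Let $(V,Q)$ be a $G$-equivariant $L_\infty[1]$ algebra. Assume that the following $G$-modules are semisimple (direct sums of irreducible representations): - $V^i$, for all $i\in\mathbb{Z}$; - $\operatorname{Hom}^j(H(V,q_1)^{\odot n},H(V,q_1))$, the space of linear maps of degree $j$ with the action $(g\varphi)(x)=g\,\varphi(g^{-1}x)$, for $j=0,1$ and all $n\ge2$. If $(V,Q)$ is formal, then it is $G$-equivariantly formal. -/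

import Mathlib

open scoped TensorProduct DirectSum

noncomputable section

namespace LInfty

section SymmetricCoalgebra

variable {K V W : Type*} [Field K] [AddCommGroup V] [Module K V] [AddCommGroup W] [Module K W]

/-- The Koszul sign `(-1)^n` as a scalar. -/
def ksign (K : Type*) [Field K] (n : ℤ) : K := ((n.negOnePow : ℤ) : K)

/-- A linear map between graded vector spaces which is homogeneous of degree `j`. -/
def HasDegree (𝒱 : ℤ → Submodule K V) (𝒲 : ℤ → Submodule K W) (j : ℤ) (f : V →ₗ[K] W) : Prop :=
  ∀ i : ℤ, ∀ v ∈ 𝒱 i, f v ∈ 𝒲 (i + j)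

/-- The relations `x y = (-1)^{|x||y|} y x` of graded commutativity. -/
inductive SymRel (𝒱 : ℤ → Submodule K V) : TensorAlgebra K V → TensorAlgebra K V → Prop
  | comm {i j : ℤ} {x y : V} (hx : x ∈ 𝒱 i) (hy : y ∈ 𝒱 j) :
      SymRel 𝒱 (TensorAlgebra.ι K x * TensorAlgebra.ι K y)
        (ksign K (i * j) • (TensorAlgebra.ι K y * TensorAlgebra.ι K x))

/-- The graded symmetric algebra `S(V) = ⨁ₙ V^{⊙n}` of a graded vector space `V`: the quotient of
the tensor algebra by the Koszul commutation relations. It carries the coproduct `comul`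
below, and with it is the symmetric coalgebra `S^c(V)`. -/
def Sym (𝒱 : ℤ → Submodule K V) : Type _ := RingQuot (SymRel 𝒱)

namespace Sym

variable (𝒱 : ℤ → Submodule K V) (𝒲 : ℤ → Submodule K W)

instance : Ring (Sym 𝒱) := inferInstanceAs (Ring (RingQuot (SymRel 𝒱)))

instance : Algebra K (Sym 𝒱) := inferInstanceAs (Algebra K (RingQuot (SymRel 𝒱)))

/-- The inclusion `V = V^{⊙1} → S(V)`. -/
def ι : V →ₗ[K] Sym 𝒱 :=
  (RingQuot.mkAlgHom K (SymRel 𝒱)).toLinearMap ∘ₗ TensorAlgebra.ι K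

variable {𝒱} in
theorem ι_mul_ι {i j : ℤ} {x y : V} (hx : x ∈ 𝒱 i) (hy : y ∈ 𝒱 j) :
    ι 𝒱 x * ι 𝒱 y = ksign K (i * j) • (ι 𝒱 y * ι 𝒱 x) := by
  have h := RingQuot.mkAlgHom_rel K (SymRel.comm hx hy)
  rw [map_mul, map_smul, map_mul] at h
  exact h

/-- The universal property of `S(V)`. -/
def lift {A : Type*} [Ring A] [Algebra K A] (f : V →ₗ[K] A)
    (hf : ∀ (i j : ℤ) (x y : V), x ∈ 𝒱 i → y ∈ 𝒱 j → f x * f y = ksign K (i * j) • (f y * f x)) :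
    Sym 𝒱 →ₐ[K] A :=
  RingQuot.liftAlgHom K ⟨TensorAlgebra.lift K f, by
    rintro _ _ ⟨hx, hy⟩
    simpa using hf _ _ _ _ hx hy⟩

@[simp]
theorem lift_ι {A : Type*} [Ring A] [Algebra K A] (f : V →ₗ[K] A)
    (hf : ∀ (i j : ℤ) (x y : V), x ∈ 𝒱 i → y ∈ 𝒱 j → f x * f y = ksign K (i * j) • (f y * f x))
    (v : V) : lift 𝒱 f hf (ι 𝒱 v) = f v := by
  change RingQuot.liftAlgHom K _ (RingQuot.mkAlgHom K (SymRel 𝒱) (TensorAlgebra.ι K v)) = f v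
  rw [RingQuot.liftAlgHom_mkAlgHom_apply, TensorAlgebra.lift_ι_apply]

theorem algHom_ext {A : Type*} [Ring A] [Algebra K A] {f g : Sym 𝒱 →ₐ[K] A}
    (h : ∀ v, f (ι 𝒱 v) = g (ι 𝒱 v)) : f = g := by
  exact RingQuot.ringQuot_ext' K _ _ (TensorAlgebra.hom_ext (LinearMap.ext h))

/-- The action of `V` on `K × V` by `v • (a, w) = (0, a v)`. -/
def projAux : V →ₗ[K] Module.End K (K × V) where
  toFun v := LinearMap.inr K K V ∘ₗ (LinearMap.fst K K V).smulRight v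
  map_add' v w := by ext <;> simp
  map_smul' c v := by ext <;> simp

/-- The natural projection `p : S^c(V) → V = V^{⊙1}`, which is the identity on `V` and vanishes on
`V^{⊙n}` for `n ≠ 1`. It is the second component of the action on `(1, 0)`, where `S(V)`
acts on `K × V` by the extension of `projAux`, so that products of two elements of `V` act as `0`. -/
def proj : Sym 𝒱 →ₗ[K] V :=
  LinearMap.snd K K V ∘ₗ LinearMap.applyₗ ((1, 0) : K × V) ∘ₗ
    (lift 𝒱 (projAux (K := K) (V := V)) (by
      intro i j x y _ _
      ext <;> simp [projAux])).toLinearMap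

theorem proj_one : proj 𝒱 1 = 0 := by simp [proj]

theorem proj_ι (v : V) : proj 𝒱 (ι 𝒱 v) = v := by simp [proj, projAux]

theorem proj_ι_mul_ι_mul (v w : V) (x : Sym 𝒱) : proj 𝒱 (ι 𝒱 v * (ι 𝒱 w * x)) = 0 := by
  simp [proj, projAux]

/-- The counit `S^c(V) → K`, the projection onto `V^{⊙0} = K`. -/
def counit : Sym 𝒱 →ₗ[K] K :=
  (lift 𝒱 (A := K) 0 (by intros; simp)).toLinearMap

/-- The symmetric power `V^{⊙n}` as a subspace of `S(V)`. -/
def power (n : ℕ) : Submodule K (Sym 𝒱) := LinearMap.range (ι 𝒱) ^ n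

/-- The symmetric product `(v₁, …, vₙ) ↦ v₁ ⊙ ⋯ ⊙ vₙ`. -/
def prod (n : ℕ) : MultilinearMap K (fun _ : Fin n => V) (Sym 𝒱) :=
  (MultilinearMap.mkPiAlgebraFin K n (Sym 𝒱)).compLinearMap fun _ => ι 𝒱

/-- The part of `S(V)` of degree `d`, spanned by the products `v₁ ⊙ ⋯ ⊙ vₙ` of homogeneous
elements with `|v₁| + ⋯ + |vₙ| = d`. -/
def grading (d : ℤ) : Submodule K (Sym 𝒱) :=
  Submodule.span K {x | ∃ l : List (Σ i : ℤ, 𝒱 i),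
    (l.map Sigma.fst).sum = d ∧ (l.map fun a => ι 𝒱 (a.2 : V)).prod = x}

variable {𝒱} in
theorem ι_mem_grading {i : ℤ} {v : V} (hv : v ∈ 𝒱 i) : ι 𝒱 v ∈ grading 𝒱 i :=
  Submodule.subset_span ⟨[⟨i, v, hv⟩], by simp, by simp⟩

instance : SetLike.GradedMonoid (grading 𝒱) where
  one_mem := Submodule.subset_span ⟨[], by simp, by simp⟩
  mul_mem := by
    intro i j x y hx hy
    have h : x * y ∈ grading 𝒱 i * grading 𝒱 j := Submodule.mul_mem_mul hx hy
    rw [grading, grading, Submodule.span_mul_span] at h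
    refine Submodule.span_mono ?_ h
    rintro _ ⟨_, ⟨l, hl, rfl⟩, _, ⟨l', hl', rfl⟩, rfl⟩
    exact ⟨l ++ l', by simp [hl, hl'], by simp⟩

section Graded

variable [DirectSum.Decomposition 𝒱]

/-- The inclusion of `V` with values in the direct sum of the graded pieces of `S(V)`. -/
def gradedι : V →ₗ[K] ⨁ d, grading 𝒱 d :=
  DirectSum.toModule K ℤ _ (fun i => DirectSum.lof K ℤ (fun d => grading 𝒱 d) i ∘ₗ
    ((ι 𝒱).restrict fun _ hv => ι_mem_grading hv)) ∘ₗ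
    (DirectSum.decomposeLinearEquiv 𝒱).toLinearMap

theorem gradedι_of_mem {i : ℤ} {v : V} (hv : v ∈ 𝒱 i) :
    gradedι 𝒱 v = DirectSum.of (fun d => grading 𝒱 d) i ⟨ι 𝒱 v, ι_mem_grading hv⟩ := by
  simp only [gradedι, LinearMap.comp_apply, LinearEquiv.coe_coe,
    DirectSum.decomposeLinearEquiv_apply]
  rw [DirectSum.decompose_of_mem 𝒱 hv, ← DirectSum.lof_eq_of K, DirectSum.toModule_lof]
  rfl

/-- The algebra morphism that splits an element of `S(V)` into its homogeneous components. -/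
def split : Sym 𝒱 →ₐ[K] ⨁ d, grading 𝒱 d :=
  lift 𝒱 (A := ⨁ d, grading 𝒱 d) (gradedι 𝒱) (by
    intro i j x y hx hy
    change gradedι 𝒱 x * gradedι 𝒱 y = ksign K (i * j) • (gradedι 𝒱 y * gradedι 𝒱 x)
    rw [gradedι_of_mem 𝒱 hx, gradedι_of_mem 𝒱 hy, DirectSum.of_mul_of, DirectSum.of_mul_of,
      ← DirectSum.lof_eq_of K, ← DirectSum.lof_eq_of K, ← map_smul]
    exact DirectSum.of_eq_of_gradedMonoid_eq
      (Sigma.subtype_ext (add_comm i j) (ι_mul_ι hx hy)))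

theorem split_list (l : List (Σ i : ℤ, 𝒱 i))
    (h : (l.map fun a => ι 𝒱 (a.2 : V)).prod ∈ grading 𝒱 (l.map Sigma.fst).sum) :
    split 𝒱 (l.map fun a => ι 𝒱 (a.2 : V)).prod =
      DirectSum.of (fun d => grading 𝒱 d) (l.map Sigma.fst).sum ⟨_, h⟩ := by
  induction l with
  | nil =>
    simp only [List.map_nil, List.prod_nil, map_one]
    rfl
  | cons a l ih =>
    have h' : (l.map fun a => ι 𝒱 (a.2 : V)).prod ∈ grading 𝒱 (l.map Sigma.fst).sum :=
      Submodule.subset_span ⟨l, rfl, rfl⟩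
    simp only [List.map_cons, List.prod_cons, map_mul, ih h']
    rw [split, lift_ι, gradedι_of_mem 𝒱 a.2.2, DirectSum.of_mul_of]
    exact DirectSum.of_eq_of_gradedMonoid_eq (Sigma.subtype_ext List.sum_cons.symm rfl)

theorem split_coe (d : ℤ) (x : grading 𝒱 d) :
    split 𝒱 (x : Sym 𝒱) = DirectSum.of (fun d => grading 𝒱 d) d x := by
  obtain ⟨x, hx⟩ := x
  dsimp only
  rw [← DirectSum.lof_eq_of K]
  induction hx using Submodule.span_induction with
  | mem x h =>
    obtain ⟨l, rfl, rfl⟩ := h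
    exact split_list 𝒱 l _
  | zero =>
    rw [map_zero]
    exact (map_zero _).symm
  | add x y hx hy ihx ihy =>
    rw [map_add, ihx, ihy, ← map_add]
    rfl
  | smul a x hx ih =>
    rw [map_smul, ih, ← map_smul]
    rfl

instance : GradedAlgebra (grading 𝒱) :=
  GradedAlgebra.ofAlgHom _ (split 𝒱)
    (by
      refine algHom_ext 𝒱 fun v => ?_
      change DirectSum.coeAlgHom (grading 𝒱) (split 𝒱 (ι 𝒱 v)) = ι 𝒱 v
      rw [split, lift_ι]
      induction v using DirectSum.Decomposition.inductionOn 𝒱 with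
      | zero => simp
      | homogeneous v => rw [gradedι_of_mem 𝒱 v.2, DirectSum.coeAlgHom_of]
      | add v w hv hw => rw [map_add, map_add, hv, hw, map_add])
    (split_coe 𝒱)

theorem comul_aux (i j : ℤ) (x y : V) (hx : x ∈ 𝒱 i) (hy : y ∈ 𝒱 j) :
    let f : V →ₗ[K] GradedTensorProduct K (grading 𝒱) (grading 𝒱) :=
      (GradedTensorProduct.includeLeft (grading 𝒱) (grading 𝒱)).toLinearMap ∘ₗ ι 𝒱 +
        (GradedTensorProduct.includeRight (grading 𝒱) (grading 𝒱)).toLinearMap ∘ₗ ι 𝒱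
    f x * f y = ksign K (i * j) • (f y * f x) := by
  intro f
  let L := GradedTensorProduct.includeLeft (grading 𝒱) (grading 𝒱)
  let R := GradedTensorProduct.includeRight (grading 𝒱) (grading 𝒱)
  have hf : ∀ v, f v = L (ι 𝒱 v) + R (ι 𝒱 v) := fun v => rfl
  have hLR : ∀ a b, L a * R b = GradedTensorProduct.tmul K a b := fun a b =>
    GradedTensorProduct.tmul_one_mul_one_tmul _ _ a b
  have hRL : ∀ {i j : ℤ} {x y : V}, x ∈ 𝒱 i → y ∈ 𝒱 j →
      R (ι 𝒱 x) * L (ι 𝒱 y) = ksign K (i * j) • (L (ι 𝒱 y) * R (ι 𝒱 x)) := by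
    intro i j x y hx hy
    have h := GradedTensorProduct.tmul_coe_mul_coe_tmul (R := K) (grading 𝒱) (grading 𝒱) 1
      ⟨ι 𝒱 x, ι_mem_grading hx⟩ ⟨ι 𝒱 y, ι_mem_grading hy⟩ 1
    rw [hLR, ksign, Int.cast_smul_eq_zsmul]
    rw [mul_one, one_mul] at h
    exact h
  have hs : ksign K (i * j) * ksign K (j * i) = 1 := by
    rw [mul_comm j i, ksign, ← Int.cast_mul, ← Units.val_mul, Int.units_mul_self]
    simp
  simp only [hf, add_mul, mul_add, smul_add]
  rw [hRL hx hy, hRL hy hx, ← map_mul L, ← map_mul R, ← map_mul L, ← map_mul R, ι_mul_ι hx hy,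
    map_smul, map_smul, smul_smul, hs, one_smul]
  abel

/-- The coproduct `Δ : S^c(V) → S^c(V) ⊗ S^c(V)`: the unique morphism of graded algebras with
`Δ v = v ⊗ 1 + 1 ⊗ v` for `v ∈ V`, where the product of `S(V) ⊗ S(V)` is the one with the Koszul
sign, `(a ⊗ b)(a' ⊗ b') = (-1)^{|b||a'|} aa' ⊗ bb'`. On `v₁ ⊙ ⋯ ⊙ vₙ` it is the signed sum over
all unshuffles. -/
def comul : Sym 𝒱 →ₗ[K] Sym 𝒱 ⊗[K] Sym 𝒱 :=
  (GradedTensorProduct.of K (grading 𝒱) (grading 𝒱)).symm.toLinearMap ∘ₗ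
    (lift 𝒱 ((GradedTensorProduct.includeLeft (grading 𝒱) (grading 𝒱)).toLinearMap ∘ₗ ι 𝒱 +
      (GradedTensorProduct.includeRight (grading 𝒱) (grading 𝒱)).toLinearMap ∘ₗ ι 𝒱)
      (comul_aux 𝒱)).toLinearMap

/-- The linear map `x ↦ (-1)^{|x|} x` of `S(V)`. -/
def signMap : Sym 𝒱 →ₗ[K] Sym 𝒱 :=
  DirectSum.toModule K ℤ (Sym 𝒱) (fun d => ksign K d • (grading 𝒱 d).subtype) ∘ₗ
    (DirectSum.decomposeLinearEquiv (grading 𝒱)).toLinearMap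

/-- A coderivation of degree `1` of `S^c(V)`: a linear map `Q` of degree `1` with
`Δ Q = (Q ⊗ id + id ⊗ Q) Δ`, where `(id ⊗ Q)(a ⊗ b) = (-1)^{|a|} a ⊗ Q b`. -/
structure IsCoderivation (Q : Sym 𝒱 →ₗ[K] Sym 𝒱) : Prop where
  degree : HasDegree (grading 𝒱) (grading 𝒱) 1 Q
  comul_comp : comul 𝒱 ∘ₗ Q =
    (TensorProduct.map Q LinearMap.id + TensorProduct.map (signMap 𝒱) Q) ∘ₗ comul 𝒱

variable [DirectSum.Decomposition 𝒲]

/-- A morphism of graded, counital and coaugmented coalgebras `S^c(V) → S^c(W)`. -/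
structure IsCoalgHom (F : Sym 𝒱 →ₗ[K] Sym 𝒲) : Prop where
  degree : HasDegree (grading 𝒱) (grading 𝒲) 0 F
  comul_comp : comul 𝒲 ∘ₗ F = TensorProduct.map F F ∘ₗ comul 𝒱
  counit_comp : counit 𝒲 ∘ₗ F = counit 𝒱
  map_one : F 1 = 1

end Graded

variable {𝒱 𝒲}

/-- The Taylor coefficients `fₙ : V^{⊙n} → W` of a linear map `F : S^c(V) → S^c(W)`, as
multilinear maps: `fₙ(v₁, …, vₙ) = p (F (v₁ ⊙ ⋯ ⊙ vₙ))`. -/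
def taylor (F : Sym 𝒱 →ₗ[K] Sym 𝒲) (n : ℕ) : MultilinearMap K (fun _ : Fin n => V) W :=
  (proj 𝒲 ∘ₗ F).compMultilinearMap (prod 𝒱 n)

/-- The linear part `f₁ : V → W`. -/
def linearPart (F : Sym 𝒱 →ₗ[K] Sym 𝒲) : V →ₗ[K] W := proj 𝒲 ∘ₗ F ∘ₗ ι 𝒱

theorem taylor_one (F : Sym 𝒱 →ₗ[K] Sym 𝒲) (v : Fin 1 → V) :
    taylor F 1 v = linearPart F (v 0) := by
  simp [taylor, linearPart, prod]

theorem proj_hasDegree : HasDegree (grading 𝒱) 𝒱 0 (proj 𝒱) := by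
  intro d x hx
  rw [add_zero]
  induction hx using Submodule.span_induction with
  | mem x h =>
    obtain ⟨l, rfl, rfl⟩ := h
    match l with
    | [] => simp [proj_one]
    | [a] => simp [proj_ι]
    | a :: b :: l => simp [proj_ι_mul_ι_mul]
  | zero => simp
  | add x y hx hy ihx ihy =>
    rw [map_add]
    exact add_mem ihx ihy
  | smul a x hx ih =>
    rw [map_smul]
    exact Submodule.smul_mem _ _ ih

/-- The functoriality of `S(V)` for linear maps of degree `0`. -/
def map (f : V →ₗ[K] W) (hf : HasDegree 𝒱 𝒲 0 f) : Sym 𝒱 →ₐ[K] Sym 𝒲 :=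
  lift 𝒱 (ι 𝒲 ∘ₗ f) fun i j x y hx hy => by
    have hx' := hf i x hx
    have hy' := hf j y hy
    rw [add_zero] at hx' hy'
    exact ι_mul_ι hx' hy'

@[simp]
theorem map_ι (f : V →ₗ[K] W) (hf : HasDegree 𝒱 𝒲 0 f) (v : V) :
    map f hf (ι 𝒱 v) = ι 𝒲 (f v) := by
  simp [map]

theorem map_hasDegree (f : V →ₗ[K] W) (hf : HasDegree 𝒱 𝒲 0 f) :
    HasDegree (grading 𝒱) (grading 𝒲) 0 (map f hf).toLinearMap := by
  intro d x hx
  rw [add_zero]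
  induction hx using Submodule.span_induction with
  | mem x h =>
    obtain ⟨l, rfl, rfl⟩ := h
    refine Submodule.subset_span
      ⟨l.map fun a => ⟨a.1, f a.2, by simpa using hf a.1 a.2 a.2.2⟩, ?_, ?_⟩
    · simp [Function.comp_def]
    · simp [map_list_prod, Function.comp_def]
  | zero => simp
  | add x y hx hy ihx ihy =>
    rw [map_add]
    exact add_mem ihx ihy
  | smul a x hx ih =>
    rw [map_smul]
    exact Submodule.smul_mem _ _ ih

theorem map_mem_power (f : V →ₗ[K] W) (hf : HasDegree 𝒱 𝒲 0 f) (n : ℕ) {x : Sym 𝒱}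
    (hx : x ∈ power 𝒱 n) : map f hf x ∈ power 𝒲 n := by
  have h : (power 𝒱 n).map (map f hf).toLinearMap ≤ power 𝒲 n := by
    rw [power, Submodule.map_pow, power]
    refine pow_le_pow_left₀ (by simp) ?_ n
    rintro _ ⟨_, ⟨v, rfl⟩, rfl⟩
    exact ⟨f v, (map_ι f hf v).symm⟩
  exact h ⟨x, hx, rfl⟩

end Sym

end SymmetricCoalgebra

section Cohomology

variable {K V W : Type*} [Field K] [AddCommGroup V] [Module K V] [AddCommGroup W] [Module K W]

/-- The cohomology `ker d / im d` of a differential `d`. -/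
abbrev Cohomology (d : V →ₗ[K] V) : Type _ :=
  LinearMap.ker d ⧸ (LinearMap.range d).submoduleOf (LinearMap.ker d)

/-- The class of a cocycle. -/
abbrev Cohomology.mk (d : V →ₗ[K] V) : LinearMap.ker d →ₗ[K] Cohomology d :=
  ((LinearMap.range d).submoduleOf (LinearMap.ker d)).mkQ

/-- The graded piece `Hⁱ` of the cohomology: the classes of the cocycles in `Vⁱ`. -/
def Cohomology.grading (𝒱 : ℤ → Submodule K V) (d : V →ₗ[K] V) (i : ℤ) :
    Submodule K (Cohomology d) :=
  ((𝒱 i).submoduleOf (LinearMap.ker d)).map (Cohomology.mk d)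

/-- The map induced in cohomology by a map of complexes. -/
def Cohomology.map {d : V →ₗ[K] V} {d' : W →ₗ[K] W} (f : V →ₗ[K] W) (h : f ∘ₗ d = d' ∘ₗ f) :
    Cohomology d →ₗ[K] Cohomology d' :=
  Submodule.mapQ _ _
    (f.restrict (p := LinearMap.ker d) (q := LinearMap.ker d') fun v hv => by
      rw [LinearMap.mem_ker] at hv ⊢
      rw [← LinearMap.comp_apply, ← h, LinearMap.comp_apply, hv, map_zero])
    (by
      rintro x ⟨y, hy⟩
      exact ⟨f y, by
        change d' (f y) = f x
        rw [← LinearMap.comp_apply, ← h, LinearMap.comp_apply, hy]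
        rfl⟩)

/-- `f` is a morphism of complexes that induces an isomorphism in cohomology. -/
def IsQuasiIso (d : V →ₗ[K] V) (d' : W →ₗ[K] W) (f : V →ₗ[K] W) : Prop :=
  ∃ h : f ∘ₗ d = d' ∘ₗ f, Function.Bijective (Cohomology.map f h)

section Decomposition

variable (𝒱 : ℤ → Submodule K V) [DirectSum.Decomposition 𝒱]

/-- The projection of `V` onto its component of degree `i`. -/
def component (i : ℤ) : V →ₗ[K] V :=
  (𝒱 i).subtype ∘ₗ DirectSum.component K ℤ (fun i => 𝒱 i) i ∘ₗ
    (DirectSum.decomposeLinearEquiv 𝒱).toLinearMap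

theorem component_apply (i : ℤ) (v : V) : component 𝒱 i v = (DirectSum.decompose 𝒱 v i : V) := rfl

theorem component_comm {d : V →ₗ[K] V} (hd : HasDegree 𝒱 𝒱 1 d) (i : ℤ) (v : V) :
    d (component 𝒱 i v) = component 𝒱 (i + 1) (d v) := by
  induction v using DirectSum.Decomposition.inductionOn 𝒱 with
  | zero => simp
  | @homogeneous j v =>
    rw [component_apply, component_apply]
    by_cases h : j = i
    · subst h
      rw [DirectSum.decompose_of_mem_same 𝒱 v.2, DirectSum.decompose_of_mem_same 𝒱 (hd j v v.2)]
    · rw [DirectSum.decompose_of_mem_ne 𝒱 v.2 h,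
        DirectSum.decompose_of_mem_ne 𝒱 (hd j v v.2) (by omega), map_zero]
  | add v w hv hw => simp only [map_add, hv, hw]

theorem component_mem_ker {d : V →ₗ[K] V} (hd : HasDegree 𝒱 𝒱 1 d) (i : ℤ) {v : V}
    (hv : v ∈ LinearMap.ker d) : component 𝒱 i v ∈ LinearMap.ker d := by
  rw [LinearMap.mem_ker] at hv ⊢
  rw [component_comm 𝒱 hd, hv, map_zero]

/-- The projection of the cohomology onto its component of degree `i`. -/
def cohomologyComponent {d : V →ₗ[K] V} (hd : HasDegree 𝒱 𝒱 1 d) (i : ℤ) :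
    Cohomology d →ₗ[K] Cohomology d :=
  Submodule.mapQ _ _
    ((component 𝒱 i).restrict fun _ hv => component_mem_ker 𝒱 hd i hv)
    (by
      rintro x ⟨y, hy⟩
      refine ⟨component 𝒱 (i - 1) y, ?_⟩
      rw [component_comm 𝒱 hd, hy, sub_add_cancel]
      rfl)

theorem cohomologyComponent_mk {d : V →ₗ[K] V} (hd : HasDegree 𝒱 𝒱 1 d) (i : ℤ)
    (x : LinearMap.ker d) : cohomologyComponent 𝒱 hd i (Cohomology.mk d x) =
      Cohomology.mk d ⟨component 𝒱 i x, component_mem_ker 𝒱 hd i x.2⟩ := rfl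

theorem cohomologyComponent_of_mem {d : V →ₗ[K] V} (hd : HasDegree 𝒱 𝒱 1 d) (i j : ℤ)
    {x : Cohomology d} (hx : x ∈ Cohomology.grading 𝒱 d i) :
    cohomologyComponent 𝒱 hd j x = if i = j then x else 0 := by
  obtain ⟨v, hv, rfl⟩ := hx
  have hv' : (v : V) ∈ 𝒱 i := hv
  rw [cohomologyComponent_mk]
  split_ifs with h
  · subst h
    congr 1
    exact Subtype.ext (DirectSum.decompose_of_mem_same 𝒱 hv')
  · rw [← map_zero (Cohomology.mk d)]
    congr 1
    exact Subtype.ext (DirectSum.decompose_of_mem_ne 𝒱 hv' h)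

theorem cohomology_isInternal {d : V →ₗ[K] V} (hd : HasDegree 𝒱 𝒱 1 d) :
    DirectSum.IsInternal (Cohomology.grading 𝒱 d) := by
  classical
  constructor
  · rw [injective_iff_map_eq_zero]
    intro x hx
    ext j
    have h : ∀ x : ⨁ i, Cohomology.grading 𝒱 d i,
        cohomologyComponent 𝒱 hd j (DirectSum.coeAddMonoidHom (Cohomology.grading 𝒱 d) x) =
          (x j : Cohomology d) := by
      intro x
      induction x using DirectSum.induction_on with
      | zero => simp
      | of i x =>
        rw [DirectSum.coeAddMonoidHom_of, cohomologyComponent_of_mem 𝒱 hd i j x.2,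
          DirectSum.coe_of_apply]
        split_ifs <;> rfl
      | add x y hx hy => simp only [map_add, hx, hy, DirectSum.add_apply, Submodule.coe_add]
    rw [← h, hx, map_zero]
    rfl
  · intro x
    obtain ⟨v, rfl⟩ := Submodule.mkQ_surjective _ x
    let s := (DirectSum.decompose 𝒱 (v : V)).support
    let c : ℤ → LinearMap.ker d := fun i => ⟨component 𝒱 i v, component_mem_ker 𝒱 hd i v.2⟩
    have hc : ∀ i, Cohomology.mk d (c i) ∈ Cohomology.grading 𝒱 d i := fun i =>
      ⟨c i, (DirectSum.decompose 𝒱 (v : V) i).2, rfl⟩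
    refine ⟨∑ i ∈ s, DirectSum.of (fun i => Cohomology.grading 𝒱 d i) i ⟨_, hc i⟩, ?_⟩
    rw [map_sum]
    simp only [DirectSum.coeAddMonoidHom_of]
    rw [← map_sum]
    congr 1
    ext
    rw [AddSubmonoidClass.coe_finsetSum]
    exact DirectSum.sum_support_decompose 𝒱 (v : V)

end Decomposition

end Cohomology

section Algebras

variable {K V W : Type*} [Field K] [AddCommGroup V] [Module K V] [AddCommGroup W] [Module K W]

/-- An `L∞[1]` algebra structure on the graded vector space `V`: a coderivation `Q` of degree `1` of
`S^c(V)` with vanishing constant part and `Q ∘ Q = 0`. -/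
structure LInftyStr (𝒱 : ℤ → Submodule K V) [DirectSum.Decomposition 𝒱] where
  /-- The codifferential. -/
  Q : Sym 𝒱 →ₗ[K] Sym 𝒱
  isCoderivation : Sym.IsCoderivation 𝒱 Q
  proj_Q_one : Sym.proj 𝒱 (Q 1) = 0
  Q_comp_Q : Q ∘ₗ Q = 0

namespace LInftyStr

variable {𝒱 : ℤ → Submodule K V} [DirectSum.Decomposition 𝒱]
  {𝒲 : ℤ → Submodule K W} [DirectSum.Decomposition 𝒲]

/-- The Taylor coefficients `qₙ` of the structure. -/
def q (A : LInftyStr 𝒱) (n : ℕ) : MultilinearMap K (fun _ : Fin n => V) V := Sym.taylor A.Q n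

/-- The differential `q₁` of the tangent complex. -/
def q₁ (A : LInftyStr 𝒱) : V →ₗ[K] V := Sym.linearPart A.Q

theorem q₁_hasDegree (A : LInftyStr 𝒱) : HasDegree 𝒱 𝒱 1 A.q₁ := by
  intro i v hv
  have h := Sym.proj_hasDegree (𝒱 := 𝒱) _ _
    (A.isCoderivation.degree i _ (Sym.ι_mem_grading hv))
  rwa [add_zero] at h

/-- The tangent cohomology `H(V, q₁)`. -/
abbrev H (A : LInftyStr 𝒱) : Type _ := Cohomology A.q₁

/-- The grading of the tangent cohomology. -/
abbrev gradingH (A : LInftyStr 𝒱) : ℤ → Submodule K A.H := Cohomology.grading 𝒱 A.q₁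

instance (A : LInftyStr 𝒱) : DirectSum.Decomposition A.gradingH :=
  (cohomology_isInternal 𝒱 A.q₁_hasDegree).chooseDecomposition

/-- An `L∞[1]` morphism `(V, Q) ⇢ (W, R)`: a morphism of DG coalgebras `S^c(V) → S^c(W)`. -/
structure IsMorphism (A : LInftyStr 𝒱) (B : LInftyStr 𝒲) (F : Sym 𝒱 →ₗ[K] Sym 𝒲) : Prop where
  isCoalgHom : Sym.IsCoalgHom 𝒱 𝒲 F
  comp_Q : F ∘ₗ A.Q = B.Q ∘ₗ F

/-- A weak equivalence: an `L∞[1]` morphism whose linear part is a quasi-isomorphism of the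
tangent complexes. -/
structure IsWeakEquiv (A : LInftyStr 𝒱) (B : LInftyStr 𝒲) (F : Sym 𝒱 →ₗ[K] Sym 𝒲) : Prop where
  isMorphism : IsMorphism A B F
  isQuasiIso : IsQuasiIso A.q₁ B.q₁ (Sym.linearPart F)

/-- `R` is the `L∞[1]` structure `(0, r₂, 0, 0, …)` on `H(V, q₁)`, where `r₂` is the bracket induced
by `q₂`, that is `r₂([x], [y]) = [q₂(x, y)]`. As a coderivation is determined by its Taylor
coefficients, there is at most one such `R`. -/
structure IsInducedBracket (A : LInftyStr 𝒱) (R : LInftyStr A.gradingH) : Prop where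
  two : ∀ x y : LinearMap.ker A.q₁, ∃ h : A.q 2 ![(x : V), (y : V)] ∈ LinearMap.ker A.q₁,
    R.q 2 ![Cohomology.mk A.q₁ x, Cohomology.mk A.q₁ y] = Cohomology.mk A.q₁ ⟨_, h⟩
  ne_two : ∀ n : ℕ, n ≠ 2 → R.q n = 0

/-- `(V, Q)` is formal: there is a weak equivalence `(V, Q) ⇢ (H(V, q₁), r₂)`. -/
def IsFormal (A : LInftyStr 𝒱) : Prop :=
  ∃ R : LInftyStr A.gradingH, A.IsInducedBracket R ∧
    ∃ F : Sym 𝒱 →ₗ[K] Sym A.gradingH, IsWeakEquiv A R F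

end LInftyStr

end Algebras

section Equivariance

variable {K G V W : Type*} [Field K] [Group G] [AddCommGroup V] [Module K V]
  [AddCommGroup W] [Module K W] {𝒱 : ℤ → Submodule K V} {𝒲 : ℤ → Submodule K W}

/-- A representation of `G` on the graded vector space `V`: every `g` acts with degree `0`. -/
def IsGradedRep (𝒱 : ℤ → Submodule K V) (ρ : Representation K G V) : Prop :=
  ∀ g : G, HasDegree 𝒱 𝒱 0 (ρ g)

/-- The `G`-module `Vⁱ`. -/
def gradedPiece (ρ : Representation K G V) (hρ : IsGradedRep 𝒱 ρ) (i : ℤ) :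
    Subrepresentation ρ where
  toSubmodule := 𝒱 i
  apply_mem_toSubmodule g v hv := by simpa using hρ g i v hv

/-- The action of `G` on `S(V)`, `g (v₁ ⊙ ⋯ ⊙ vₙ) = g v₁ ⊙ ⋯ ⊙ g vₙ`. -/
def symRep (ρ : Representation K G V) (hρ : IsGradedRep 𝒱 ρ) : Representation K G (Sym 𝒱) where
  toFun g := (Sym.map (ρ g) (hρ g)).toLinearMap
  map_one' := by
    have h : Sym.map (ρ 1) (hρ 1) = AlgHom.id K (Sym 𝒱) := Sym.algHom_ext 𝒱 fun v => by simp
    rw [h]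
    rfl
  map_mul' g g' := by
    have h : Sym.map (ρ (g * g')) (hρ (g * g')) = (Sym.map (ρ g) (hρ g)).comp
        (Sym.map (ρ g') (hρ g')) := Sym.algHom_ext 𝒱 fun v => by simp
    rw [h]
    rfl

/-- The `G`-module `V^{⊙n}`. -/
def powerRep (ρ : Representation K G V) (hρ : IsGradedRep 𝒱 ρ) (n : ℕ) :
    Subrepresentation (symRep ρ hρ) where
  toSubmodule := Sym.power 𝒱 n
  apply_mem_toSubmodule g _ hv := Sym.map_mem_power (ρ g) (hρ g) n hv

/-- The `G`-module `Hom^j(V^{⊙n}, V)` of linear maps of degree `j`, with the action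
`(g φ)(x) = g (φ (g⁻¹ x))`. -/
def homRep (ρ : Representation K G V) (hρ : IsGradedRep 𝒱 ρ) (j : ℤ) (n : ℕ) :
    Subrepresentation (Representation.linHom (powerRep ρ hρ n).toRepresentation ρ) where
  toSubmodule :=
    { carrier := {φ | HasDegree (fun i => (Sym.grading 𝒱 i).submoduleOf (Sym.power 𝒱 n)) 𝒱 j φ}
      add_mem' := fun ha hb i x hx => add_mem (ha i x hx) (hb i x hx)
      zero_mem' := fun i _ _ => zero_mem (𝒱 (i + j))
      smul_mem' := fun c _ ha i x hx => Submodule.smul_mem _ c (ha i x hx) }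
  apply_mem_toSubmodule g φ hφ := by
    intro i x hx
    have h1 := Sym.map_hasDegree (ρ g⁻¹) (hρ g⁻¹) i x hx
    rw [add_zero] at h1
    have h2 := hρ g _ _ (hφ i ((powerRep ρ hρ n).toRepresentation g⁻¹ x) h1)
    rw [add_zero] at h2
    exact h2

/-- A linear map `S^c(V) → S^c(W)` whose Taylor coefficients are `G`-equivariant:
`g fₙ(v₁, …, vₙ) = fₙ(g v₁, …, g vₙ)` for all `n ≥ 1`. -/
def IsEquivariant (ρ : Representation K G V) (σ : Representation K G W)
    (F : Sym 𝒱 →ₗ[K] Sym 𝒲) : Prop :=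
  ∀ (g : G) (n : ℕ), 1 ≤ n → ∀ v : Fin n → V,
    σ g (Sym.taylor F n v) = Sym.taylor F n fun k => ρ g (v k)

/-- The action of `G` on the cohomology of an equivariant differential. -/
def cohomologyRep (ρ : Representation K G V) (d : V →ₗ[K] V)
    (hd : ∀ (g : G) (v : V), ρ g (d v) = d (ρ g v)) : Representation K G (Cohomology d) :=
  (ρ.subrepresentation (LinearMap.ker d) fun g v hv => by
    rw [LinearMap.mem_ker] at hv
    rw [Submodule.mem_comap, LinearMap.mem_ker, ← hd, hv, map_zero]).quotient
    ((LinearMap.range d).submoduleOf (LinearMap.ker d)) fun g x hx => by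
      obtain ⟨y, hy⟩ := hx
      refine ⟨ρ g y, ?_⟩
      rw [← hd, hy]
      rfl

namespace LInftyStr

variable [DirectSum.Decomposition 𝒱] {ρ : Representation K G V}

/-- The `L∞[1]` structure is `G`-equivariant. -/
def IsEquivariant (A : LInftyStr 𝒱) (ρ : Representation K G V) : Prop :=
  LInfty.IsEquivariant ρ ρ A.Q

/-- The action of `G` on the tangent cohomology of a `G`-equivariant `L∞[1]` algebra. -/
def repH (A : LInftyStr 𝒱) (hA : A.IsEquivariant ρ) : Representation K G A.H :=
  cohomologyRep ρ A.q₁ fun g v => by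
    simpa only [Sym.taylor_one] using! hA g 1 le_rfl fun _ => v

theorem repH_isGradedRep (A : LInftyStr 𝒱) (hA : A.IsEquivariant ρ) (hρ : IsGradedRep 𝒱 ρ) :
    IsGradedRep A.gradingH (A.repH hA) := by
  rintro g i _ ⟨v, hv, rfl⟩
  exact ⟨_, hρ g i v hv, rfl⟩

/-- `(V, Q)` is `G`-equivariantly formal: there is a `G`-equivariant weak equivalence
`(H(V, q₁), r₂) ⇢ (V, Q)`. -/
def IsEquivariantlyFormal (A : LInftyStr 𝒱) (hA : A.IsEquivariant ρ) : Prop :=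
  ∃ R : LInftyStr A.gradingH, A.IsInducedBracket R ∧
    ∃ F : Sym A.gradingH →ₗ[K] Sym 𝒱, IsWeakEquiv R A F ∧ LInfty.IsEquivariant (A.repH hA) ρ F

end LInftyStr

end Equivariance

end LInfty

end

/-!
An equivariant weak equivalence is built weight by weight, and the given one serves to show that the
obstructions vanish. Semisimplicity of the `V^i` gives an equivariant `h` of degree `-1` with
`q₁ h q₁ = q₁`, so that `[z] ↦ z - q₁ (h z)` is an equivariant embedding of the cohomology into `V`.
It is extended to an equivariant morphism `F : (H, r₂) ⇢ (V, Q)` one Taylor coefficient at a time,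
using that a coalgebra morphism is the convolution exponential of its Taylor coefficients. If `F`
commutes with the codifferentials below weight `n`, its defect in weight `n` is a `q₁`-cocycle and
determines a class `c : H^{⊙n} → H`. Composition with the given weak equivalence `(V, Q) ⇢ (H, r₂)`
turns `c` into the defect of a coalgebra automorphism of `S(H)`. As `r₂` is quadratic, commuting
with the Euler coderivation exhibits that defect as a bracket with `r₂`, up to a factor which is
invertible in characteristic `0`. Semisimplicity of `Hom⁰(H^{⊙(n-1)}, H)` makes the primitive
invariant; correcting `F` by it removes the class, and `h` then provides the next Taylor
coefficient.
-/

noncomputable section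

namespace LInfty

/-! ### Graded vector spaces -/

section Decomposition

variable {I R M N : Type*} [DecidableEq I] [Semiring R] [AddCommMonoid M] [Module R M]
  [AddCommMonoid N] [Module R N] (ℳ : I → Submodule R M) [DirectSum.Decomposition ℳ]

theorem linearMap_ext_of_mem {f g : M →ₗ[R] N} (h : ∀ i, ∀ x ∈ ℳ i, f x = g x) : f = g :=
  DirectSum.decompose_lhom_ext ℳ fun i => LinearMap.ext fun x => h i x x.2

/-- The linear map on a graded module that restricts to `f i` on the component of index `i`. -/
def ofComponents (f : I → M →ₗ[R] N) : M →ₗ[R] N :=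
  DirectSum.toModule R I N (fun i => f i ∘ₗ (ℳ i).subtype) ∘ₗ
    (DirectSum.decomposeLinearEquiv ℳ).toLinearMap

theorem ofComponents_of_mem (f : I → M →ₗ[R] N) {i : I} {x : M} (hx : x ∈ ℳ i) :
    ofComponents ℳ f x = f i x := by
  simp only [ofComponents, LinearMap.comp_apply, LinearEquiv.coe_coe,
    DirectSum.decomposeLinearEquiv_apply]
  rw [DirectSum.decompose_of_mem ℳ hx, ← DirectSum.lof_eq_of R, DirectSum.toModule_lof]
  rfl

end Decomposition

section Degree

variable {K U V W : Type*} [Field K] [AddCommGroup U] [Module K U] [AddCommGroup V] [Module K V]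
  [AddCommGroup W] [Module K W]
  {𝒰 : ℤ → Submodule K U} {𝒱 : ℤ → Submodule K V} {𝒲 : ℤ → Submodule K W} {j : ℤ}

theorem hasDegree_zero_iff {f : V →ₗ[K] W} :
    HasDegree 𝒱 𝒲 0 f ↔ ∀ i, ∀ v ∈ 𝒱 i, f v ∈ 𝒲 i := by
  simp only [HasDegree, add_zero]

theorem HasDegree.map_mem {f : V →ₗ[K] W} (hf : HasDegree 𝒱 𝒲 0 f) {i : ℤ} {v : V}
    (hv : v ∈ 𝒱 i) : f v ∈ 𝒲 i :=
  hasDegree_zero_iff.mp hf i v hv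

theorem HasDegree.comp {k l : ℤ} {f : V →ₗ[K] W} {g : W →ₗ[K] U} (hg : HasDegree 𝒲 𝒰 k g)
    (hf : HasDegree 𝒱 𝒲 j f) (h : j + k = l) : HasDegree 𝒱 𝒰 l (g ∘ₗ f) := by
  intro i v hv
  rw [← h, ← add_assoc]
  exact hg _ _ (hf i v hv)

theorem HasDegree.add {f g : V →ₗ[K] W} (hf : HasDegree 𝒱 𝒲 j f) (hg : HasDegree 𝒱 𝒲 j g) :
    HasDegree 𝒱 𝒲 j (f + g) :=
  fun i v hv => add_mem (hf i v hv) (hg i v hv)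

theorem HasDegree.sub {f g : V →ₗ[K] W} (hf : HasDegree 𝒱 𝒲 j f) (hg : HasDegree 𝒱 𝒲 j g) :
    HasDegree 𝒱 𝒲 j (f - g) :=
  fun i v hv => sub_mem (hf i v hv) (hg i v hv)

theorem HasDegree.neg {f : V →ₗ[K] W} (hf : HasDegree 𝒱 𝒲 j f) : HasDegree 𝒱 𝒲 j (-f) :=
  fun i v hv => neg_mem (hf i v hv)

theorem HasDegree.smul {f : V →ₗ[K] W} (c : K) (hf : HasDegree 𝒱 𝒲 j f) :
    HasDegree 𝒱 𝒲 j (c • f) :=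
  fun i v hv => Submodule.smul_mem _ c (hf i v hv)

variable [DirectSum.Decomposition 𝒱] [DirectSum.Decomposition 𝒲]

theorem component_of_mem {i : ℤ} {v : V} (hv : v ∈ 𝒱 i) : component 𝒱 i v = v :=
  DirectSum.decompose_of_mem_same 𝒱 hv

theorem component_mem (i : ℤ) (v : V) : component 𝒱 i v ∈ 𝒱 i := SetLike.coe_mem _

theorem HasDegree.map_component {f : V →ₗ[K] W} (hf : HasDegree 𝒱 𝒲 j f) (i : ℤ) (v : V) :
    f (component 𝒱 i v) = component 𝒲 (i + j) (f v) := by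
  suffices h : f ∘ₗ component 𝒱 i = component 𝒲 (i + j) ∘ₗ f from congr($h v)
  refine linearMap_ext_of_mem 𝒱 fun k v hv => ?_
  simp only [LinearMap.comp_apply, component_apply]
  by_cases hki : k = i
  · subst hki
    rw [DirectSum.decompose_of_mem_same 𝒱 hv, DirectSum.decompose_of_mem_same 𝒲 (hf k v hv)]
  · rw [DirectSum.decompose_of_mem_ne 𝒱 hv hki,
      DirectSum.decompose_of_mem_ne 𝒲 (hf k v hv) (by omega), map_zero]

theorem HasDegree.symm {f : V ≃ₗ[K] W} (hf : HasDegree 𝒱 𝒲 0 f.toLinearMap) :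
    HasDegree 𝒲 𝒱 0 f.symm.toLinearMap := by
  refine hasDegree_zero_iff.mpr fun i w hw => ?_
  have h : component 𝒱 i (f.symm w) = f.symm w := f.injective <| by
    simpa [component_of_mem hw] using hf.map_component i (f.symm w)
  exact h ▸ component_mem i (f.symm w)

end Degree

section Signs

variable (K : Type*) [Field K]

theorem ksign_add (m n : ℤ) : ksign K (m + n) = ksign K m * ksign K n := by
  simp [ksign, Int.negOnePow_add]

theorem ksign_zero : ksign K 0 = 1 := by simp [ksign]

end Signs

/-! ### The symmetric algebra and its coproduct -/

namespace Sym

section SymmetricAlgebra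

variable {K V W : Type*} [Field K] [AddCommGroup V] [Module K V] [AddCommGroup W] [Module K W]
  {𝒱 : ℤ → Submodule K V} {𝒲 : ℤ → Submodule K W}

section Generation

variable [DirectSum.Decomposition 𝒱]

theorem ι_mul_mem_of_homogeneous {P Q : Submodule K (Sym 𝒱)}
    (h : ∀ (i : ℤ) (v : V), v ∈ 𝒱 i → ∀ x ∈ P, ι 𝒱 v * x ∈ Q) (v : V) {x : Sym 𝒱} (hx : x ∈ P) :
    ι 𝒱 v * x ∈ Q := by
  induction v using DirectSum.Decomposition.inductionOn 𝒱 with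
  | zero => simp
  | @homogeneous i v => exact h i v v.2 x hx
  | add v w hv hw =>
    rw [map_add, add_mul]
    exact add_mem hv hw

theorem eq_top_of_one_mem_of_ι_mul_mem (P : Submodule K (Sym 𝒱)) (one : 1 ∈ P)
    (ι_mul : ∀ (i : ℤ) (v : V), v ∈ 𝒱 i → ∀ x ∈ P, ι 𝒱 v * x ∈ P) : P = ⊤ := by
  let B : Subalgebra K (Sym 𝒱) :=
    { carrier := {a | ∀ x ∈ P, a * x ∈ P}
      mul_mem' := fun {a b} ha hb x hx => by rw [mul_assoc]; exact ha _ (hb _ hx)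
      add_mem' := fun {a b} ha hb x hx => by rw [add_mul]; exact add_mem (ha _ hx) (hb _ hx)
      algebraMap_mem' := fun r x hx => by rw [← Algebra.smul_def]; exact P.smul_mem _ hx }
  have ι_mem : ∀ v, ι 𝒱 v ∈ B := fun v x hx => ι_mul_mem_of_homogeneous ι_mul v hx
  let f : Sym 𝒱 →ₐ[K] B := lift 𝒱 ((ι 𝒱).codRestrict B.toSubmodule ι_mem) fun i j x y hx hy =>
    Subtype.ext (ι_mul_ι hx hy)
  have val_comp_f : B.val.comp f = AlgHom.id K _ := algHom_ext 𝒱 fun v => by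
    simp only [f, AlgHom.comp_apply, lift_ι]
    rfl
  refine eq_top_iff.mpr fun x _ => ?_
  have hx : x ∈ B := by
    rw [← AlgHom.id_apply (R := K) x, ← val_comp_f]
    exact (f x).2
  simpa using hx 1 one

theorem linearMap_ext_of_ι_mul {M : Type*} [AddCommGroup M] [Module K M] {f g : Sym 𝒱 →ₗ[K] M}
    (one : f 1 = g 1)
    (ι_mul : ∀ (i : ℤ) (v : V), v ∈ 𝒱 i → ∀ x, f x = g x → f (ι 𝒱 v * x) = g (ι 𝒱 v * x)) :
    f = g :=
  LinearMap.eqLocus_eq_top.mp (eq_top_of_one_mem_of_ι_mul_mem _ one ι_mul)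

end Generation

theorem power_zero : power 𝒱 0 = 1 := pow_zero _

theorem power_succ (n : ℕ) : power 𝒱 (n + 1) = LinearMap.range (ι 𝒱) * power 𝒱 n := pow_succ' _ _

theorem one_mem_power : (1 : Sym 𝒱) ∈ power 𝒱 0 := by
  rw [power_zero]
  exact Submodule.one_le.mp le_rfl

theorem ι_mul_mem_power (v : V) {n : ℕ} {x : Sym 𝒱} (hx : x ∈ power 𝒱 n) :
    ι 𝒱 v * x ∈ power 𝒱 (n + 1) := by
  rw [power_succ]
  exact Submodule.mul_mem_mul ⟨v, rfl⟩ hx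

theorem ι_mem_power (v : V) : ι 𝒱 v ∈ power 𝒱 1 := by
  simpa using ι_mul_mem_power v (one_mem_power (𝒱 := 𝒱))

theorem power_le [DirectSum.Decomposition 𝒱] (P : ℕ → Submodule K (Sym 𝒱)) (one : 1 ∈ P 0)
    (ι_mul : ∀ (n : ℕ) (i : ℤ) (v : V), v ∈ 𝒱 i → ∀ x ∈ P n, ι 𝒱 v * x ∈ P (n + 1)) (n : ℕ) :
    power 𝒱 n ≤ P n := by
  induction n with
  | zero => rwa [power_zero, Submodule.one_le]
  | succ n ih =>
    rw [power_succ, Submodule.mul_le]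
    rintro _ ⟨v, rfl⟩ x hx
    exact ι_mul_mem_of_homogeneous (ι_mul n) v (ih hx)

theorem grading_le (P : ℤ → Submodule K (Sym 𝒱)) (one : 1 ∈ P 0)
    (ι_mul : ∀ (d i : ℤ) (v : V), v ∈ 𝒱 i → ∀ x ∈ P d, ι 𝒱 v * x ∈ P (i + d)) (d : ℤ) :
    grading 𝒱 d ≤ P d := by
  rw [grading, Submodule.span_le]
  rintro _ ⟨l, rfl, rfl⟩
  induction l with
  | nil => simpa using one
  | cons a l ih => simpa using ι_mul _ _ _ a.2.2 _ ih

theorem exists_eq_smul_one_of_mem_power_zero {x : Sym 𝒱} (hx : x ∈ power 𝒱 0) :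
    ∃ c : K, x = c • 1 := by
  rw [power_zero] at hx
  obtain ⟨c, rfl⟩ := Submodule.mem_one.mp hx
  exact ⟨c, Algebra.algebraMap_eq_smul_one c⟩

theorem exists_eq_ι_of_mem_power_one {x : Sym 𝒱} (hx : x ∈ power 𝒱 1) : ∃ v, x = ι 𝒱 v := by
  rw [power, pow_one] at hx
  obtain ⟨v, rfl⟩ := hx
  exact ⟨v, rfl⟩

theorem counit_one : counit 𝒱 1 = 1 := by simp [counit]

theorem counit_ι_mul (v : V) (x : Sym 𝒱) : counit 𝒱 (ι 𝒱 v * x) = 0 := by simp [counit]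

theorem counit_ι (v : V) : counit 𝒱 (ι 𝒱 v) = 0 := by simp [counit]

theorem proj_ι_mul [DirectSum.Decomposition 𝒱] (v : V) (x : Sym 𝒱) :
    proj 𝒱 (ι 𝒱 v * x) = counit 𝒱 x • v := by
  suffices h : proj 𝒱 ∘ₗ LinearMap.mulLeft K (ι 𝒱 v) = (counit 𝒱).smulRight v from congr($h x)
  exact linearMap_ext_of_ι_mul (by simp [proj_ι, counit_one]) fun i w _ x _ => by
    simp [proj_ι_mul_ι_mul, counit_ι_mul]

theorem ι_hasDegree : HasDegree 𝒱 (grading 𝒱) 0 (ι 𝒱) :=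
  hasDegree_zero_iff.mpr fun _ _ => ι_mem_grading

theorem one_mem_grading : (1 : Sym 𝒱) ∈ grading 𝒱 0 := SetLike.GradedOne.one_mem

theorem ι_mul_mem_grading {i d : ℤ} {v : V} (hv : v ∈ 𝒱 i) {x : Sym 𝒱} (hx : x ∈ grading 𝒱 d) :
    ι 𝒱 v * x ∈ grading 𝒱 (i + d) :=
  SetLike.GradedMul.mul_mem (ι_mem_grading hv) hx

section Comul

variable [DirectSum.Decomposition 𝒱] [DirectSum.Decomposition 𝒲]

variable (𝒱) in
/-- The linear map `x ↦ (-1)^{i|x|} x` of `S(V)`, the sign of moving an element of degree `i`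
past `x`. -/
def signTwist (i : ℤ) : Sym 𝒱 →ₗ[K] Sym 𝒱 :=
  ofComponents (grading 𝒱) fun d => ksign K (i * d) • LinearMap.id

theorem signTwist_of_mem (i : ℤ) {d : ℤ} {x : Sym 𝒱} (hx : x ∈ grading 𝒱 d) :
    signTwist 𝒱 i x = ksign K (i * d) • x :=
  ofComponents_of_mem (grading 𝒱) _ hx

theorem signMap_eq_signTwist : signMap 𝒱 = signTwist 𝒱 1 := by
  simp [signMap, signTwist, ofComponents, LinearMap.smul_comp]

theorem signTwist_one (i : ℤ) : signTwist 𝒱 i 1 = 1 := by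
  rw [signTwist_of_mem i one_mem_grading, mul_zero, ksign_zero, one_smul]

theorem signTwist_ι_mul (i : ℤ) {j : ℤ} {v : V} (hv : v ∈ 𝒱 j) (x : Sym 𝒱) :
    signTwist 𝒱 i (ι 𝒱 v * x) = ksign K (i * j) • (ι 𝒱 v * signTwist 𝒱 i x) := by
  suffices h : signTwist 𝒱 i ∘ₗ LinearMap.mulLeft K (ι 𝒱 v) =
      ksign K (i * j) • (LinearMap.mulLeft K (ι 𝒱 v) ∘ₗ signTwist 𝒱 i) from congr($h x)
  refine linearMap_ext_of_mem (grading 𝒱) fun d x hx => ?_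
  simp only [LinearMap.comp_apply, LinearMap.mulLeft_apply, LinearMap.smul_apply,
    signTwist_of_mem i (ι_mul_mem_grading hv hx), signTwist_of_mem i hx, mul_smul_comm, smul_smul,
    mul_add, ksign_add]

theorem signTwist_comp_of_hasDegree {F : Sym 𝒱 →ₗ[K] Sym 𝒲}
    (hF : HasDegree (grading 𝒱) (grading 𝒲) 0 F) (i : ℤ) :
    signTwist 𝒲 i ∘ₗ F = F ∘ₗ signTwist 𝒱 i :=
  linearMap_ext_of_mem (grading 𝒱) fun d x hx => by
    simp only [LinearMap.comp_apply, signTwist_of_mem i hx, signTwist_of_mem i (hF.map_mem hx),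
      map_smul]

theorem ι_mul_eq_signTwist_mul_ι {i : ℤ} {v : V} (hv : v ∈ 𝒱 i) (x : Sym 𝒱) :
    ι 𝒱 v * x = signTwist 𝒱 i x * ι 𝒱 v := by
  suffices h : LinearMap.mulLeft K (ι 𝒱 v) =
      LinearMap.mulRight K (ι 𝒱 v) ∘ₗ signTwist 𝒱 i from congr($h x)
  refine linearMap_ext_of_ι_mul (by simp [signTwist_one]) fun j w hw x hx => ?_
  simp only [LinearMap.mulLeft_apply, LinearMap.comp_apply, LinearMap.mulRight_apply] at hx ⊢
  rw [signTwist_ι_mul i hw, ← mul_assoc, ι_mul_ι hv hw, smul_mul_assoc, smul_mul_assoc, mul_assoc,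
    mul_assoc, hx]

variable (𝒱) in
/-- The coproduct as a morphism of algebras into the graded tensor product. -/
def gradedComul : Sym 𝒱 →ₐ[K] GradedTensorProduct K (grading 𝒱) (grading 𝒱) :=
  lift 𝒱 ((GradedTensorProduct.includeLeft (grading 𝒱) (grading 𝒱)).toLinearMap ∘ₗ ι 𝒱 +
      (GradedTensorProduct.includeRight (grading 𝒱) (grading 𝒱)).toLinearMap ∘ₗ ι 𝒱)
      (comul_aux 𝒱)

theorem of_comul (x : Sym 𝒱) :
    GradedTensorProduct.of K (grading 𝒱) (grading 𝒱) (comul 𝒱 x) = gradedComul 𝒱 x := rfl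

theorem gradedComul_ι (v : V) : gradedComul 𝒱 (ι 𝒱 v) =
    GradedTensorProduct.includeLeft (grading 𝒱) (grading 𝒱) (ι 𝒱 v) +
      GradedTensorProduct.includeRight (grading 𝒱) (grading 𝒱) (ι 𝒱 v) := by
  simp [gradedComul]

theorem comul_one : comul 𝒱 1 = 1 ⊗ₜ 1 := by
  apply (GradedTensorProduct.of K (grading 𝒱) (grading 𝒱)).injective
  rw [of_comul, map_one]
  rfl

theorem includeLeft_mul_of (a : Sym 𝒱) (y : Sym 𝒱 ⊗[K] Sym 𝒱) :
    GradedTensorProduct.includeLeft (grading 𝒱) (grading 𝒱) a *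
      GradedTensorProduct.of K (grading 𝒱) (grading 𝒱) y =
    GradedTensorProduct.of K (grading 𝒱) (grading 𝒱)
      (TensorProduct.map (LinearMap.mulLeft K a) LinearMap.id y) := by
  suffices h : Algebra.lmul K _ (GradedTensorProduct.includeLeft (grading 𝒱) (grading 𝒱) a) ∘ₗ
      (GradedTensorProduct.of K (grading 𝒱) (grading 𝒱)).toLinearMap =
      (GradedTensorProduct.of K (grading 𝒱) (grading 𝒱)).toLinearMap ∘ₗ
        TensorProduct.map (LinearMap.mulLeft K a) LinearMap.id from congr($h y)
  exact TensorProduct.ext <| linearMap_ext_of_mem (grading 𝒱) fun d b hb => LinearMap.ext fun c =>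
    GradedTensorProduct.tmul_one_mul_coe_tmul (grading 𝒱) (grading 𝒱) a ⟨b, hb⟩ c

theorem includeRight_mul_of {i : ℤ} {a : Sym 𝒱} (ha : a ∈ grading 𝒱 i)
    (y : Sym 𝒱 ⊗[K] Sym 𝒱) :
    GradedTensorProduct.includeRight (grading 𝒱) (grading 𝒱) a *
      GradedTensorProduct.of K (grading 𝒱) (grading 𝒱) y =
    GradedTensorProduct.of K (grading 𝒱) (grading 𝒱)
      (TensorProduct.map (signTwist 𝒱 i) (LinearMap.mulLeft K a) y) := by
  suffices h : Algebra.lmul K _ (GradedTensorProduct.includeRight (grading 𝒱) (grading 𝒱) a) ∘ₗ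
      (GradedTensorProduct.of K (grading 𝒱) (grading 𝒱)).toLinearMap =
      (GradedTensorProduct.of K (grading 𝒱) (grading 𝒱)).toLinearMap ∘ₗ
        TensorProduct.map (signTwist 𝒱 i) (LinearMap.mulLeft K a) from congr($h y)
  refine TensorProduct.ext <| linearMap_ext_of_mem (grading 𝒱) fun d b hb => LinearMap.ext
    fun c => ?_
  have tmul_mul_tmul := GradedTensorProduct.tmul_coe_mul_coe_tmul (R := K) (grading 𝒱) (grading 𝒱) 1
    ⟨a, ha⟩ ⟨b, hb⟩ c
  change _ = GradedTensorProduct.of K _ _ (signTwist 𝒱 i b ⊗ₜ[K] (a * c))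
  rw [signTwist_of_mem i hb, ← TensorProduct.smul_tmul', map_smul, ksign, Int.cast_smul_eq_zsmul]
  rw [one_mul] at tmul_mul_tmul
  exact tmul_mul_tmul

variable (𝒱) in
/-- For `v` of degree `i`, the left multiplication by the primitive element `v ⊗ 1 + 1 ⊗ v` of the
graded tensor product: `a ⊗ b ↦ v a ⊗ b + (-1)^{i|a|} a ⊗ v b`. -/
def primitiveMulLeft (i : ℤ) (v : V) : Module.End K (Sym 𝒱 ⊗[K] Sym 𝒱) :=
  TensorProduct.map (LinearMap.mulLeft K (ι 𝒱 v)) LinearMap.id +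
    TensorProduct.map (signTwist 𝒱 i) (LinearMap.mulLeft K (ι 𝒱 v))

theorem primitiveMulLeft_tmul (i : ℤ) (v : V) (a b : Sym 𝒱) :
    primitiveMulLeft 𝒱 i v (a ⊗ₜ b) =
      (ι 𝒱 v * a) ⊗ₜ[K] b + signTwist 𝒱 i a ⊗ₜ[K] (ι 𝒱 v * b) := rfl

theorem comul_ι_mul {i : ℤ} {v : V} (hv : v ∈ 𝒱 i) (x : Sym 𝒱) :
    comul 𝒱 (ι 𝒱 v * x) = primitiveMulLeft 𝒱 i v (comul 𝒱 x) := by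
  apply (GradedTensorProduct.of K (grading 𝒱) (grading 𝒱)).injective
  rw [of_comul, map_mul, gradedComul_ι, add_mul, ← of_comul, includeLeft_mul_of,
    includeRight_mul_of (ι_mem_grading hv), primitiveMulLeft, LinearMap.add_apply, map_add]

end Comul

end SymmetricAlgebra

/-! ### Symmetric powers -/

section SymmetricCoalgebra

variable {K V W : Type*} [Field K] [AddCommGroup V] [Module K V] [AddCommGroup W] [Module K W]
  {𝒱 : ℤ → Submodule K V} {𝒲 : ℤ → Submodule K W}

section Powers

instance : SetLike.GradedMonoid (power 𝒱) :=
  inferInstanceAs (SetLike.GradedMonoid (fun n : ℕ => LinearMap.range (ι 𝒱) ^ n))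

variable (𝒱) in
/-- The algebra morphism that splits an element of `S(V)` into its components in the symmetric
powers. -/
def powerSplit : Sym 𝒱 →ₐ[K] ⨁ n, power 𝒱 n :=
  lift 𝒱 (A := ⨁ n, power 𝒱 n)
    (DirectSum.lof K ℕ (fun n => power 𝒱 n) 1 ∘ₗ (ι 𝒱).codRestrict _ ι_mem_power) (by
      intro i j x y hx hy
      simp only [LinearMap.comp_apply, DirectSum.lof_eq_of, DirectSum.of_mul_of]
      rw [← DirectSum.lof_eq_of K, ← DirectSum.lof_eq_of K, ← map_smul]
      exact DirectSum.of_eq_of_gradedMonoid_eq (Sigma.subtype_ext rfl (ι_mul_ι hx hy)))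

theorem powerSplit_ι (v : V) : powerSplit 𝒱 (ι 𝒱 v) =
    DirectSum.of (fun n => power 𝒱 n) 1 ⟨ι 𝒱 v, ι_mem_power v⟩ := by
  rw [powerSplit, lift_ι]
  rfl

theorem powerSplit_of_mem {n : ℕ} {x : Sym 𝒱} (hx : x ∈ power 𝒱 n) :
    powerSplit 𝒱 x = DirectSum.of (fun n => power 𝒱 n) n ⟨x, hx⟩ := by
  change x ∈ LinearMap.range (ι 𝒱) ^ n at hx
  induction hx using Submodule.pow_induction_on_left' with
  | algebraMap r =>
    rw [AlgHom.commutes, DirectSum.algebraMap_apply]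
    rfl
  | add x y i hx hy ihx ihy =>
    rw [map_add, ihx, ihy, ← map_add]
    rfl
  | mem_mul m hm i x hx ih =>
    obtain ⟨v, rfl⟩ := hm
    rw [map_mul, ih, powerSplit_ι, DirectSum.of_mul_of]
    exact DirectSum.of_eq_of_gradedMonoid_eq (Sigma.subtype_ext (add_comm _ _) rfl)

instance : GradedAlgebra (power 𝒱) :=
  GradedAlgebra.ofAlgHom _ (powerSplit 𝒱)
    (algHom_ext 𝒱 fun v => by
      rw [AlgHom.comp_apply, powerSplit_ι, DirectSum.coeAlgHom_of, AlgHom.id_apply])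
    fun _ x => powerSplit_of_mem x.2

variable (𝒱) in
/-- The projection of `S(V)` onto `V^{⊙n}`. -/
abbrev powerProj (n : ℕ) : Sym 𝒱 →ₗ[K] Sym 𝒱 := GradedAlgebra.proj (power 𝒱) n

theorem powerProj_of_mem {n : ℕ} {x : Sym 𝒱} (hx : x ∈ power 𝒱 n) : powerProj 𝒱 n x = x :=
  DirectSum.decompose_of_mem_same _ hx

theorem powerProj_of_mem_of_ne {m n : ℕ} {x : Sym 𝒱} (hx : x ∈ power 𝒱 m) (h : m ≠ n) :
    powerProj 𝒱 n x = 0 :=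
  DirectSum.decompose_of_mem_ne _ hx h

theorem powerProj_mem (n : ℕ) (x : Sym 𝒱) : powerProj 𝒱 n x ∈ power 𝒱 n := SetLike.coe_mem _

theorem ext_powerProj {x y : Sym 𝒱} (h : ∀ n, powerProj 𝒱 n x = powerProj 𝒱 n y) : x = y :=
  (DirectSum.decompose (power 𝒱)).injective (DFinsupp.ext fun n => Subtype.ext (h n))

theorem powerProj_map {f : Sym 𝒱 →ₗ[K] Sym 𝒲} (hf : ∀ n, ∀ x ∈ power 𝒱 n, f x ∈ power 𝒲 n)
    (n : ℕ) (x : Sym 𝒱) : powerProj 𝒲 n (f x) = f (powerProj 𝒱 n x) := by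
  suffices h : powerProj 𝒲 n ∘ₗ f = f ∘ₗ powerProj 𝒱 n from congr($h x)
  refine linearMap_ext_of_mem (power 𝒱) fun m x hx => ?_
  rw [LinearMap.comp_apply, LinearMap.comp_apply]
  rcases eq_or_ne m n with rfl | hmn
  · rw [powerProj_of_mem hx, powerProj_of_mem (hf m x hx)]
  · rw [powerProj_of_mem_of_ne hx hmn, powerProj_of_mem_of_ne (hf m x hx) hmn, map_zero]

theorem powerProj_ι_mul (n : ℕ) (v : V) (x : Sym 𝒱) :
    powerProj 𝒱 (n + 1) (ι 𝒱 v * x) = ι 𝒱 v * powerProj 𝒱 n x := by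
  suffices h : powerProj 𝒱 (n + 1) ∘ₗ LinearMap.mulLeft K (ι 𝒱 v) =
      LinearMap.mulLeft K (ι 𝒱 v) ∘ₗ powerProj 𝒱 n from congr($h x)
  refine linearMap_ext_of_mem (power 𝒱) fun m x hx => ?_
  rw [LinearMap.comp_apply, LinearMap.comp_apply, LinearMap.mulLeft_apply, LinearMap.mulLeft_apply]
  rcases eq_or_ne m n with rfl | hmn
  · rw [powerProj_of_mem hx, powerProj_of_mem (ι_mul_mem_power v hx)]
  · rw [powerProj_of_mem_of_ne hx hmn,
      powerProj_of_mem_of_ne (ι_mul_mem_power v hx) (Nat.succ_ne_succ_iff.mpr hmn), mul_zero]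

variable (𝒱) in
/-- The sum of the symmetric powers `V^{⊙k}` with `k < n`, encoded by the vanishing of the
components of weight at least `n`. -/
def powerLT (n : ℕ) : Submodule K (Sym 𝒱) := ⨅ k ≥ n, LinearMap.ker (powerProj 𝒱 k)

theorem mem_powerLT {n : ℕ} {x : Sym 𝒱} : x ∈ powerLT 𝒱 n ↔ ∀ k ≥ n, powerProj 𝒱 k x = 0 := by
  simp only [powerLT, Submodule.mem_iInf, LinearMap.mem_ker]

theorem powerLT_le {n : ℕ} {P : Submodule K (Sym 𝒱)} (h : ∀ k < n, power 𝒱 k ≤ P) :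
    powerLT 𝒱 n ≤ P := by
  classical
  intro x hx
  rw [← DirectSum.sum_support_decompose (power 𝒱) x]
  refine Submodule.sum_mem _ fun k hk => ?_
  rw [GradedAlgebra.mem_support_iff] at hk
  exact h k (not_le.mp fun hnk => hk (mem_powerLT.mp hx k hnk)) (powerProj_mem k x)

theorem power_le_powerLT {k n : ℕ} (h : k < n) : power 𝒱 k ≤ powerLT 𝒱 n := fun _ hx =>
  mem_powerLT.mpr fun _ hm => powerProj_of_mem_of_ne hx (h.trans_le hm).ne

theorem powerLT_mono {m n : ℕ} (h : m ≤ n) : powerLT 𝒱 m ≤ powerLT 𝒱 n :=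
  powerLT_le fun _ hk => power_le_powerLT (hk.trans_le h)

theorem ι_mul_mem_powerLT (v : V) {n : ℕ} {x : Sym 𝒱} (hx : x ∈ powerLT 𝒱 n) :
    ι 𝒱 v * x ∈ powerLT 𝒱 (n + 1) := by
  rw [mem_powerLT] at hx ⊢
  intro k hk
  obtain ⟨k, rfl⟩ : ∃ m, k = m + 1 := ⟨k - 1, by omega⟩
  rw [powerProj_ι_mul, hx k (by omega), mul_zero]

theorem exists_mem_powerLT (x : Sym 𝒱) : ∃ n, x ∈ powerLT 𝒱 n := by
  induction x using DirectSum.Decomposition.inductionOn (power 𝒱) with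
  | zero => exact ⟨0, zero_mem _⟩
  | @homogeneous i v => exact ⟨i + 1, power_le_powerLT i.lt_succ_self v.2⟩
  | add v w hv hw =>
    obtain ⟨m, hm⟩ := hv
    obtain ⟨n, hn⟩ := hw
    exact ⟨max m n,
      add_mem (powerLT_mono (le_max_left _ _) hm) (powerLT_mono (le_max_right _ _) hn)⟩

theorem powerLT_zero : powerLT 𝒱 0 = ⊥ :=
  eq_bot_iff.mpr <| powerLT_le fun k hk => absurd hk k.not_lt_zero

theorem counit_of_mem_power {n : ℕ} (hn : n ≠ 0) {x : Sym 𝒱} (hx : x ∈ power 𝒱 n) :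
    counit 𝒱 x = 0 := by
  obtain ⟨n, rfl⟩ := Nat.exists_eq_succ_of_ne_zero hn
  rw [power_succ] at hx
  induction hx using Submodule.mul_induction_on' with
  | mem_mul_mem v hv y _ =>
    obtain ⟨v, rfl⟩ := hv
    exact counit_ι_mul v y
  | add x _ y _ hx hy => rw [map_add, hx, hy, add_zero]

theorem proj_of_mem_power [DirectSum.Decomposition 𝒱] {n : ℕ} (hn : n ≠ 1) {x : Sym 𝒱}
    (hx : x ∈ power 𝒱 n) : proj 𝒱 x = 0 := by
  match n with
  | 0 =>
    obtain ⟨c, rfl⟩ := exists_eq_smul_one_of_mem_power_zero hx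
    rw [map_smul, proj_one, smul_zero]
  | n + 1 =>
    rw [power_succ] at hx
    induction hx using Submodule.mul_induction_on' with
    | mem_mul_mem v hv y hy =>
      obtain ⟨v, rfl⟩ := hv
      rw [proj_ι_mul, counit_of_mem_power (by omega) hy, zero_smul]
    | add x _ y _ hx hy => rw [map_add, hx, hy, add_zero]

theorem powerProj_zero (x : Sym 𝒱) : powerProj 𝒱 0 x = counit 𝒱 x • 1 := by
  suffices h : powerProj 𝒱 0 = (counit 𝒱).smulRight 1 from congr($h x)
  refine linearMap_ext_of_mem (power 𝒱) fun n x hx => ?_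
  rw [LinearMap.smulRight_apply]
  rcases eq_or_ne n 0 with rfl | hn
  · obtain ⟨c, rfl⟩ := exists_eq_smul_one_of_mem_power_zero hx
    rw [powerProj_of_mem hx, map_smul, counit_one, smul_eq_mul, mul_one]
  · rw [powerProj_of_mem_of_ne hx hn, counit_of_mem_power hn hx, zero_smul]

theorem powerProj_one [DirectSum.Decomposition 𝒱] (x : Sym 𝒱) :
    powerProj 𝒱 1 x = ι 𝒱 (proj 𝒱 x) := by
  suffices h : powerProj 𝒱 1 = ι 𝒱 ∘ₗ proj 𝒱 from congr($h x)
  refine linearMap_ext_of_mem (power 𝒱) fun n x hx => ?_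
  rw [LinearMap.comp_apply]
  rcases eq_or_ne n 1 with rfl | hn
  · obtain ⟨v, rfl⟩ := exists_eq_ι_of_mem_power_one hx
    rw [powerProj_of_mem hx, proj_ι]
  · rw [powerProj_of_mem_of_ne hx hn, proj_of_mem_power hn hx, map_zero]

variable (𝒱) in
/-- The Euler coderivation, multiplication by `n` on `V^{⊙n}`. -/
def euler : Sym 𝒱 →ₗ[K] Sym 𝒱 := ofComponents (power 𝒱) fun n => (n : K) • LinearMap.id

theorem euler_of_mem {n : ℕ} {x : Sym 𝒱} (hx : x ∈ power 𝒱 n) : euler 𝒱 x = (n : K) • x :=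
  ofComponents_of_mem (power 𝒱) _ hx

theorem euler_one : euler 𝒱 1 = 0 := by
  rw [euler_of_mem one_mem_power, Nat.cast_zero, zero_smul]

theorem euler_ι (v : V) : euler 𝒱 (ι 𝒱 v) = ι 𝒱 v := by
  rw [euler_of_mem (ι_mem_power v), Nat.cast_one, one_smul]

theorem euler_map {f : Sym 𝒱 →ₗ[K] Sym 𝒲} (hf : ∀ n, ∀ x ∈ power 𝒱 n, f x ∈ power 𝒲 n) :
    euler 𝒲 ∘ₗ f = f ∘ₗ euler 𝒱 :=
  linearMap_ext_of_mem (power 𝒱) fun n x hx => by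
    rw [LinearMap.comp_apply, LinearMap.comp_apply, euler_of_mem hx, euler_of_mem (hf n x hx),
      map_smul]

theorem euler_ι_mul (v : V) (x : Sym 𝒱) :
    euler 𝒱 (ι 𝒱 v * x) = ι 𝒱 v * x + ι 𝒱 v * euler 𝒱 x := by
  suffices h : euler 𝒱 ∘ₗ LinearMap.mulLeft K (ι 𝒱 v) =
      LinearMap.mulLeft K (ι 𝒱 v) + LinearMap.mulLeft K (ι 𝒱 v) ∘ₗ euler 𝒱 from congr($h x)
  refine linearMap_ext_of_mem (power 𝒱) fun m x hx => ?_
  simp only [LinearMap.comp_apply, LinearMap.mulLeft_apply, LinearMap.add_apply, euler_of_mem hx,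
    euler_of_mem (ι_mul_mem_power v hx), mul_smul_comm]
  push_cast
  module

theorem powerProj_euler (n : ℕ) (x : Sym 𝒱) :
    powerProj 𝒱 n (euler 𝒱 x) = (n : K) • powerProj 𝒱 n x := by
  suffices h : powerProj 𝒱 n ∘ₗ euler 𝒱 = (n : K) • powerProj 𝒱 n from congr($h x)
  refine linearMap_ext_of_mem (power 𝒱) fun m x hx => ?_
  rw [LinearMap.comp_apply, LinearMap.smul_apply, euler_of_mem hx, map_smul]
  rcases eq_or_ne m n with rfl | hmn
  · rfl
  · rw [powerProj_of_mem_of_ne hx hmn, smul_zero, smul_zero]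

variable [CharZero K]

theorem powerProj_eq_zero_of_euler {n : ℕ} {x : Sym 𝒱} (h : powerProj 𝒱 n (euler 𝒱 x) = 0)
    (h0 : counit 𝒱 x = 0) : powerProj 𝒱 n x = 0 := by
  rcases eq_or_ne n 0 with rfl | hn
  · rw [powerProj_zero, h0, zero_smul]
  · rw [powerProj_euler] at h
    exact (smul_eq_zero.mp h).resolve_left (Nat.cast_ne_zero.mpr hn)

theorem eq_of_euler_eq {x y : Sym 𝒱} (h : euler 𝒱 x = euler 𝒱 y)
    (h0 : counit 𝒱 x = counit 𝒱 y) : x = y :=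
  sub_eq_zero.mp <| ext_powerProj fun n => by
    rw [map_zero]
    exact powerProj_eq_zero_of_euler (by rw [map_sub, h, sub_self, map_zero])
      (by rw [map_sub, h0, sub_self])

theorem mem_powerLT_of_euler_mem {n : ℕ} {x : Sym 𝒱} (h : euler 𝒱 x ∈ powerLT 𝒱 n)
    (h0 : counit 𝒱 x = 0) : x ∈ powerLT 𝒱 n :=
  mem_powerLT.mpr fun k hk => powerProj_eq_zero_of_euler (mem_powerLT.mp h k hk) h0

theorem mem_power_of_euler_mem {n : ℕ} {x : Sym 𝒱} (h : euler 𝒱 x ∈ power 𝒱 n)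
    (h0 : counit 𝒱 x = 0) : x ∈ power 𝒱 n := by
  suffices hx : x = powerProj 𝒱 n x from hx ▸ powerProj_mem n x
  refine ext_powerProj fun k => ?_
  rcases eq_or_ne k n with rfl | hk
  · rw [powerProj_of_mem (powerProj_mem k x)]
  · rw [powerProj_of_mem_of_ne (powerProj_mem n x) hk.symm,
      powerProj_eq_zero_of_euler (powerProj_of_mem_of_ne h hk.symm) h0]

end Powers

/-! ### The coalgebra structure and convolution -/

section Coalgebra

variable [DirectSum.Decomposition 𝒱]

theorem signTwist_mem_power (i : ℤ) (n : ℕ) (x : Sym 𝒱) (hx : x ∈ power 𝒱 n) :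
    signTwist 𝒱 i x ∈ power 𝒱 n := by
  refine power_le (fun n => (power 𝒱 n).comap (signTwist 𝒱 i)) ?_ (fun n j v hv x hx => ?_) n hx
  · rw [Submodule.mem_comap, signTwist_one]
    exact one_mem_power
  · rw [Submodule.mem_comap, signTwist_ι_mul i hv]
    exact Submodule.smul_mem _ _ (ι_mul_mem_power v hx)

theorem signTwist_hasDegree (i : ℤ) :
    HasDegree (grading 𝒱) (grading 𝒱) 0 (signTwist 𝒱 i) :=
  hasDegree_zero_iff.mpr fun d x hx => by
    rw [signTwist_of_mem i hx]
    exact Submodule.smul_mem _ _ hx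

theorem signTwist_signTwist_comm (i j : ℤ) (x : Sym 𝒱) :
    signTwist 𝒱 i (signTwist 𝒱 j x) = signTwist 𝒱 j (signTwist 𝒱 i x) :=
  congr($(signTwist_comp_of_hasDegree (signTwist_hasDegree j) i) x)

theorem map_signTwist_primitiveMulLeft (i : ℤ) {j : ℤ} {v : V} (hv : v ∈ 𝒱 j) :
    TensorProduct.map (signTwist 𝒱 i) (signTwist 𝒱 i) ∘ₗ primitiveMulLeft 𝒱 j v =
      ksign K (i * j) • (primitiveMulLeft 𝒱 j v ∘ₗ
        TensorProduct.map (signTwist 𝒱 i) (signTwist 𝒱 i)) :=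
  TensorProduct.ext' fun a b => by
    simp only [LinearMap.comp_apply, primitiveMulLeft_tmul, map_add, TensorProduct.map_tmul,
      signTwist_ι_mul i hv, signTwist_signTwist_comm i j, LinearMap.smul_apply, smul_add,
      TensorProduct.smul_tmul', TensorProduct.tmul_smul]

theorem comul_signTwist (i : ℤ) :
    comul 𝒱 ∘ₗ signTwist 𝒱 i =
      TensorProduct.map (signTwist 𝒱 i) (signTwist 𝒱 i) ∘ₗ comul 𝒱 := by
  refine linearMap_ext_of_ι_mul (by simp [signTwist_one, comul_one]) fun j v hv x hx => ?_
  simp only [LinearMap.comp_apply] at hx ⊢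
  rw [signTwist_ι_mul i hv, map_smul, comul_ι_mul hv, comul_ι_mul hv, hx]
  exact congr($(map_signTwist_primitiveMulLeft i hv) (comul 𝒱 x)).symm

theorem counit_signTwist (i : ℤ) (x : Sym 𝒱) : counit 𝒱 (signTwist 𝒱 i x) = counit 𝒱 x := by
  suffices h : counit 𝒱 ∘ₗ signTwist 𝒱 i = counit 𝒱 from congr($h x)
  refine linearMap_ext_of_ι_mul (by simp [signTwist_one]) fun j v hv x _ => ?_
  rw [LinearMap.comp_apply, signTwist_ι_mul i hv, map_smul, counit_ι_mul, counit_ι_mul, smul_zero]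

theorem lTensor_comul_primitiveMulLeft {i : ℤ} {v : V} (hv : v ∈ 𝒱 i) :
    (comul 𝒱).lTensor (Sym 𝒱) ∘ₗ primitiveMulLeft 𝒱 i v =
      (TensorProduct.map (LinearMap.mulLeft K (ι 𝒱 v)) LinearMap.id +
        TensorProduct.map (signTwist 𝒱 i) (primitiveMulLeft 𝒱 i v)) ∘ₗ
          (comul 𝒱).lTensor (Sym 𝒱) :=
  TensorProduct.ext' fun a b => by
    simp [primitiveMulLeft_tmul, comul_ι_mul hv]

theorem rTensor_comul_primitiveMulLeft {i : ℤ} {v : V} (hv : v ∈ 𝒱 i) :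
    (comul 𝒱).rTensor (Sym 𝒱) ∘ₗ primitiveMulLeft 𝒱 i v =
      (TensorProduct.map (primitiveMulLeft 𝒱 i v) LinearMap.id +
        TensorProduct.map (TensorProduct.map (signTwist 𝒱 i) (signTwist 𝒱 i))
          (LinearMap.mulLeft K (ι 𝒱 v))) ∘ₗ (comul 𝒱).rTensor (Sym 𝒱) :=
  TensorProduct.ext' fun a b => by
    have comul_signTwist_apply : comul 𝒱 (signTwist 𝒱 i a) = _ := congr($(comul_signTwist i) a)
    simp [primitiveMulLeft_tmul, comul_ι_mul hv, comul_signTwist_apply]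

theorem assoc_primitiveMulLeft (i : ℤ) (v : V) :
    (TensorProduct.assoc K (Sym 𝒱) (Sym 𝒱) (Sym 𝒱)).toLinearMap ∘ₗ
        (TensorProduct.map (primitiveMulLeft 𝒱 i v) LinearMap.id +
          TensorProduct.map (TensorProduct.map (signTwist 𝒱 i) (signTwist 𝒱 i))
            (LinearMap.mulLeft K (ι 𝒱 v))) =
      (TensorProduct.map (LinearMap.mulLeft K (ι 𝒱 v)) LinearMap.id +
          TensorProduct.map (signTwist 𝒱 i) (primitiveMulLeft 𝒱 i v)) ∘ₗ
        (TensorProduct.assoc K (Sym 𝒱) (Sym 𝒱) (Sym 𝒱)).toLinearMap :=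
  TensorProduct.ext_threefold fun a b c => by
    simp [primitiveMulLeft_tmul, TensorProduct.add_tmul, TensorProduct.tmul_add, add_assoc]

theorem coassoc : (TensorProduct.assoc K (Sym 𝒱) (Sym 𝒱) (Sym 𝒱)).toLinearMap ∘ₗ
    (comul 𝒱).rTensor (Sym 𝒱) ∘ₗ comul 𝒱 = (comul 𝒱).lTensor (Sym 𝒱) ∘ₗ comul 𝒱 := by
  refine linearMap_ext_of_ι_mul (by simp [comul_one]) fun i v hv x hx => ?_
  simp only [LinearMap.comp_apply] at hx ⊢
  rw [comul_ι_mul hv, ← LinearMap.comp_apply ((comul 𝒱).rTensor _),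
    rTensor_comul_primitiveMulLeft hv, ← LinearMap.comp_apply ((comul 𝒱).lTensor _),
    lTensor_comul_primitiveMulLeft hv, LinearMap.comp_apply, LinearMap.comp_apply, ← hx]
  exact congr($(assoc_primitiveMulLeft i v) ((comul 𝒱).rTensor (Sym 𝒱) (comul 𝒱 x)))

theorem rTensor_counit_comp_comul :
    (counit 𝒱).rTensor (Sym 𝒱) ∘ₗ comul 𝒱 = TensorProduct.mk K K (Sym 𝒱) 1 := by
  refine linearMap_ext_of_ι_mul (by simp [comul_one, counit_one]) fun i v hv x hx => ?_
  have rTensor_primitiveMulLeft : (counit 𝒱).rTensor (Sym 𝒱) ∘ₗ primitiveMulLeft 𝒱 i v =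
      (LinearMap.mulLeft K (ι 𝒱 v)).lTensor K ∘ₗ (counit 𝒱).rTensor (Sym 𝒱) :=
    TensorProduct.ext' fun a b => by simp [primitiveMulLeft_tmul, counit_ι_mul, counit_signTwist]
  rw [LinearMap.comp_apply] at hx ⊢
  rw [comul_ι_mul hv, ← LinearMap.comp_apply, rTensor_primitiveMulLeft, LinearMap.comp_apply, hx]
  rfl

theorem lTensor_counit_comp_comul :
    (counit 𝒱).lTensor (Sym 𝒱) ∘ₗ comul 𝒱 = (TensorProduct.mk K (Sym 𝒱) K).flip 1 := by
  refine linearMap_ext_of_ι_mul (by simp [comul_one, counit_one]) fun i v hv x hx => ?_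
  have lTensor_primitiveMulLeft : (counit 𝒱).lTensor (Sym 𝒱) ∘ₗ primitiveMulLeft 𝒱 i v =
      (LinearMap.mulLeft K (ι 𝒱 v)).rTensor K ∘ₗ (counit 𝒱).lTensor (Sym 𝒱) :=
    TensorProduct.ext' fun a b => by simp [primitiveMulLeft_tmul, counit_ι_mul]
  rw [LinearMap.comp_apply] at hx ⊢
  rw [comul_ι_mul hv, ← LinearMap.comp_apply, lTensor_primitiveMulLeft, LinearMap.comp_apply, hx]
  rfl

instance : Coalgebra K (Sym 𝒱) where
  comul := comul 𝒱
  counit := counit 𝒱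
  coassoc := coassoc
  rTensor_counit_comp_comul := rTensor_counit_comp_comul
  lTensor_counit_comp_comul := lTensor_counit_comp_comul

theorem comm_includeLeft {i : ℤ} {x : Sym 𝒱} (hx : x ∈ grading 𝒱 i) :
    GradedTensorProduct.comm (grading 𝒱) (grading 𝒱)
        (GradedTensorProduct.includeLeft (grading 𝒱) (grading 𝒱) x) =
      GradedTensorProduct.includeRight (grading 𝒱) (grading 𝒱) x := by
  have comm_tmul_one := GradedTensorProduct.comm_coe_tmul_coe (R := K) (grading 𝒱) (grading 𝒱)
    ⟨x, hx⟩ ⟨1, one_mem_grading⟩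
  rwa [zero_mul, uzpow_zero, one_smul] at comm_tmul_one

theorem comm_includeRight {i : ℤ} {x : Sym 𝒱} (hx : x ∈ grading 𝒱 i) :
    GradedTensorProduct.comm (grading 𝒱) (grading 𝒱)
        (GradedTensorProduct.includeRight (grading 𝒱) (grading 𝒱) x) =
      GradedTensorProduct.includeLeft (grading 𝒱) (grading 𝒱) x := by
  have comm_one_tmul := GradedTensorProduct.comm_coe_tmul_coe (R := K) (grading 𝒱) (grading 𝒱)
    ⟨1, one_mem_grading⟩ ⟨x, hx⟩
  rwa [mul_zero, uzpow_zero, one_smul] at comm_one_tmul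

theorem comm_gradedComul (x : Sym 𝒱) :
    GradedTensorProduct.comm (grading 𝒱) (grading 𝒱) (gradedComul 𝒱 x) = gradedComul 𝒱 x := by
  suffices h : (GradedTensorProduct.comm (R := K) (grading 𝒱) (grading 𝒱)).toAlgHom.comp
      (gradedComul 𝒱) = gradedComul 𝒱 from congr($h x)
  refine algHom_ext 𝒱 fun v => ?_
  suffices h : ((GradedTensorProduct.comm (R := K) (grading 𝒱) (grading 𝒱)).toAlgHom.comp
      (gradedComul 𝒱)).toLinearMap ∘ₗ ι 𝒱 = (gradedComul 𝒱).toLinearMap ∘ₗ ι 𝒱 from congr($h v)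
  refine linearMap_ext_of_mem 𝒱 fun i v hv => ?_
  change GradedTensorProduct.comm _ _ (gradedComul 𝒱 (ι 𝒱 v)) = gradedComul 𝒱 (ι 𝒱 v)
  rw [gradedComul_ι, map_add, comm_includeLeft (ι_mem_grading hv),
    comm_includeRight (ι_mem_grading hv), add_comm]

theorem comul_euler : comul 𝒱 ∘ₗ euler 𝒱 =
    (TensorProduct.map (euler 𝒱) LinearMap.id + TensorProduct.map LinearMap.id (euler 𝒱)) ∘ₗ
      comul 𝒱 := by
  refine linearMap_ext_of_ι_mul (by simp [comul_one, euler_one]) fun i v hv x hx => ?_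
  simp only [LinearMap.comp_apply] at hx ⊢
  rw [euler_ι_mul, map_add, comul_ι_mul hv, comul_ι_mul hv, hx]
  suffices h : primitiveMulLeft 𝒱 i v + primitiveMulLeft 𝒱 i v ∘ₗ
        (TensorProduct.map (euler 𝒱) LinearMap.id + TensorProduct.map LinearMap.id (euler 𝒱)) =
      (TensorProduct.map (euler 𝒱) LinearMap.id + TensorProduct.map LinearMap.id (euler 𝒱)) ∘ₗ
        primitiveMulLeft 𝒱 i v from congr($h (comul 𝒱 x))
  refine TensorProduct.ext' fun a b => ?_
  have euler_signTwist : euler 𝒱 (signTwist 𝒱 i a) = signTwist 𝒱 i (euler 𝒱 a) :=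
    congr($(euler_map (signTwist_mem_power i)) a)
  simp only [TensorProduct.map_tmul, LinearMap.add_apply, LinearMap.comp_apply, LinearMap.id_apply,
    map_add, primitiveMulLeft_tmul, euler_ι_mul, euler_signTwist, TensorProduct.add_tmul,
    TensorProduct.tmul_add]
  abel

/-- The convolution product of linear maps from `S(V)` to an algebra: the multiplication of
`WithConv (Sym 𝒱 →ₗ[K] A)`, without the type synonym. -/
def conv {A : Type*} [Ring A] [Algebra K A] (f g : Sym 𝒱 →ₗ[K] A) : Sym 𝒱 →ₗ[K] A :=
  (WithConv.toConv f * WithConv.toConv g).ofConv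

theorem conv_apply {A : Type*} [Ring A] [Algebra K A] (f g : Sym 𝒱 →ₗ[K] A) (x : Sym 𝒱) :
    conv f g x = LinearMap.mul' K A (TensorProduct.map f g (comul 𝒱 x)) := rfl

theorem conv_proj_id : conv (ι 𝒱 ∘ₗ proj 𝒱) LinearMap.id = euler 𝒱 := by
  refine linearMap_ext_of_ι_mul (by simp [conv_apply, comul_one, euler_one, proj_one])
    fun i v hv x hx => ?_
  rw [conv_apply] at hx ⊢
  rw [comul_ι_mul hv, euler_ι_mul, ← hx]
  have conv_primitiveMulLeft : LinearMap.mul' K (Sym 𝒱) ∘ₗ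
        TensorProduct.map (ι 𝒱 ∘ₗ proj 𝒱) LinearMap.id ∘ₗ primitiveMulLeft 𝒱 i v =
      LinearMap.mulLeft K (ι 𝒱 v) ∘ₗ (TensorProduct.lid K (Sym 𝒱)).toLinearMap ∘ₗ
          (counit 𝒱).rTensor (Sym 𝒱) +
        LinearMap.mulLeft K (ι 𝒱 v) ∘ₗ LinearMap.mul' K (Sym 𝒱) ∘ₗ
          TensorProduct.map (ι 𝒱 ∘ₗ proj 𝒱) LinearMap.id := by
    refine TensorProduct.ext' fun a b => ?_
    have ι_proj_signTwist : ι 𝒱 (proj 𝒱 (signTwist 𝒱 i a)) = signTwist 𝒱 i (ι 𝒱 (proj 𝒱 a)) := by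
      rw [← powerProj_one, ← powerProj_one, powerProj_map (signTwist_mem_power i)]
    simp only [LinearMap.comp_apply, primitiveMulLeft_tmul, map_add, TensorProduct.map_tmul,
      LinearMap.mul'_apply, LinearMap.add_apply, LinearMap.mulLeft_apply, LinearMap.id_apply,
      proj_ι_mul, map_smul, ι_proj_signTwist, LinearEquiv.coe_coe, LinearMap.rTensor_tmul,
      TensorProduct.lid_tmul, smul_mul_assoc]
    rw [← mul_assoc, ← ι_mul_eq_signTwist_mul_ι hv, mul_assoc]
  have lid_rTensor_counit : TensorProduct.lid K _ ((counit 𝒱).rTensor _ (comul 𝒱 x)) = x := by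
    rw [← LinearMap.comp_apply, rTensor_counit_comp_comul, TensorProduct.mk_apply,
      TensorProduct.lid_tmul, one_smul]
  have h := congr($conv_primitiveMulLeft (comul 𝒱 x))
  simpa only [LinearMap.comp_apply, LinearMap.add_apply, LinearMap.mulLeft_apply,
    LinearEquiv.coe_coe, lid_rTensor_counit] using h

end Coalgebra

end SymmetricCoalgebra

section CoalgebraMorphisms

variable {K V W U : Type*} [Field K] [AddCommGroup V] [Module K V] [AddCommGroup W] [Module K W]
  [AddCommGroup U] [Module K U] {𝒱 : ℤ → Submodule K V} {𝒲 : ℤ → Submodule K W}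
  {𝒰 : ℤ → Submodule K U} [DirectSum.Decomposition 𝒱] [DirectSum.Decomposition 𝒲]
  [DirectSum.Decomposition 𝒰]

section Homogeneous

variable {M : Type*} [AddCommGroup M] [Module K M]

theorem comul_mem_span_tmul {I : Type*} [AddCommMonoid I] {𝒮 : I → Submodule K (Sym 𝒱)}
    {δ : ℤ → I} (one : 1 ∈ 𝒮 0)
    (ι_mul : ∀ (n : I) (i : ℤ) (v : V), v ∈ 𝒱 i → ∀ x ∈ 𝒮 n, ι 𝒱 v * x ∈ 𝒮 (δ i + n))
    (twist : ∀ (i : ℤ) (n : I), ∀ x ∈ 𝒮 n, signTwist 𝒱 i x ∈ 𝒮 n)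
    (le : ∀ P : I → Submodule K (Sym 𝒱), 1 ∈ P 0 →
      (∀ (n : I) (i : ℤ) (v : V), v ∈ 𝒱 i → ∀ x ∈ P n, ι 𝒱 v * x ∈ P (δ i + n)) →
        ∀ n, 𝒮 n ≤ P n)
    {n : I} {x : Sym 𝒱} (hx : x ∈ 𝒮 n) :
    comul 𝒱 x ∈ Submodule.span K
      {z | ∃ i j : I, i + j = n ∧ ∃ a ∈ 𝒮 i, ∃ b ∈ 𝒮 j, a ⊗ₜ[K] b = z} := by
  refine le (fun n => (Submodule.span K
    {z | ∃ i j : I, i + j = n ∧ ∃ a ∈ 𝒮 i, ∃ b ∈ 𝒮 j, a ⊗ₜ[K] b = z}).comap (comul 𝒱)) ?_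
    (fun n k v hv x hx => ?_) n hx
  · rw [Submodule.mem_comap, comul_one]
    exact Submodule.subset_span ⟨0, 0, add_zero 0, 1, one, 1, one, rfl⟩
  · rw [Submodule.mem_comap] at hx ⊢
    rw [comul_ι_mul hv]
    refine (Submodule.map_span_le _ _ _).mpr ?_ (Submodule.mem_map_of_mem hx)
    rintro _ ⟨i, j, rfl, a, ha, b, hb, rfl⟩
    rw [primitiveMulLeft_tmul]
    exact add_mem
      (Submodule.subset_span ⟨δ k + i, j, add_assoc _ _ _, _, ι_mul i k v hv a ha, b, hb, rfl⟩)
      (Submodule.subset_span ⟨i, δ k + j, add_left_comm _ _ _, _, twist k i a ha, _,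
        ι_mul j k v hv b hb, rfl⟩)

theorem map_comul_mem_of_mem_power {P : Submodule K M} (B : Sym 𝒱 ⊗[K] Sym 𝒱 →ₗ[K] M) {n : ℕ}
    (h : ∀ i j : ℕ, i + j = n → ∀ a ∈ power 𝒱 i, ∀ b ∈ power 𝒱 j, B (a ⊗ₜ b) ∈ P)
    {x : Sym 𝒱} (hx : x ∈ power 𝒱 n) : B (comul 𝒱 x) ∈ P := by
  have mem_span := comul_mem_span_tmul (δ := fun _ => 1) one_mem_power
    (fun n i v _ x hx => add_comm 1 n ▸ ι_mul_mem_power v hx) signTwist_mem_power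
    (fun P one ι_mul => power_le P one fun n i v hv x hx => add_comm n 1 ▸ ι_mul n i v hv x hx) hx
  refine (Submodule.map_span_le _ _ _).mpr ?_ (Submodule.mem_map_of_mem mem_span)
  rintro _ ⟨i, j, hij, a, ha, b, hb, rfl⟩
  exact h i j hij a ha b hb

theorem map_comul_mem_of_mem_grading {P : Submodule K M} (B : Sym 𝒱 ⊗[K] Sym 𝒱 →ₗ[K] M) {d : ℤ}
    (h : ∀ i j : ℤ, i + j = d → ∀ a ∈ grading 𝒱 i, ∀ b ∈ grading 𝒱 j, B (a ⊗ₜ b) ∈ P)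
    {x : Sym 𝒱} (hx : x ∈ grading 𝒱 d) : B (comul 𝒱 x) ∈ P := by
  have mem_span := comul_mem_span_tmul (δ := id) one_mem_grading
    (fun n i v hv x hx => ι_mul_mem_grading hv hx)
    (fun i n x hx => (signTwist_hasDegree i).map_mem hx) grading_le hx
  refine (Submodule.map_span_le _ _ _).mpr ?_ (Submodule.mem_map_of_mem mem_span)
  rintro _ ⟨i, j, hij, a, ha, b, hb, rfl⟩
  exact h i j hij a ha b hb

theorem map_comul_eq_of_mem_power {B B' : Sym 𝒱 ⊗[K] Sym 𝒱 →ₗ[K] M} {n : ℕ}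
    (h : ∀ i j : ℕ, i + j = n → ∀ a ∈ power 𝒱 i, ∀ b ∈ power 𝒱 j, B (a ⊗ₜ b) = B' (a ⊗ₜ b))
    {x : Sym 𝒱} (hx : x ∈ power 𝒱 n) : B (comul 𝒱 x) = B' (comul 𝒱 x) := by
  have sub_mem_bot := map_comul_mem_of_mem_power (P := ⊥) (B - B') (fun i j hij a ha b hb => by
    rw [Submodule.mem_bot, LinearMap.sub_apply, h i j hij a ha b hb, sub_self]) hx
  rwa [Submodule.mem_bot, LinearMap.sub_apply, sub_eq_zero] at sub_mem_bot

variable {A : Type*} [Ring A] [Algebra K A] {f g f' g' : Sym 𝒱 →ₗ[K] A}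

theorem conv_mem_of_mem_power {P : Submodule K A} {n : ℕ}
    (h : ∀ i j : ℕ, i + j = n → ∀ a ∈ power 𝒱 i, ∀ b ∈ power 𝒱 j, f a * g b ∈ P)
    {x : Sym 𝒱} (hx : x ∈ power 𝒱 n) : conv f g x ∈ P :=
  map_comul_mem_of_mem_power (LinearMap.mul' K A ∘ₗ TensorProduct.map f g) h hx

theorem conv_mem_of_mem_grading {P : Submodule K A} {d : ℤ}
    (h : ∀ i j : ℤ, i + j = d → ∀ a ∈ grading 𝒱 i, ∀ b ∈ grading 𝒱 j, f a * g b ∈ P)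
    {x : Sym 𝒱} (hx : x ∈ grading 𝒱 d) : conv f g x ∈ P :=
  map_comul_mem_of_mem_grading (LinearMap.mul' K A ∘ₗ TensorProduct.map f g) h hx

theorem conv_eq_of_mem_power {n : ℕ} (h : ∀ i j : ℕ, i + j = n → ∀ a ∈ power 𝒱 i,
      ∀ b ∈ power 𝒱 j, f a * g b = f' a * g' b) {x : Sym 𝒱} (hx : x ∈ power 𝒱 n) :
    conv f g x = conv f' g' x :=
  map_comul_eq_of_mem_power (B := LinearMap.mul' K A ∘ₗ TensorProduct.map f g)
    (B' := LinearMap.mul' K A ∘ₗ TensorProduct.map f' g') h hx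

omit [DirectSum.Decomposition 𝒱] in
theorem counit_smulRight_one : (counit 𝒱).smulRight (1 : K) = counit 𝒱 :=
  LinearMap.ext fun _ => mul_one _

theorem conv_counit_smulRight (f : Sym 𝒱 →ₗ[K] A) (a : A) :
    conv f ((counit 𝒱).smulRight a) = LinearMap.mulRight K a ∘ₗ f := by
  have factor : LinearMap.mul' K A ∘ₗ TensorProduct.map f ((counit 𝒱).smulRight a) =
      LinearMap.mul' K A ∘ₗ TensorProduct.map f (LinearMap.toSpanSingleton K A a) ∘ₗ
        (counit 𝒱).lTensor (Sym 𝒱) := TensorProduct.ext' fun _ _ => by simp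
  ext x
  rw [conv_apply, ← LinearMap.comp_apply, factor, LinearMap.comp_apply, LinearMap.comp_apply,
    ← LinearMap.comp_apply _ (comul 𝒱), lTensor_counit_comp_comul]
  simp

theorem counit_smulRight_conv (a : A) (f : Sym 𝒱 →ₗ[K] A) :
    conv ((counit 𝒱).smulRight a) f = LinearMap.mulLeft K a ∘ₗ f := by
  have factor : LinearMap.mul' K A ∘ₗ TensorProduct.map ((counit 𝒱).smulRight a) f =
      LinearMap.mul' K A ∘ₗ TensorProduct.map (LinearMap.toSpanSingleton K A a) f ∘ₗ
        (counit 𝒱).rTensor (Sym 𝒱) := TensorProduct.ext' fun _ _ => by simp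
  ext x
  rw [conv_apply, ← LinearMap.comp_apply, factor, LinearMap.comp_apply, LinearMap.comp_apply,
    ← LinearMap.comp_apply _ (comul 𝒱), rTensor_counit_comp_comul]
  simp

theorem conv_eq_mul_apply_one {n : ℕ} (hf : ∀ k < n, ∀ a ∈ power 𝒱 k, f a = 0)
    {x : Sym 𝒱} (hx : x ∈ power 𝒱 n) : conv f g x = f x * g 1 := by
  refine (conv_eq_of_mem_power (f' := f) (g' := (counit 𝒱).smulRight (g 1))
    (fun i j hij a ha b hb => ?_) hx).trans congr($(conv_counit_smulRight f (g 1)) x)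
  rcases eq_or_ne j 0 with rfl | hj
  · obtain ⟨c, rfl⟩ := exists_eq_smul_one_of_mem_power_zero hb
    simp [counit_one]
  · rw [hf i (by omega) a ha, zero_mul, zero_mul]

theorem conv_eq_apply_one_mul {n : ℕ} (hg : ∀ k < n, ∀ a ∈ power 𝒱 k, g a = 0)
    {x : Sym 𝒱} (hx : x ∈ power 𝒱 n) : conv f g x = f 1 * g x := by
  refine (conv_eq_of_mem_power (f' := (counit 𝒱).smulRight (f 1)) (g' := g)
    (fun i j hij a ha b hb => ?_) hx).trans congr($(counit_smulRight_conv (f 1) g) x)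
  rcases eq_or_ne i 0 with rfl | hi
  · obtain ⟨c, rfl⟩ := exists_eq_smul_one_of_mem_power_zero ha
    simp [counit_one]
  · rw [hg j (by omega) b hb, mul_zero, mul_zero]

end Homogeneous

/-! ### Coalgebra morphisms and coderivations -/

theorem IsCoalgHom.comp {F : Sym 𝒱 →ₗ[K] Sym 𝒲} {F' : Sym 𝒲 →ₗ[K] Sym 𝒰}
    (hF' : IsCoalgHom 𝒲 𝒰 F') (hF : IsCoalgHom 𝒱 𝒲 F) : IsCoalgHom 𝒱 𝒰 (F' ∘ₗ F) where
  degree := hF'.degree.comp hF.degree (add_zero 0)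
  comul_comp := by
    rw [← LinearMap.comp_assoc, hF'.comul_comp, LinearMap.comp_assoc, hF.comul_comp,
      ← LinearMap.comp_assoc, ← TensorProduct.map_comp]
  counit_comp := by rw [← LinearMap.comp_assoc, hF'.counit_comp, hF.counit_comp]
  map_one := by rw [LinearMap.comp_apply, hF.map_one, hF'.map_one]

theorem isCoalgHom_id : IsCoalgHom 𝒱 𝒱 LinearMap.id where
  degree := hasDegree_zero_iff.mpr fun _ _ hx => hx
  comul_comp := by rw [TensorProduct.map_id]; rfl
  counit_comp := rfl
  map_one := rfl

theorem isCoalgHom_signTwist (i : ℤ) : IsCoalgHom 𝒱 𝒱 (signTwist 𝒱 i) where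
  degree := signTwist_hasDegree i
  comul_comp := comul_signTwist i
  counit_comp := LinearMap.ext (counit_signTwist i)
  map_one := signTwist_one i

theorem map_map_primitiveMulLeft (f : V →ₗ[K] W) (hf : HasDegree 𝒱 𝒲 0 f) (i : ℤ) (v : V) :
    TensorProduct.map (map f hf).toLinearMap (map f hf).toLinearMap ∘ₗ primitiveMulLeft 𝒱 i v =
      primitiveMulLeft 𝒲 i (f v) ∘ₗ
        TensorProduct.map (map f hf).toLinearMap (map f hf).toLinearMap :=
  TensorProduct.ext' fun a b => by
    have signTwist_map : signTwist 𝒲 i (map f hf a) = map f hf (signTwist 𝒱 i a) :=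
      congr($(signTwist_comp_of_hasDegree (map_hasDegree f hf) i) a)
    simp [primitiveMulLeft_tmul, signTwist_map]

theorem isCoalgHom_map (f : V →ₗ[K] W) (hf : HasDegree 𝒱 𝒲 0 f) :
    IsCoalgHom 𝒱 𝒲 (map f hf).toLinearMap where
  degree := map_hasDegree f hf
  comul_comp := by
    refine linearMap_ext_of_ι_mul (by simp [comul_one]) fun i v hv x hx => ?_
    simp only [LinearMap.comp_apply, AlgHom.toLinearMap_apply] at hx ⊢
    rw [map_mul, map_ι, comul_ι_mul (hf.map_mem hv), comul_ι_mul hv, hx]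
    exact congr($(map_map_primitiveMulLeft f hf i v) (comul 𝒱 x)).symm
  counit_comp :=
    linearMap_ext_of_ι_mul (by simp [counit_one]) fun _ _ _ _ _ => by simp [counit_ι_mul]
  map_one := by simp

namespace IsCoalgHom

variable {F : Sym 𝒱 →ₗ[K] Sym 𝒲}

theorem conv_comp (hF : IsCoalgHom 𝒱 𝒲 F) {A : Type*} [Ring A] [Algebra K A]
    (f g : Sym 𝒲 →ₗ[K] A) : conv f g ∘ₗ F = conv (f ∘ₗ F) (g ∘ₗ F) := by
  ext x
  rw [LinearMap.comp_apply, conv_apply, ← LinearMap.comp_apply _ F, hF.comul_comp,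
    LinearMap.comp_apply, TensorProduct.map_map, conv_apply]

theorem euler_comp (hF : IsCoalgHom 𝒱 𝒲 F) :
    euler 𝒲 ∘ₗ F = conv (ι 𝒲 ∘ₗ proj 𝒲 ∘ₗ F) F := by
  rw [← conv_proj_id, hF.conv_comp]
  rfl

theorem proj_one (hF : IsCoalgHom 𝒱 𝒲 F) : proj 𝒲 (F 1) = 0 := by rw [hF.map_one, Sym.proj_one]

theorem proj_of_mem_power_zero (hF : IsCoalgHom 𝒱 𝒲 F) {x : Sym 𝒱} (hx : x ∈ power 𝒱 0) :
    proj 𝒲 (F x) = 0 := by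
  obtain ⟨c, rfl⟩ := exists_eq_smul_one_of_mem_power_zero hx
  rw [map_smul, map_smul, hF.proj_one, smul_zero]

end IsCoalgHom

/-- `D` is a coderivation along the pair `(F, F')`: `Δ D = (D ⊗ F + F' ⊗ D) Δ`. -/
def IsCoderivationAlong (F F' D : Sym 𝒱 →ₗ[K] Sym 𝒲) : Prop :=
  comul 𝒲 ∘ₗ D = (TensorProduct.map D F + TensorProduct.map F' D) ∘ₗ comul 𝒱

namespace IsCoderivationAlong

variable {F F' D : Sym 𝒱 →ₗ[K] Sym 𝒲}

theorem conv_comp (hD : IsCoderivationAlong F F' D) {A : Type*} [Ring A] [Algebra K A]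
    (f g : Sym 𝒲 →ₗ[K] A) :
    conv f g ∘ₗ D = conv (f ∘ₗ D) (g ∘ₗ F) + conv (f ∘ₗ F') (g ∘ₗ D) := by
  ext x
  rw [LinearMap.comp_apply, conv_apply, ← LinearMap.comp_apply _ D, hD, LinearMap.comp_apply,
    LinearMap.add_apply, map_add, map_add, TensorProduct.map_map, TensorProduct.map_map]
  rfl

theorem euler_comp (hD : IsCoderivationAlong F F' D) : euler 𝒲 ∘ₗ D =
    conv (ι 𝒲 ∘ₗ proj 𝒲 ∘ₗ D) F + conv (ι 𝒲 ∘ₗ proj 𝒲 ∘ₗ F') D := by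
  rw [← conv_proj_id, hD.conv_comp]
  rfl

theorem sub {D' : Sym 𝒱 →ₗ[K] Sym 𝒲} (hD : IsCoderivationAlong F F' D)
    (hD' : IsCoderivationAlong F F' D') : IsCoderivationAlong F F' (D - D') := by
  unfold IsCoderivationAlong at *
  rw [LinearMap.comp_sub, hD, hD', ← LinearMap.sub_comp]
  congr 1
  exact TensorProduct.ext' fun a b => by
    simp only [LinearMap.sub_apply, LinearMap.add_apply, TensorProduct.map_tmul,
      TensorProduct.sub_tmul, TensorProduct.tmul_sub]
    abel

theorem counit_comp (hD : IsCoderivationAlong F F' D) (hF : IsCoalgHom 𝒱 𝒲 F)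
    (hF' : IsCoalgHom 𝒱 𝒲 F') : counit 𝒲 ∘ₗ D = 0 := by
  have conv_comp_counit : conv (counit 𝒲) ((counit 𝒲).smulRight 1) ∘ₗ D =
      conv (counit 𝒲 ∘ₗ D) (counit 𝒱) + conv (counit 𝒱) (counit 𝒲 ∘ₗ D) := by
    rw [counit_smulRight_one, hD.conv_comp, hF.counit_comp, hF'.counit_comp]
  have counit_comp_eq_add_self : counit 𝒲 ∘ₗ D = counit 𝒲 ∘ₗ D + counit 𝒲 ∘ₗ D := by
    rw [← counit_smulRight_one (𝒱 := 𝒱), conv_counit_smulRight, conv_counit_smulRight,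
      counit_smulRight_conv] at conv_comp_counit
    simpa using conv_comp_counit
  exact left_eq_add.mp counit_comp_eq_add_self

variable [CharZero K]

theorem eq_ι_proj (hD : IsCoderivationAlong F F' D) (hF : IsCoalgHom 𝒱 𝒲 F)
    (hF' : IsCoalgHom 𝒱 𝒲 F') {n : ℕ} (h : ∀ k < n, ∀ x ∈ power 𝒱 k, D x = 0) {x : Sym 𝒱}
    (hx : x ∈ power 𝒱 n) : D x = ι 𝒲 (proj 𝒲 (D x)) := by
  refine eq_of_euler_eq ?_ (by rw [counit_ι]; exact congr($(hD.counit_comp hF hF') x))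
  have vanish : ∀ k < n, ∀ x ∈ power 𝒱 k, (ι 𝒲 ∘ₗ proj 𝒲 ∘ₗ D) x = 0 := fun k hk x hx => by
    rw [LinearMap.comp_apply, LinearMap.comp_apply, h k hk x hx, map_zero, map_zero]
  rw [euler_ι, ← LinearMap.comp_apply (euler 𝒲), hD.euler_comp, LinearMap.add_apply,
    conv_eq_mul_apply_one vanish hx, conv_eq_apply_one_mul h hx, hF.map_one, mul_one]
  simp [hF'.proj_one]

theorem eq_zero (hD : IsCoderivationAlong F F' D) (hF : IsCoalgHom 𝒱 𝒲 F)
    (hF' : IsCoalgHom 𝒱 𝒲 F') {n : ℕ} (h : ∀ k < n, ∀ x ∈ power 𝒱 k, proj 𝒲 (D x) = 0) :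
    ∀ k < n, ∀ x ∈ power 𝒱 k, D x = 0 := by
  intro k
  induction k using Nat.strong_induction_on with
  | _ k ih =>
    intro hk x hx
    rw [hD.eq_ι_proj hF hF' (fun m hm => ih m hm (hm.trans hk)) hx, h k hk x hx, map_zero]

theorem eq_zero_of_proj (hD : IsCoderivationAlong F F' D) (hF : IsCoalgHom 𝒱 𝒲 F)
    (hF' : IsCoalgHom 𝒱 𝒲 F') (h : proj 𝒲 ∘ₗ D = 0) : D = 0 :=
  linearMap_ext_of_mem (power 𝒱) fun n x hx =>
    hD.eq_zero hF hF' (n := n + 1) (fun _ _ x _ => congr($h x)) n n.lt_succ_self x hx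

end IsCoderivationAlong

namespace IsCoalgHom

variable {F F' : Sym 𝒱 →ₗ[K] Sym 𝒲}

theorem isCoderivationAlong_sub (hF' : IsCoalgHom 𝒱 𝒲 F') (hF : IsCoalgHom 𝒱 𝒲 F) :
    IsCoderivationAlong F' F (F' - F) := by
  rw [IsCoderivationAlong, LinearMap.comp_sub, hF.comul_comp, hF'.comul_comp,
    ← LinearMap.sub_comp]
  congr 1
  exact TensorProduct.ext' fun a b => by
    simp only [LinearMap.sub_apply, LinearMap.add_apply, TensorProduct.map_tmul,
      TensorProduct.sub_tmul, TensorProduct.tmul_sub]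
    abel

variable [CharZero K]

theorem eq_of_proj_sub_eq_zero (hF' : IsCoalgHom 𝒱 𝒲 F') (hF : IsCoalgHom 𝒱 𝒲 F) {n : ℕ}
    (h : ∀ k < n, ∀ x ∈ power 𝒱 k, proj 𝒲 ((F' - F) x) = 0) :
    ∀ k < n, ∀ x ∈ power 𝒱 k, F' x = F x := fun k hk x hx =>
  sub_eq_zero.mp ((hF'.isCoderivationAlong_sub hF).eq_zero hF' hF h k hk x hx)

theorem ext_proj (hF' : IsCoalgHom 𝒱 𝒲 F') (hF : IsCoalgHom 𝒱 𝒲 F)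
    (h : proj 𝒲 ∘ₗ F' = proj 𝒲 ∘ₗ F) : F' = F := by
  rw [← sub_eq_zero]
  refine (hF'.isCoderivationAlong_sub hF).eq_zero_of_proj hF' hF ?_
  rw [LinearMap.comp_sub, h, sub_self]

theorem map_ι (hF : IsCoalgHom 𝒱 𝒲 F) (v : V) : F (ι 𝒱 v) = ι 𝒲 (proj 𝒲 (F (ι 𝒱 v))) := by
  refine eq_of_euler_eq ?_ ?_
  · rw [← LinearMap.comp_apply (euler 𝒲), hF.euler_comp, conv_eq_mul_apply_one (n := 1) ?_
      (ι_mem_power v), hF.map_one, mul_one, euler_ι]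
    · rfl
    · intro k hk x hx
      obtain rfl := Nat.lt_one_iff.mp hk
      rw [LinearMap.comp_apply, LinearMap.comp_apply, hF.proj_of_mem_power_zero hx, _root_.map_zero]
  · rw [← LinearMap.comp_apply, hF.counit_comp, counit_ι, counit_ι]

theorem map_mem_powerLT (hF : IsCoalgHom 𝒱 𝒲 F) {n : ℕ} {x : Sym 𝒱} (hx : x ∈ power 𝒱 n) :
    F x ∈ powerLT 𝒲 (n + 1) := by
  induction n using Nat.strong_induction_on generalizing x with
  | _ n ih =>
    rcases eq_or_ne n 0 with rfl | hn
    · obtain ⟨c, rfl⟩ := exists_eq_smul_one_of_mem_power_zero hx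
      rw [map_smul, hF.map_one]
      exact Submodule.smul_mem _ _ (power_le_powerLT Nat.zero_lt_one one_mem_power)
    refine mem_powerLT_of_euler_mem ?_ ?_
    · rw [← LinearMap.comp_apply (euler 𝒲), hF.euler_comp]
      refine conv_mem_of_mem_power (fun i j hij a ha b hb => ?_) hx
      rw [LinearMap.comp_apply, LinearMap.comp_apply]
      rcases eq_or_ne i 0 with rfl | hi
      · rw [hF.proj_of_mem_power_zero ha, map_zero, zero_mul]
        exact zero_mem _
      · exact powerLT_mono (by omega) (ι_mul_mem_powerLT _ (ih j (by omega) hb))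
    · rw [← LinearMap.comp_apply, hF.counit_comp, counit_of_mem_power hn hx]

end IsCoalgHom

theorem IsCoderivationAlong.mem_powerLT [CharZero K] {F F' D : Sym 𝒱 →ₗ[K] Sym 𝒲}
    (hD : IsCoderivationAlong F F' D) (hF : IsCoalgHom 𝒱 𝒲 F) (hF' : IsCoalgHom 𝒱 𝒲 F')
    (h : ∀ k < 2, ∀ x ∈ power 𝒱 k, proj 𝒲 (D x) = 0) {n : ℕ} {x : Sym 𝒱} (hx : x ∈ power 𝒱 n) :
    D x ∈ powerLT 𝒲 n := by
  induction n using Nat.strong_induction_on generalizing x with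
  | _ n ih =>
    refine mem_powerLT_of_euler_mem ?_ congr($(hD.counit_comp hF hF') x)
    rw [← LinearMap.comp_apply (euler 𝒲), hD.euler_comp, LinearMap.add_apply]
    refine add_mem (conv_mem_of_mem_power (fun i j hij a ha b hb => ?_) hx)
      (conv_mem_of_mem_power (fun i j hij a ha b hb => ?_) hx)
    · rw [LinearMap.comp_apply, LinearMap.comp_apply]
      by_cases hi : i < 2
      · rw [h i hi a ha, map_zero, zero_mul]
        exact zero_mem _
      · exact powerLT_mono (by omega) (ι_mul_mem_powerLT _ (hF.map_mem_powerLT hb))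
    · rw [LinearMap.comp_apply, LinearMap.comp_apply]
      rcases eq_or_ne i 0 with rfl | hi
      · rw [hF'.proj_of_mem_power_zero ha, map_zero, zero_mul]
        exact zero_mem _
      · exact powerLT_mono (by omega) (ι_mul_mem_powerLT _ (ih j (by omega) hb))

end CoalgebraMorphisms

/-! ### The coalgebra morphism with given Taylor coefficients -/

section TaylorCoefficients

variable {K V W : Type*} [Field K] [AddCommGroup V] [Module K V] [AddCommGroup W] [Module K W]
  {𝒱 : ℤ → Submodule K V} {𝒲 : ℤ → Submodule K W} [DirectSum.Decomposition 𝒱]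

section ConvolutionPowers

/-- The `k`-th power of a linear map from `S(V)` to an algebra under convolution. -/
def convPow {A : Type*} [Ring A] [Algebra K A] (f : Sym 𝒱 →ₗ[K] A) (k : ℕ) : Sym 𝒱 →ₗ[K] A :=
  (WithConv.toConv f ^ k).ofConv

section Algebra

variable {A B : Type*} [Ring A] [Algebra K A] [Ring B] [Algebra K B]

theorem convPow_zero_apply (f : Sym 𝒱 →ₗ[K] A) (x : Sym 𝒱) :
    convPow f 0 x = counit 𝒱 x • 1 := by
  rw [convPow, pow_zero, ← Algebra.algebraMap_eq_smul_one]
  rfl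

theorem convPow_one (f : Sym 𝒱 →ₗ[K] A) : convPow f 1 = f := by
  rw [convPow, pow_one]

theorem convPow_succ (f : Sym 𝒱 →ₗ[K] A) (k : ℕ) : convPow f (k + 1) = conv f (convPow f k) := by
  rw [convPow, pow_succ']
  rfl

theorem algHom_comp_convPow (h : A →ₐ[K] B) (f : Sym 𝒱 →ₗ[K] A) (k : ℕ) :
    h.toLinearMap ∘ₗ convPow f k = convPow (h.toLinearMap ∘ₗ f) k := by
  induction k with
  | zero =>
    ext x
    simp [convPow_zero_apply]
  | succ k ih =>
    rw [convPow_succ, convPow_succ, ← ih]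
    exact LinearMap.algHom_comp_convMul_distrib _ _ _

theorem convPow_add_of_conv_comm {f g : Sym 𝒱 →ₗ[K] A} (h : conv f g = conv g f) (k : ℕ) :
    convPow (f + g) k = ∑ m ∈ Finset.HasAntidiagonal.antidiagonal k,
      k.choose m.1 • conv (convPow f m.1) (convPow g m.2) := by
  have commute : Commute (WithConv.toConv f) (WithConv.toConv g) := WithConv.ofConv_injective h
  rw [convPow, WithConv.toConv_add, commute.add_pow', WithConv.ofConv_sum]
  rfl

end Algebra

variable {f : Sym 𝒱 →ₗ[K] W}

theorem convPow_ι_comp_mem_grading (hf : HasDegree (grading 𝒱) 𝒲 0 f) (k : ℕ) {d : ℤ} {x : Sym 𝒱}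
    (hx : x ∈ grading 𝒱 d) : convPow (ι 𝒲 ∘ₗ f) k x ∈ grading 𝒲 d := by
  induction k generalizing d x with
  | zero =>
    rw [convPow_zero_apply]
    refine grading_le (fun d => (grading 𝒲 d).comap ((counit 𝒱).smulRight 1)) ?_
      (fun d i v _ x _ => ?_) d hx
    · simpa [counit_one] using one_mem_grading
    · simp [counit_ι_mul]
  | succ k ih =>
    rw [convPow_succ]
    refine conv_mem_of_mem_grading (fun i j hij a ha b hb => ?_) hx
    rw [← hij]
    exact ι_mul_mem_grading (hf.map_mem ha) (ih hb)

theorem convPow_ι_comp_mem_power (f : Sym 𝒱 →ₗ[K] W) (k : ℕ) (x : Sym 𝒱) :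
    convPow (ι 𝒲 ∘ₗ f) k x ∈ power 𝒲 k := by
  induction k generalizing x with
  | zero =>
    rw [convPow_zero_apply]
    exact Submodule.smul_mem _ _ one_mem_power
  | succ k ih =>
    rw [convPow_succ, conv_apply]
    induction comul 𝒱 x with
    | zero => simp
    | add y z hy hz => rw [map_add, map_add]; exact add_mem hy hz
    | tmul a b => exact ι_mul_mem_power _ (ih b)

theorem convPow_ι_comp_eq_zero (hf : f 1 = 0) {k n : ℕ} (h : n < k) {x : Sym 𝒱}
    (hx : x ∈ power 𝒱 n) : convPow (ι 𝒲 ∘ₗ f) k x = 0 := by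
  induction k generalizing n x with
  | zero => omega
  | succ k ih =>
    rw [convPow_succ, ← Submodule.mem_bot K]
    refine conv_mem_of_mem_power (fun i j hij a ha b hb => ?_) hx
    rw [Submodule.mem_bot]
    rcases eq_or_ne i 0 with rfl | hi
    · obtain ⟨c, rfl⟩ := exists_eq_smul_one_of_mem_power_zero ha
      rw [map_smul, LinearMap.comp_apply, hf, map_zero, smul_zero, zero_mul]
    · rw [ih (by omega) hb, mul_zero]

variable [DirectSum.Decomposition 𝒲]

theorem includeLeft_mul_includeRight (a b : Sym 𝒲) :
    GradedTensorProduct.includeLeft (grading 𝒲) (grading 𝒲) a *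
        GradedTensorProduct.includeRight (grading 𝒲) (grading 𝒲) b =
      GradedTensorProduct.of K (grading 𝒲) (grading 𝒲) (a ⊗ₜ b) :=
  GradedTensorProduct.tmul_one_mul_one_tmul _ _ a b

theorem conv_includeLeft_includeRight (g h : Sym 𝒱 →ₗ[K] Sym 𝒲) :
    conv ((GradedTensorProduct.includeLeft (grading 𝒲) (grading 𝒲)).toLinearMap ∘ₗ g)
        ((GradedTensorProduct.includeRight (grading 𝒲) (grading 𝒲)).toLinearMap ∘ₗ h) =
      (GradedTensorProduct.of K (grading 𝒲) (grading 𝒲)).toLinearMap ∘ₗ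
        TensorProduct.map g h ∘ₗ comul 𝒱 := by
  suffices e : LinearMap.mul' K _ ∘ₗ TensorProduct.map
      ((GradedTensorProduct.includeLeft (grading 𝒲) (grading 𝒲)).toLinearMap ∘ₗ g)
      ((GradedTensorProduct.includeRight (grading 𝒲) (grading 𝒲)).toLinearMap ∘ₗ h) =
      (GradedTensorProduct.of K (grading 𝒲) (grading 𝒲)).toLinearMap ∘ₗ TensorProduct.map g h from
    congr($e ∘ₗ comul 𝒱)
  exact TensorProduct.ext' fun a b => includeLeft_mul_includeRight (g a) (h b)

theorem includeRight_mul_includeLeft {i j : ℤ} {a b : Sym 𝒲} (ha : a ∈ grading 𝒲 i)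
    (hb : b ∈ grading 𝒲 j) :
    GradedTensorProduct.includeRight (grading 𝒲) (grading 𝒲) a *
        GradedTensorProduct.includeLeft (grading 𝒲) (grading 𝒲) b =
      ksign K (i * j) • GradedTensorProduct.of K (grading 𝒲) (grading 𝒲) (b ⊗ₜ a) := by
  refine (includeRight_mul_of ha (b ⊗ₜ 1)).trans ?_
  rw [TensorProduct.map_tmul, signTwist_of_mem i hb, LinearMap.mulLeft_apply, mul_one,
    ← TensorProduct.smul_tmul', map_smul]

theorem comm_of_tmul {i j : ℤ} {a b : Sym 𝒱} (ha : a ∈ grading 𝒱 i) (hb : b ∈ grading 𝒱 j) :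
    GradedTensorProduct.comm (grading 𝒱) (grading 𝒱)
        (GradedTensorProduct.of K (grading 𝒱) (grading 𝒱) (a ⊗ₜ b)) =
      ksign K (i * j) • GradedTensorProduct.of K (grading 𝒱) (grading 𝒱) (b ⊗ₜ a) := by
  rw [ksign, Int.cast_smul_eq_zsmul, mul_comm]
  exact GradedTensorProduct.comm_coe_tmul_coe (R := K) (grading 𝒱) (grading 𝒱) ⟨a, ha⟩ ⟨b, hb⟩

/-- Koszul's sign in `S(W) ⊗ S(W)` cancels the one in the cocommutativity of `S(V)`. -/
theorem conv_includeLeft_includeRight_comm {φ : Sym 𝒱 →ₗ[K] Sym 𝒲}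
    (hφ : HasDegree (grading 𝒱) (grading 𝒲) 0 φ) :
    conv ((GradedTensorProduct.includeLeft (grading 𝒲) (grading 𝒲)).toLinearMap ∘ₗ φ)
        ((GradedTensorProduct.includeRight (grading 𝒲) (grading 𝒲)).toLinearMap ∘ₗ φ) =
      conv ((GradedTensorProduct.includeRight (grading 𝒲) (grading 𝒲)).toLinearMap ∘ₗ φ)
        ((GradedTensorProduct.includeLeft (grading 𝒲) (grading 𝒲)).toLinearMap ∘ₗ φ) := by
  let swap : Module.End K (Sym 𝒱 ⊗[K] Sym 𝒱) :=
    (GradedTensorProduct.of K (grading 𝒱) (grading 𝒱)).symm.toLinearMap ∘ₗ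
      (GradedTensorProduct.comm (R := K) (grading 𝒱) (grading 𝒱)).toLinearMap ∘ₗ
        (GradedTensorProduct.of K (grading 𝒱) (grading 𝒱)).toLinearMap
  have swap_comul (x : Sym 𝒱) : swap (comul 𝒱 x) = comul 𝒱 x := by
    apply (GradedTensorProduct.of K (grading 𝒱) (grading 𝒱)).injective
    exact comm_gradedComul x
  have swap_tmul {i j : ℤ} {a b : Sym 𝒱} (ha : a ∈ grading 𝒱 i) (hb : b ∈ grading 𝒱 j) :
      swap (a ⊗ₜ b) = ksign K (i * j) • b ⊗ₜ a :=
    (GradedTensorProduct.of K (grading 𝒱) (grading 𝒱)).injective (comm_of_tmul ha hb)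
  let L := (GradedTensorProduct.includeLeft (grading 𝒲) (grading 𝒲)).toLinearMap ∘ₗ φ
  let R := (GradedTensorProduct.includeRight (grading 𝒲) (grading 𝒲)).toLinearMap ∘ₗ φ
  refine linearMap_ext_of_mem (grading 𝒱) fun d x hx => ?_
  rw [conv_apply, ← swap_comul x, ← sub_eq_zero, ← Submodule.mem_bot K]
  refine map_comul_mem_of_mem_grading (LinearMap.mul' K _ ∘ₗ TensorProduct.map L R ∘ₗ swap -
    LinearMap.mul' K _ ∘ₗ TensorProduct.map R L) (fun i j _ a ha b hb => ?_) hx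
  rw [Submodule.mem_bot, LinearMap.sub_apply, sub_eq_zero]
  calc LinearMap.mul' K _ (TensorProduct.map L R (swap (a ⊗ₜ b)))
    _ = ksign K (i * j) • (L b * R a) := by
      rw [swap_tmul ha hb, map_smul, map_smul]
      rfl
    _ = R a * L b := by
      exact (congrArg _ (includeLeft_mul_includeRight _ _)).trans
        (includeRight_mul_includeLeft (hφ.map_mem ha) (hφ.map_mem hb)).symm

theorem comul_convPow {f : Sym 𝒱 →ₗ[K] W} (hf : HasDegree (grading 𝒱) 𝒲 0 f) (k : ℕ)
    (x : Sym 𝒱) :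
    comul 𝒲 (convPow (ι 𝒲 ∘ₗ f) k x) =
      ∑ m ∈ Finset.HasAntidiagonal.antidiagonal k, k.choose m.1 •
        TensorProduct.map (convPow (ι 𝒲 ∘ₗ f) m.1) (convPow (ι 𝒲 ∘ₗ f) m.2) (comul 𝒱 x) := by
  apply (GradedTensorProduct.of K (grading 𝒲) (grading 𝒲)).injective
  have gradedComul_comp : (gradedComul 𝒲).toLinearMap ∘ₗ ι 𝒲 ∘ₗ f =
      (GradedTensorProduct.includeLeft (grading 𝒲) (grading 𝒲)).toLinearMap ∘ₗ ι 𝒲 ∘ₗ f +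
      (GradedTensorProduct.includeRight (grading 𝒲) (grading 𝒲)).toLinearMap ∘ₗ ι 𝒲 ∘ₗ f :=
    LinearMap.ext fun x => gradedComul_ι (f x)
  calc GradedTensorProduct.of K (grading 𝒲) (grading 𝒲) (comul 𝒲 (convPow (ι 𝒲 ∘ₗ f) k x))
    _ = convPow ((gradedComul 𝒲).toLinearMap ∘ₗ ι 𝒲 ∘ₗ f) k x := by
      rw [of_comul, ← algHom_comp_convPow]
      rfl
    _ = _ := by
      rw [gradedComul_comp, convPow_add_of_conv_comm
        (conv_includeLeft_includeRight_comm (ι_hasDegree.comp hf (add_zero 0))),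
        LinearMap.sum_apply, map_sum]
      refine Finset.sum_congr rfl fun m _ => ?_
      rw [← algHom_comp_convPow, ← algHom_comp_convPow, conv_includeLeft_includeRight,
        LinearMap.smul_apply, map_nsmul]
      rfl

end ConvolutionPowers

section Exponential

variable (𝒲) in
/-- The component with values in `W^{⊙k}` of the coalgebra morphism with Taylor coefficients `f`:
the `k`-th term of the exponential series of `f` under convolution. -/
def expComponent (f : Sym 𝒱 →ₗ[K] W) (k : ℕ) : Sym 𝒱 →ₗ[K] Sym 𝒲 :=
  (k.factorial : K)⁻¹ • convPow (ι 𝒲 ∘ₗ f) k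

variable (𝒲) in
/-- The coalgebra morphism with Taylor coefficients `f`: the exponential series of `f` under
convolution, which is a finite sum on each `V^{⊙n}` when `f 1 = 0`. -/
def coexp (f : Sym 𝒱 →ₗ[K] W) : Sym 𝒱 →ₗ[K] Sym 𝒲 :=
  ofComponents (power 𝒱) fun n => ∑ k ∈ Finset.range (n + 1), expComponent 𝒲 f k

variable {f : Sym 𝒱 →ₗ[K] W}

theorem expComponent_mem_power (k : ℕ) (x : Sym 𝒱) : expComponent 𝒲 f k x ∈ power 𝒲 k :=
  Submodule.smul_mem _ _ (convPow_ι_comp_mem_power f k x)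

theorem expComponent_eq_zero (hf : f 1 = 0) {k n : ℕ} (h : n < k) {x : Sym 𝒱}
    (hx : x ∈ power 𝒱 n) : expComponent 𝒲 f k x = 0 := by
  rw [expComponent, LinearMap.smul_apply, convPow_ι_comp_eq_zero hf h hx, smul_zero]

theorem expComponent_zero (x : Sym 𝒱) : expComponent 𝒲 f 0 x = counit 𝒱 x • 1 := by
  rw [expComponent, LinearMap.smul_apply, convPow_zero_apply, Nat.factorial_zero, Nat.cast_one,
    inv_one, one_smul]

theorem expComponent_one (x : Sym 𝒱) : expComponent 𝒲 f 1 x = ι 𝒲 (f x) := by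
  rw [expComponent, convPow_one, Nat.factorial_one, Nat.cast_one, inv_one, one_smul,
    LinearMap.comp_apply]

theorem coexp_of_mem (hf : f 1 = 0) {n N : ℕ} (h : n ≤ N) {x : Sym 𝒱} (hx : x ∈ power 𝒱 n) :
    coexp 𝒲 f x = ∑ k ∈ Finset.range (N + 1), expComponent 𝒲 f k x := by
  rw [coexp, ofComponents_of_mem _ _ hx, LinearMap.sum_apply]
  refine Finset.sum_subset (Finset.range_mono (by omega)) fun k _ hk => ?_
  rw [Finset.mem_range, not_lt] at hk
  exact expComponent_eq_zero hf (by omega) hx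

theorem exists_coexp_eq_sum (hf : f 1 = 0) (x : Sym 𝒱) :
    ∃ N, coexp 𝒲 f x = ∑ k ∈ Finset.range (N + 1), expComponent 𝒲 f k x := by
  obtain ⟨N, hN⟩ := exists_mem_powerLT x
  have h : powerLT 𝒱 N ≤ LinearMap.eqLocus (coexp 𝒲 f)
      (∑ k ∈ Finset.range (N + 1), expComponent 𝒲 f k) := powerLT_le fun k hk x hx => by
    rw [LinearMap.mem_eqLocus, coexp_of_mem hf hk.le hx, LinearMap.sum_apply]
  exact ⟨N, (h hN).trans (LinearMap.sum_apply _ _ _)⟩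

theorem map_coexp_comul (hf : f 1 = 0) {n : ℕ} {x : Sym 𝒱} (hx : x ∈ power 𝒱 n) :
    TensorProduct.map (coexp 𝒲 f) (coexp 𝒲 f) (comul 𝒱 x) =
      ∑ k ∈ Finset.range (n + 1), ∑ m ∈ Finset.HasAntidiagonal.antidiagonal k,
        TensorProduct.map (expComponent 𝒲 f m.1) (expComponent 𝒲 f m.2) (comul 𝒱 x) := by
  simp only [Finset.Nat.sum_antidiagonal_eq_sum_range_succ
    (fun p q => TensorProduct.map (expComponent 𝒲 f p) (expComponent 𝒲 f q) (comul 𝒱 x))]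
  rw [Finset.sum_range_diag_flip (n + 1)
    fun p q => TensorProduct.map (expComponent 𝒲 f p) (expComponent 𝒲 f q) (comul 𝒱 x)]
  suffices h : TensorProduct.map (coexp 𝒲 f) (coexp 𝒲 f) (comul 𝒱 x) =
      (∑ p ∈ Finset.range (n + 1), ∑ q ∈ Finset.range (n + 1 - p),
        TensorProduct.map (expComponent 𝒲 f p) (expComponent 𝒲 f q)) (comul 𝒱 x) by
    simpa only [LinearMap.sum_apply] using h
  refine map_comul_eq_of_mem_power (fun i j hij a ha b hb => ?_) hx
  simp only [LinearMap.sum_apply, TensorProduct.map_tmul]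
  rw [coexp_of_mem hf (by omega : i ≤ n) ha, TensorProduct.sum_tmul]
  refine Finset.sum_congr rfl fun p _ => ?_
  rcases lt_or_ge i p with hp | hp
  · simp [expComponent_eq_zero hf hp ha]
  · rw [coexp_of_mem hf (by omega : j ≤ n - p) hb, TensorProduct.tmul_sum,
      Nat.sub_add_comm (by omega : p ≤ n)]

variable [DirectSum.Decomposition 𝒲]

theorem proj_coexp (hf1 : f 1 = 0) (x : Sym 𝒱) : proj 𝒲 (coexp 𝒲 f x) = f x := by
  suffices h : proj 𝒲 ∘ₗ coexp 𝒲 f = f from congr($h x)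
  refine linearMap_ext_of_mem (power 𝒱) fun n x hx => ?_
  rw [LinearMap.comp_apply, coexp_of_mem hf1 (Nat.le_succ n) hx, map_sum,
    Finset.sum_eq_single_of_mem 1 (by simp) fun k _ hk =>
      proj_of_mem_power hk (expComponent_mem_power k x),
    expComponent_one, proj_ι]

variable [CharZero K]

theorem comul_expComponent (hf : HasDegree (grading 𝒱) 𝒲 0 f) (k : ℕ) (x : Sym 𝒱) :
    comul 𝒲 (expComponent 𝒲 f k x) = ∑ m ∈ Finset.HasAntidiagonal.antidiagonal k,
      TensorProduct.map (expComponent 𝒲 f m.1) (expComponent 𝒲 f m.2) (comul 𝒱 x) := by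
  rw [expComponent, LinearMap.smul_apply, map_smul, comul_convPow hf, Finset.smul_sum]
  refine Finset.sum_congr rfl fun m hm => ?_
  rw [Finset.HasAntidiagonal.mem_antidiagonal] at hm
  subst hm
  rw [expComponent, expComponent, TensorProduct.map_smul_left, TensorProduct.map_smul_right,
    LinearMap.smul_apply, LinearMap.smul_apply, smul_smul, ← Nat.cast_smul_eq_nsmul K, smul_smul,
    Nat.cast_add_choose]
  have factorial_ne_zero (n : ℕ) : (n.factorial : K) ≠ 0 := Nat.cast_ne_zero.mpr n.factorial_ne_zero
  congr 1
  field_simp [factorial_ne_zero]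

theorem isCoalgHom_coexp (hf1 : f 1 = 0) (hf : HasDegree (grading 𝒱) 𝒲 0 f) :
    IsCoalgHom 𝒱 𝒲 (coexp 𝒲 f) where
  degree := hasDegree_zero_iff.mpr fun d x hx => by
    obtain ⟨N, hN⟩ := exists_coexp_eq_sum (𝒲 := 𝒲) hf1 x
    rw [hN]
    exact Submodule.sum_mem _ fun k _ =>
      Submodule.smul_mem _ _ (convPow_ι_comp_mem_grading hf k hx)
  comul_comp := linearMap_ext_of_mem (power 𝒱) fun n x hx => by
    rw [LinearMap.comp_apply, LinearMap.comp_apply, coexp_of_mem hf1 le_rfl hx, map_sum,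
      map_coexp_comul hf1 hx]
    exact Finset.sum_congr rfl fun k _ => comul_expComponent hf k x
  counit_comp := linearMap_ext_of_mem (power 𝒱) fun n x hx => by
    rw [LinearMap.comp_apply, coexp_of_mem hf1 le_rfl hx, map_sum,
      Finset.sum_eq_single_of_mem 0 (by simp) fun k _ hk =>
        counit_of_mem_power hk (expComponent_mem_power k x),
      expComponent_zero, map_smul, counit_one, smul_eq_mul, mul_one]
  map_one := by
    rw [coexp_of_mem hf1 le_rfl one_mem_power, Finset.sum_range_one, expComponent_zero, counit_one,
      one_smul]

end Exponential

end TaylorCoefficients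

section Isomorphisms

variable {K V W : Type*} [Field K] [AddCommGroup V] [Module K V] [AddCommGroup W] [Module K W]
  {𝒱 : ℤ → Submodule K V} {𝒲 : ℤ → Submodule K W}

section Bijective

variable {T : Sym 𝒱 →ₗ[K] Sym 𝒱}

theorem injective_of_sub_mem_powerLT (h : ∀ n, ∀ x ∈ power 𝒱 n, T x - x ∈ powerLT 𝒱 n) :
    Function.Injective T := by
  rw [injective_iff_map_eq_zero]
  intro x hx
  obtain ⟨N, hN⟩ := exists_mem_powerLT x
  induction N with
  | zero => rwa [powerLT_zero, Submodule.mem_bot] at hN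
  | succ n ih =>
    have lowers : powerLT 𝒱 (n + 1) ≤ (powerLT 𝒱 n).comap (T - LinearMap.id) :=
      powerLT_le fun k hk y hy => powerLT_mono (by omega) (h k y hy)
    apply ih
    simpa [hx] using lowers hN

theorem surjective_of_sub_mem_powerLT (h : ∀ n, ∀ x ∈ power 𝒱 n, T x - x ∈ powerLT 𝒱 n) :
    Function.Surjective T := by
  have power_le_range (n : ℕ) : power 𝒱 n ≤ LinearMap.range T := by
    induction n using Nat.strong_induction_on with
    | _ n ih =>
      intro x hx
      rw [← sub_sub_cancel (T x) x]
      exact sub_mem ⟨x, rfl⟩ (powerLT_le ih (h n x hx))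
  intro x
  obtain ⟨N, hN⟩ := exists_mem_powerLT x
  exact powerLT_le (fun k _ => power_le_range k) hN

end Bijective

section MapEquiv

variable [DirectSum.Decomposition 𝒱] [DirectSum.Decomposition 𝒲] (γ : V ≃ₗ[K] W)
  (hγ : HasDegree 𝒱 𝒲 0 γ.toLinearMap)

theorem map_map_symm (x : Sym 𝒲) :
    map γ.toLinearMap hγ (map γ.symm.toLinearMap hγ.symm x) = x := by
  suffices h : (map γ.toLinearMap hγ).comp (map γ.symm.toLinearMap hγ.symm) =
      AlgHom.id K (Sym 𝒲) from congr($h x)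
  exact algHom_ext 𝒲 fun v => by simp

theorem map_symm_map (x : Sym 𝒱) :
    map γ.symm.toLinearMap hγ.symm (map γ.toLinearMap hγ x) = x := by
  suffices h : (map γ.symm.toLinearMap hγ.symm).comp (map γ.toLinearMap hγ) =
      AlgHom.id K (Sym 𝒱) from congr($h x)
  exact algHom_ext 𝒱 fun v => by simp

theorem map_bijective : Function.Bijective (map γ.toLinearMap hγ) :=
  Function.bijective_iff_has_inverse.mpr ⟨_, map_symm_map γ hγ, map_map_symm γ hγ⟩

end MapEquiv

variable [DirectSum.Decomposition 𝒱] [DirectSum.Decomposition 𝒲]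

theorem IsCoalgHom.linearPart_hasDegree {F : Sym 𝒱 →ₗ[K] Sym 𝒲} (hF : IsCoalgHom 𝒱 𝒲 F) :
    HasDegree 𝒱 𝒲 0 (linearPart F) :=
  proj_hasDegree.comp (hF.degree.comp ι_hasDegree (add_zero 0)) (add_zero 0)

theorem IsCoalgHom.sub_map_mem_powerLT [CharZero K] {F : Sym 𝒱 →ₗ[K] Sym 𝒲}
    (hF : IsCoalgHom 𝒱 𝒲 F) {n : ℕ} {x : Sym 𝒱} (hx : x ∈ power 𝒱 n) :
    F x - map (linearPart F) hF.linearPart_hasDegree x ∈ powerLT 𝒲 n := by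
  have hS := isCoalgHom_map (linearPart F) hF.linearPart_hasDegree
  refine (hF.isCoderivationAlong_sub hS).mem_powerLT hF hS (fun k hk x hx => ?_) hx
  rw [LinearMap.sub_apply, map_sub, sub_eq_zero]
  interval_cases k
  · rw [hF.proj_of_mem_power_zero hx, hS.proj_of_mem_power_zero hx]
  · obtain ⟨v, rfl⟩ := exists_eq_ι_of_mem_power_one hx
    rw [AlgHom.toLinearMap_apply, Sym.map_ι, proj_ι]
    rfl

/-- Up to the automorphism `S(f₁)` the map `F` is the identity modulo terms of lower weight. -/
theorem IsCoalgHom.bijective [CharZero K] {F : Sym 𝒱 →ₗ[K] Sym 𝒲} (hF : IsCoalgHom 𝒱 𝒲 F)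
    (h : Function.Bijective (linearPart F)) : Function.Bijective F := by
  let γ : V ≃ₗ[K] W := LinearEquiv.ofBijective (linearPart F) h
  have hγ : HasDegree 𝒱 𝒲 0 γ.toLinearMap := hF.linearPart_hasDegree
  let T : Sym 𝒱 →ₗ[K] Sym 𝒱 := (map γ.symm.toLinearMap hγ.symm).toLinearMap ∘ₗ F
  have T_sub (n : ℕ) (x : Sym 𝒱) (hx : x ∈ power 𝒱 n) : T x - x ∈ powerLT 𝒱 n := by
    have map_symm_mem : powerLT 𝒲 n ≤
        (powerLT 𝒱 n).comap (map γ.symm.toLinearMap hγ.symm).toLinearMap :=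
      powerLT_le fun k hk y hy => power_le_powerLT hk (map_mem_power _ _ k hy)
    have T_sub_eq : T x - x = map γ.symm.toLinearMap hγ.symm (F x - map γ.toLinearMap hγ x) := by
      rw [map_sub, map_symm_map]
      rfl
    rw [T_sub_eq]
    exact map_symm_mem (hF.sub_map_mem_powerLT hx)
  have F_eq : F = (map γ.toLinearMap hγ).toLinearMap ∘ₗ T :=
    LinearMap.ext fun x => (map_map_symm γ hγ (F x)).symm
  rw [F_eq, LinearMap.coe_comp]
  exact (map_bijective γ hγ).comp
    ⟨injective_of_sub_mem_powerLT T_sub, surjective_of_sub_mem_powerLT T_sub⟩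

section Compose

variable {U : Type*} [AddCommGroup U] [Module K U] {𝒰 : ℤ → Submodule K U}
  [DirectSum.Decomposition 𝒰]

theorem IsCoderivationAlong.comp_isCoalgHom {F F' D : Sym 𝒲 →ₗ[K] Sym 𝒰}
    (hD : IsCoderivationAlong F F' D) {Φ : Sym 𝒱 →ₗ[K] Sym 𝒲} (hΦ : IsCoalgHom 𝒱 𝒲 Φ) :
    IsCoderivationAlong (F ∘ₗ Φ) (F' ∘ₗ Φ) (D ∘ₗ Φ) := by
  rw [IsCoderivationAlong, ← LinearMap.comp_assoc, hD, LinearMap.comp_assoc, hΦ.comul_comp,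
    ← LinearMap.comp_assoc, LinearMap.add_comp, ← TensorProduct.map_comp,
    ← TensorProduct.map_comp]

theorem IsCoderivationAlong.isCoalgHom_comp {F F' D : Sym 𝒱 →ₗ[K] Sym 𝒲}
    (hD : IsCoderivationAlong F F' D) {Φ : Sym 𝒲 →ₗ[K] Sym 𝒰} (hΦ : IsCoalgHom 𝒲 𝒰 Φ) :
    IsCoderivationAlong (Φ ∘ₗ F) (Φ ∘ₗ F') (Φ ∘ₗ D) := by
  rw [IsCoderivationAlong, ← LinearMap.comp_assoc, hΦ.comul_comp, LinearMap.comp_assoc, hD,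
    ← LinearMap.comp_assoc, LinearMap.comp_add, ← TensorProduct.map_comp,
    ← TensorProduct.map_comp]

theorem IsCoalgHom.symm {Ψ : Sym 𝒱 ≃ₗ[K] Sym 𝒲} (hΨ : IsCoalgHom 𝒱 𝒲 Ψ.toLinearMap) :
    IsCoalgHom 𝒲 𝒱 Ψ.symm.toLinearMap where
  degree := hΨ.degree.symm
  comul_comp := by
    have map_symm_comp : TensorProduct.map Ψ.symm.toLinearMap Ψ.symm.toLinearMap ∘ₗ
        TensorProduct.map Ψ.toLinearMap Ψ.toLinearMap = LinearMap.id := by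
      rw [← TensorProduct.map_comp, LinearEquiv.symm_comp, TensorProduct.map_id]
    rw [← LinearMap.id_comp (comul 𝒱 ∘ₗ _), ← map_symm_comp, LinearMap.comp_assoc,
      ← LinearMap.comp_assoc _ (comul 𝒱), ← hΨ.comul_comp, LinearMap.comp_assoc,
      LinearEquiv.comp_symm, LinearMap.comp_id]
  counit_comp := by
    rw [← hΨ.counit_comp, LinearMap.comp_assoc, LinearEquiv.comp_symm, LinearMap.comp_id]
  map_one := (LinearEquiv.symm_apply_eq Ψ).mpr hΨ.map_one.symm

end Compose

section Prod

omit [DirectSum.Decomposition 𝒱] [DirectSum.Decomposition 𝒲] in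
theorem prod_apply (n : ℕ) (v : Fin n → V) :
    prod 𝒱 n v = (List.ofFn fun k => ι 𝒱 (v k)).prod := by
  simp [prod]

theorem power_le_of_prod_mem (n : ℕ) {P : Submodule K (Sym 𝒱)} (h : ∀ v, prod 𝒱 n v ∈ P) :
    power 𝒱 n ≤ P := by
  refine le_trans (power_le (fun n => Submodule.span K (Set.range (prod 𝒱 n))) ?_
    (fun n i v _ x hx => ?_) n) (Submodule.span_le.mpr (Set.range_subset_iff.mpr h))
  · exact Submodule.subset_span ⟨fun _ => 0, by rw [prod_apply]; simp⟩
  · refine (Submodule.map_span_le (LinearMap.mulLeft K (ι 𝒱 v)) _ _).mpr ?_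
      (Submodule.mem_map_of_mem hx)
    rintro _ ⟨w, rfl⟩
    refine Submodule.subset_span ⟨Fin.cons v w, ?_⟩
    rw [prod_apply, prod_apply, List.ofFn_succ, List.prod_cons]
    simp

omit [DirectSum.Decomposition 𝒱] [DirectSum.Decomposition 𝒲] in
theorem map_prod (f : V →ₗ[K] W) (hf : HasDegree 𝒱 𝒲 0 f) (n : ℕ) (v : Fin n → V) :
    map f hf (prod 𝒱 n v) = prod 𝒲 n fun k => f (v k) := by
  rw [prod_apply, prod_apply, map_list_prod, List.map_ofFn]
  simp [Function.comp_def]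

end Prod

omit [DirectSum.Decomposition 𝒲] in
theorem conv_hasDegree {f g : Sym 𝒱 →ₗ[K] Sym 𝒲} (hf : HasDegree (grading 𝒱) (grading 𝒲) 0 f)
    (hg : HasDegree (grading 𝒱) (grading 𝒲) 0 g) :
    HasDegree (grading 𝒱) (grading 𝒲) 0 (conv f g) :=
  hasDegree_zero_iff.mpr fun _ _ hx => conv_mem_of_mem_grading (fun _ _ hij _ ha _ hb =>
    hij ▸ SetLike.GradedMul.mul_mem (hf.map_mem ha) (hg.map_mem hb)) hx

theorem euler_hasDegree : HasDegree (grading 𝒱) (grading 𝒱) 0 (euler 𝒱) :=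
  conv_proj_id (𝒱 := 𝒱) ▸ conv_hasDegree (ι_hasDegree.comp proj_hasDegree (add_zero 0))
    isCoalgHom_id.degree

theorem isCoderivationAlong_euler :
    IsCoderivationAlong LinearMap.id LinearMap.id (euler 𝒱) :=
  comul_euler

omit [DirectSum.Decomposition 𝒱] in
theorem powerProj_hasDegree (n : ℕ) : HasDegree (grading 𝒱) (grading 𝒱) 0 (powerProj 𝒱 n) := by
  have grading_le_iInf := grading_le (fun d => ⨅ n, (grading 𝒱 d).comap (powerProj 𝒱 n)) ?_ ?_
  · exact hasDegree_zero_iff.mpr fun d x hx => (Submodule.mem_iInf _).mp (grading_le_iInf d hx) n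
  · refine (Submodule.mem_iInf _).mpr fun n => ?_
    rw [Submodule.mem_comap]
    rcases eq_or_ne n 0 with rfl | hn
    · rw [powerProj_of_mem one_mem_power]
      exact one_mem_grading
    · rw [powerProj_of_mem_of_ne one_mem_power hn.symm]
      exact zero_mem _
  · intro d i v hv x hx
    rw [Submodule.mem_iInf] at hx ⊢
    rintro (_ | n)
    · rw [Submodule.mem_comap, powerProj_zero, counit_ι_mul, zero_smul]
      exact zero_mem _
    · rw [Submodule.mem_comap, powerProj_ι_mul]
      exact ι_mul_mem_grading hv (hx n)

end Isomorphisms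

end Sym

/-! ### Quadratic structures -/

namespace LInftyStr

open LInfty.Sym

variable {K V : Type*} [Field K] [CharZero K] [AddCommGroup V] [Module K V]
  {𝒱 : ℤ → Submodule K V} [DirectSum.Decomposition 𝒱] (A : LInftyStr 𝒱)

omit [CharZero K] in
theorem isCoderivationAlong : IsCoderivationAlong LinearMap.id (signTwist 𝒱 1) A.Q := by
  rw [← signMap_eq_signTwist]
  exact A.isCoderivation.comul_comp

omit [CharZero K] in
theorem counit_Q (x : Sym 𝒱) : counit 𝒱 (A.Q x) = 0 :=
  congr($(A.isCoderivationAlong.counit_comp isCoalgHom_id (isCoalgHom_signTwist 1)) x)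

theorem Q_one : A.Q 1 = 0 := by
  rw [A.isCoderivationAlong.eq_ι_proj isCoalgHom_id (isCoalgHom_signTwist 1) (n := 0)
    (fun k hk => absurd hk (Nat.not_lt_zero k)) one_mem_power, A.proj_Q_one, map_zero]

theorem Q_of_mem_power_zero {x : Sym 𝒱} (hx : x ∈ power 𝒱 0) : A.Q x = 0 := by
  obtain ⟨c, rfl⟩ := exists_eq_smul_one_of_mem_power_zero hx
  rw [map_smul, A.Q_one, smul_zero]

theorem Q_ι (v : V) : A.Q (ι 𝒱 v) = ι 𝒱 (A.q₁ v) :=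
  A.isCoderivationAlong.eq_ι_proj isCoalgHom_id (isCoalgHom_signTwist 1) (n := 1)
    (fun _ hk _ hx => A.Q_of_mem_power_zero (Nat.lt_one_iff.mp hk ▸ hx)) (ι_mem_power v)

/-- The only nonzero Taylor coefficient is the one of order `2`. -/
def IsQuadratic : Prop := ∀ n ≠ 2, ∀ x ∈ power 𝒱 n, proj 𝒱 (A.Q x) = 0

variable {A}

omit [CharZero K] in
theorem isQuadratic_of_q_eq_zero (h : ∀ n ≠ 2, A.q n = 0) : A.IsQuadratic := fun n hn _ hx =>
  power_le_of_prod_mem n (P := LinearMap.ker (proj 𝒱 ∘ₗ A.Q)) (fun v => congr($(h n hn) v)) hx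

namespace IsQuadratic

theorem Q_mem_power (hA : A.IsQuadratic) {n : ℕ} {x : Sym 𝒱} (hx : x ∈ power 𝒱 (n + 1)) :
    A.Q x ∈ power 𝒱 n := by
  induction n using Nat.strong_induction_on generalizing x with
  | _ n ih =>
    refine mem_power_of_euler_mem ?_ (A.counit_Q x)
    rw [← LinearMap.comp_apply (euler 𝒱), A.isCoderivationAlong.euler_comp, LinearMap.add_apply]
    refine add_mem (conv_mem_of_mem_power (fun i j hij a ha b hb => ?_) hx)
      (conv_mem_of_mem_power (fun i j hij a ha b hb => ?_) hx)
    · rw [LinearMap.comp_apply, LinearMap.comp_apply]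
      rcases eq_or_ne i 2 with rfl | hi
      · obtain rfl : n = j + 1 := by omega
        exact ι_mul_mem_power _ hb
      · rw [hA i hi a ha, map_zero, zero_mul]
        exact zero_mem _
    · rw [LinearMap.comp_apply, LinearMap.comp_apply]
      rcases eq_or_ne i 1 with rfl | hi
      · obtain rfl : n = j := by omega
        cases n with
        | zero =>
          rw [A.Q_of_mem_power_zero hb, mul_zero]
          exact zero_mem _
        | succ n => exact ι_mul_mem_power _ (ih n n.lt_succ_self hb)
      · rw [proj_of_mem_power hi (signTwist_mem_power 1 i a ha), map_zero, zero_mul]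
        exact zero_mem _

omit [CharZero K] in
theorem proj_Q (hA : A.IsQuadratic) (x : Sym 𝒱) :
    proj 𝒱 (A.Q x) = proj 𝒱 (A.Q (powerProj 𝒱 2 x)) := by
  suffices h : proj 𝒱 ∘ₗ A.Q = proj 𝒱 ∘ₗ A.Q ∘ₗ powerProj 𝒱 2 from congr($h x)
  refine linearMap_ext_of_mem (power 𝒱) fun n x hx => ?_
  simp only [LinearMap.comp_apply]
  rcases eq_or_ne n 2 with rfl | hn
  · rw [powerProj_of_mem hx]
  · rw [powerProj_of_mem_of_ne hx hn, hA n hn x hx, map_zero, map_zero]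

theorem euler_Q (hA : A.IsQuadratic) (x : Sym 𝒱) :
    euler 𝒱 (A.Q x) - A.Q (euler 𝒱 x) = -A.Q x := by
  suffices h : euler 𝒱 ∘ₗ A.Q - A.Q ∘ₗ euler 𝒱 = -A.Q from congr($h x)
  refine linearMap_ext_of_mem (power 𝒱) fun n x hx => ?_
  simp only [LinearMap.comp_apply, LinearMap.sub_apply, LinearMap.neg_apply]
  cases n with
  | zero => simp [A.Q_of_mem_power_zero hx, euler_of_mem hx]
  | succ n =>
    rw [euler_of_mem hx, euler_of_mem (hA.Q_mem_power hx), map_smul]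
    push_cast
    module

end IsQuadratic

end LInftyStr

namespace Sym

variable {K V W H : Type*} [Field K] [AddCommGroup V] [Module K V] [AddCommGroup W] [Module K W]
  [AddCommGroup H] [Module K H] {𝒱 : ℤ → Submodule K V} {𝒲 : ℤ → Submodule K W}
  {ℋ : ℤ → Submodule K H} [DirectSum.Decomposition ℋ]

section Bilinear

variable {A B : Type*} [Ring A] [Algebra K A] [Ring B] [Algebra K B] (f g g' : Sym ℋ →ₗ[K] A)

theorem conv_add : conv f (g + g') = conv f g + conv f g' := by
  ext x
  simp only [conv_apply, LinearMap.add_apply, TensorProduct.map_add_right, map_add]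

theorem add_conv : conv (g + g') f = conv g f + conv g' f := by
  ext x
  simp only [conv_apply, LinearMap.add_apply, TensorProduct.map_add_left, map_add]

theorem conv_smul (c : K) : conv f (c • g) = c • conv f g := by
  ext x
  simp only [conv_apply, LinearMap.smul_apply, TensorProduct.map_smul_right, map_smul]

theorem smul_conv (c : K) : conv (c • f) g = c • conv f g := by
  ext x
  simp only [conv_apply, LinearMap.smul_apply, TensorProduct.map_smul_left, map_smul]

theorem algHom_comp_conv (h : A →ₐ[K] B) :
    h.toLinearMap ∘ₗ conv f g = conv (h.toLinearMap ∘ₗ f) (h.toLinearMap ∘ₗ g) :=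
  LinearMap.algHom_comp_convMul_distrib _ _ _

end Bilinear

theorem proj_map [DirectSum.Decomposition 𝒱] (f : H →ₗ[K] V) (hf : HasDegree ℋ 𝒱 0 f)
    (x : Sym ℋ) :
    proj 𝒱 (map f hf x) = f (proj ℋ x) := by
  suffices h : proj 𝒱 ∘ₗ (map f hf).toLinearMap = f ∘ₗ proj ℋ from congr($h x)
  refine linearMap_ext_of_ι_mul (by simp [proj_one]) fun i v _ x _ => ?_
  have counit_map : counit 𝒱 (map f hf x) = counit ℋ x :=
    congr($((isCoalgHom_map f hf).counit_comp) x)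
  simp [proj_ι_mul, counit_map]

/-- The symmetrized product `x ↦ φ(x') ⊙ f(x'') + f(x') ⊙ φ(x'')` of a linear map `f` and a Taylor
coefficient `φ`. It is twice the quadratic part of a coderivation with Taylor coefficient `φ` along
a morphism with linear part `f`. -/
def symProd (f : H →ₗ[K] V) (φ : Sym ℋ →ₗ[K] V) : Sym ℋ →ₗ[K] Sym 𝒱 :=
  conv (ι 𝒱 ∘ₗ φ) (ι 𝒱 ∘ₗ f ∘ₗ proj ℋ) + conv (ι 𝒱 ∘ₗ f ∘ₗ proj ℋ) (ι 𝒱 ∘ₗ φ)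

section SymProd

variable (f : H →ₗ[K] V)

theorem symProd_add (φ ψ : Sym ℋ →ₗ[K] V) :
    symProd (𝒱 := 𝒱) f (φ + ψ) = symProd f φ + symProd f ψ := by
  rw [symProd, LinearMap.comp_add, add_conv, conv_add, add_add_add_comm]
  rfl

theorem symProd_smul (c : K) (φ : Sym ℋ →ₗ[K] V) :
    symProd (𝒱 := 𝒱) f (c • φ) = c • symProd f φ := by
  rw [symProd, LinearMap.comp_smul, smul_conv, conv_smul, ← smul_add]
  rfl

theorem symProd_mem_power (φ : Sym ℋ →ₗ[K] V) (x : Sym ℋ) :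
    symProd (𝒱 := 𝒱) f φ x ∈ power 𝒱 2 := by
  have conv_mem (g g' : Sym ℋ →ₗ[K] V) : conv (ι 𝒱 ∘ₗ g) (ι 𝒱 ∘ₗ g') x ∈ power 𝒱 2 := by
    rw [conv_apply]
    induction comul ℋ x with
    | zero => simp
    | add x y hx hy => rw [map_add, map_add]; exact add_mem hx hy
    | tmul a b => exact ι_mul_mem_power _ (ι_mem_power _)
  exact add_mem (conv_mem _ _) (conv_mem _ _)

theorem symProd_congr {φ φ' : Sym ℋ →ₗ[K] V} {n : ℕ} (h : ∀ x ∈ power ℋ n, φ x = φ' x)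
    {x : Sym ℋ} (hx : x ∈ power ℋ (n + 1)) : symProd (𝒱 := 𝒱) f φ x = symProd f φ' x := by
  rw [symProd, symProd, LinearMap.add_apply, LinearMap.add_apply]
  congr 1 <;> refine conv_eq_of_mem_power (fun i j hij a ha b hb => ?_) hx
  · rcases eq_or_ne j 1 with rfl | hj
    · obtain rfl : i = n := by omega
      rw [LinearMap.comp_apply _ φ, h a ha, LinearMap.comp_apply _ φ']
    · simp [proj_of_mem_power hj hb]
  · rcases eq_or_ne i 1 with rfl | hi
    · obtain rfl : j = n := by omega
      rw [LinearMap.comp_apply _ φ, h b hb, LinearMap.comp_apply _ φ']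
    · simp [proj_of_mem_power hi ha]

theorem map_symProd {a : H →ₗ[K] H} (ha : HasDegree ℋ ℋ 0 a) {b : V →ₗ[K] W}
    (hb : HasDegree 𝒱 𝒲 0 b) {f : H →ₗ[K] V} {f' : H →ₗ[K] W} (hf : ∀ v, b (f v) = f' (a v))
    {φ : Sym ℋ →ₗ[K] V} {φ' : Sym ℋ →ₗ[K] W} (hφ : ∀ x, b (φ x) = φ' (map a ha x)) (x : Sym ℋ) :
    map b hb (symProd f φ x) = symProd f' φ' (map a ha x) := by
  suffices h : (map b hb).toLinearMap ∘ₗ symProd f φ =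
      symProd f' φ' ∘ₗ (map a ha).toLinearMap from congr($h x)
  have map_φ : (map b hb).toLinearMap ∘ₗ ι 𝒱 ∘ₗ φ =
      (ι 𝒲 ∘ₗ φ') ∘ₗ (map a ha).toLinearMap := LinearMap.ext fun x => by simp [hφ]
  have map_f : (map b hb).toLinearMap ∘ₗ ι 𝒱 ∘ₗ f ∘ₗ proj ℋ =
      (ι 𝒲 ∘ₗ f' ∘ₗ proj ℋ) ∘ₗ (map a ha).toLinearMap :=
    LinearMap.ext fun x => by simp [hf, proj_map]
  rw [symProd, LinearMap.comp_add, algHom_comp_conv, algHom_comp_conv, map_φ, map_f, symProd,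
    LinearMap.add_comp, (isCoalgHom_map a ha).conv_comp, (isCoalgHom_map a ha).conv_comp]

end SymProd

namespace IsCoderivationAlong

theorem two_smul_powerProj {E : Sym ℋ →ₗ[K] Sym ℋ}
    (hE : IsCoderivationAlong LinearMap.id LinearMap.id E) (x : Sym ℋ) :
    (2 : K) • powerProj ℋ 2 (E x) = symProd LinearMap.id (proj ℋ ∘ₗ E) x := by
  have powerProj_two_conv (f : Sym ℋ →ₗ[K] H) (g : Sym ℋ →ₗ[K] Sym ℋ) :
      powerProj ℋ 2 (conv (ι ℋ ∘ₗ f) g x) = conv (ι ℋ ∘ₗ f) (ι ℋ ∘ₗ proj ℋ ∘ₗ g) x := by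
    rw [conv_apply, conv_apply]
    induction comul ℋ x with
    | zero => simp only [map_zero]
    | add x y hx hy => simp only [map_add, hx, hy]
    | tmul a b =>
      simp only [TensorProduct.map_tmul, LinearMap.mul'_apply, LinearMap.comp_apply,
        powerProj_ι_mul, powerProj_one]
  have powerProj_euler_two := powerProj_euler (𝒱 := ℋ) 2 (E x)
  rw [← LinearMap.comp_apply (euler ℋ), hE.euler_comp, LinearMap.add_apply, map_add,
    powerProj_two_conv, powerProj_two_conv] at powerProj_euler_two
  exact powerProj_euler_two.symm

variable [CharZero K]

theorem sub_smul_mem_powerLT {E : Sym ℋ →ₗ[K] Sym ℋ}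
    (hE : IsCoderivationAlong LinearMap.id LinearMap.id E) (E_one : E 1 = 0)
    (E_ι : ∀ v, E (ι ℋ v) = ι ℋ v) {n : ℕ} {x : Sym ℋ} (hx : x ∈ power ℋ n) :
    E x - (n : K) • x ∈ powerLT ℋ n := by
  rw [← euler_of_mem hx]
  refine (hE.sub isCoderivationAlong_euler).mem_powerLT isCoalgHom_id isCoalgHom_id
    (fun k hk y hy => ?_) hx
  interval_cases k
  · obtain ⟨c, rfl⟩ := exists_eq_smul_one_of_mem_power_zero hy
    rw [map_smul, LinearMap.sub_apply, E_one, euler_one, sub_self, smul_zero, map_zero]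
  · obtain ⟨v, rfl⟩ := exists_eq_ι_of_mem_power_one hy
    rw [LinearMap.sub_apply, E_ι, euler_ι, sub_self, map_zero]

theorem eq_ι_proj_add_symProd [DirectSum.Decomposition 𝒱] {F F' D : Sym ℋ →ₗ[K] Sym 𝒱}
    (hD : IsCoderivationAlong F F' D) (hF : IsCoalgHom ℋ 𝒱 F) (hF' : IsCoalgHom ℋ 𝒱 F')
    {i : H →ₗ[K] V} (hi : linearPart F = i) (hi' : linearPart F' = i)
    {m : ℕ} (hm : m ≠ 0) (h : ∀ k < m, ∀ x ∈ power ℋ k, proj 𝒱 (D x) = 0) {x : Sym ℋ}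
    (hx : x ∈ power ℋ (m + 1)) :
    D x = ι 𝒱 (proj 𝒱 (D x)) + (2⁻¹ : K) • symProd i (proj 𝒱 ∘ₗ D) x := by
  refine eq_of_euler_eq ?_ ?_
  · have conv_right : conv (ι 𝒱 ∘ₗ proj 𝒱 ∘ₗ D) F x = conv (ι 𝒱 ∘ₗ proj 𝒱 ∘ₗ D)
        ((counit ℋ).smulRight 1 + ι 𝒱 ∘ₗ i ∘ₗ proj ℋ) x := by
      refine conv_eq_of_mem_power (fun k l hkl a ha b hb => ?_) hx
      rcases lt_or_ge k m with hk | hk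
      · simp [h k hk a ha]
      obtain hl | hl : l = 0 ∨ l = 1 := by omega
      · obtain ⟨c, rfl⟩ := exists_eq_smul_one_of_mem_power_zero (hl ▸ hb)
        simp [hF.map_one, counit_one, proj_one]
      · obtain ⟨v, rfl⟩ := exists_eq_ι_of_mem_power_one (hl ▸ hb)
        rw [hF.map_ι, ← hi]
        simp [linearPart, proj_ι, counit_ι]
    have conv_left : conv (ι 𝒱 ∘ₗ proj 𝒱 ∘ₗ F') D x =
        conv (ι 𝒱 ∘ₗ i ∘ₗ proj ℋ) (ι 𝒱 ∘ₗ proj 𝒱 ∘ₗ D) x := by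
      refine conv_eq_of_mem_power (fun k l hkl a ha b hb => ?_) hx
      obtain hk | hk | hk : k = 0 ∨ k = 1 ∨ l < m := by omega
      · obtain ⟨c, rfl⟩ := exists_eq_smul_one_of_mem_power_zero (hk ▸ ha)
        simp [hF'.map_one, proj_one]
      · obtain rfl : l = m := by omega
        obtain ⟨v, rfl⟩ := exists_eq_ι_of_mem_power_one (hk ▸ ha)
        rw [hD.eq_ι_proj hF hF' (hD.eq_zero hF hF' h) hb, ← hi']
        simp [linearPart, proj_ι]
      · simp [hD.eq_zero hF hF' h l hk b hb]
    rw [map_add, euler_ι, map_smul, euler_of_mem (symProd_mem_power i _ x), smul_smul,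
      Nat.cast_ofNat, inv_mul_cancel₀ two_ne_zero, one_smul, ← LinearMap.comp_apply (euler 𝒱),
      hD.euler_comp, LinearMap.add_apply, conv_right, conv_left, conv_add, LinearMap.add_apply,
      conv_counit_smulRight, symProd, LinearMap.add_apply, ← add_assoc]
    simp
  · rw [← LinearMap.comp_apply, hD.counit_comp hF hF', map_add, counit_ι, map_smul,
      counit_of_mem_power two_ne_zero (symProd_mem_power i _ x), smul_zero, add_zero,
      LinearMap.zero_apply]

end IsCoderivationAlong

end Sym

/-! ### The defect of a coalgebra morphism -/

namespace LInftyStr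

open LInfty.Sym

section Defect

variable {K V H : Type*} [Field K] [AddCommGroup V] [Module K V] [AddCommGroup H]
  [Module K H] {𝒱 : ℤ → Submodule K V} [DirectSum.Decomposition 𝒱]
  {ℋ : ℤ → Submodule K H} [DirectSum.Decomposition ℋ]

/-- The failure of a coalgebra morphism to be compatible with the codifferentials. -/
def defect (R : LInftyStr ℋ) (A : LInftyStr 𝒱) (F : Sym ℋ →ₗ[K] Sym 𝒱) : Sym ℋ →ₗ[K] Sym 𝒱 :=
  A.Q ∘ₗ F - F ∘ₗ R.Q

/-- The differential of Taylor coefficients along a map `i`. When a morphism with linear part `i`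
is perturbed in weight `m` by `φ`, the brackets change its defect in weight `m + 1` by this. -/
def bracketDifferential (R : LInftyStr ℋ) (A : LInftyStr 𝒱) (i : H →ₗ[K] V) :
    (Sym ℋ →ₗ[K] V) →ₗ[K] Sym ℋ →ₗ[K] V where
  toFun φ := (2⁻¹ : K) • (proj 𝒱 ∘ₗ A.Q ∘ₗ symProd i φ) - φ ∘ₗ R.Q
  map_add' φ ψ := by
    rw [symProd_add, LinearMap.comp_add, LinearMap.comp_add, LinearMap.add_comp, smul_add,
      add_sub_add_comm]
  map_smul' c φ := by
    rw [symProd_smul, LinearMap.comp_smul, LinearMap.comp_smul, LinearMap.smul_comp, smul_comm,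
      ← smul_sub]
    rfl

variable {R : LInftyStr ℋ} {A : LInftyStr 𝒱} {F F' : Sym ℋ →ₗ[K] Sym 𝒱}

theorem defect_apply (x : Sym ℋ) : defect R A F x = A.Q (F x) - F (R.Q x) := rfl

theorem bracketDifferential_apply (i : H →ₗ[K] V) (φ : Sym ℋ →ₗ[K] V) (x : Sym ℋ) :
    bracketDifferential R A i φ x =
      (2⁻¹ : K) • proj 𝒱 (A.Q (symProd i φ x)) - φ (R.Q x) := rfl

theorem isCoderivationAlong_defect (hF : IsCoalgHom ℋ 𝒱 F) :
    IsCoderivationAlong F (signTwist 𝒱 1 ∘ₗ F) (defect R A F) := by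
  refine (A.isCoderivationAlong.comp_isCoalgHom hF).sub ?_
  have F_comp_Q := R.isCoderivationAlong.isCoalgHom_comp hF
  rwa [← signTwist_comp_of_hasDegree hF.degree] at F_comp_Q

theorem defect_hasDegree (hF : IsCoalgHom ℋ 𝒱 F) :
    HasDegree (grading ℋ) (grading 𝒱) 1 (defect R A F) :=
  (A.isCoderivation.degree.comp hF.degree (zero_add 1)).sub
    (hF.degree.comp R.isCoderivation.degree (add_zero 1))

variable [CharZero K]

theorem defect_eq_zero (hF : IsCoalgHom ℋ 𝒱 F) {n : ℕ}
    (h : ∀ k < n, ∀ x ∈ power ℋ k, proj 𝒱 (defect R A F x) = 0) :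
    ∀ k < n, ∀ x ∈ power ℋ k, defect R A F x = 0 :=
  (isCoderivationAlong_defect hF).eq_zero hF ((isCoalgHom_signTwist 1).comp hF) h

theorem defect_eq_ι (hF : IsCoalgHom ℋ 𝒱 F) {n : ℕ}
    (h : ∀ k < n, ∀ x ∈ power ℋ k, proj 𝒱 (defect R A F x) = 0) {x : Sym ℋ}
    (hx : x ∈ power ℋ n) : defect R A F x = ι 𝒱 (proj 𝒱 (defect R A F x)) :=
  (isCoderivationAlong_defect hF).eq_ι_proj hF ((isCoalgHom_signTwist 1).comp hF)
    (defect_eq_zero hF h) hx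

theorem Q_map_comm (A : LInftyStr 𝒱) {a : V →ₗ[K] V} (ha : HasDegree 𝒱 𝒱 0 a)
    (h : ∀ x, a (proj 𝒱 (A.Q x)) = proj 𝒱 (A.Q (map a ha x))) (x : Sym 𝒱) :
    map a ha (A.Q x) = A.Q (map a ha x) := by
  have hS := isCoalgHom_map a ha
  have defect_map : defect A A (map a ha).toLinearMap = 0 :=
    (isCoderivationAlong_defect hS).eq_zero_of_proj hS ((isCoalgHom_signTwist 1).comp hS) <|
      LinearMap.ext fun x => by
        simp [defect_apply, proj_map, h]
  exact (sub_eq_zero.mp congr($defect_map x)).symm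

theorem q₁_proj_defect (hR : R.IsQuadratic) (hF : IsCoalgHom ℋ 𝒱 F) {n : ℕ}
    (h : ∀ k < n + 1, ∀ x ∈ power ℋ k, proj 𝒱 (defect R A F x) = 0) {x : Sym ℋ}
    (hx : x ∈ power ℋ (n + 1)) : A.q₁ (proj 𝒱 (defect R A F x)) = 0 := by
  have Q_defect : A.Q (defect R A F x) = -defect R A F (R.Q x) := by
    have A_square : A.Q (A.Q (F x)) = 0 := congr($(A.Q_comp_Q) (F x))
    have R_square : R.Q (R.Q x) = 0 := congr($(R.Q_comp_Q) x)
    rw [defect_apply, defect_apply, map_sub, A_square, R_square, map_zero, zero_sub, sub_zero]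
  rw [defect_eq_zero hF h n n.lt_succ_self _ (hR.Q_mem_power hx), defect_eq_ι hF h hx,
    A.Q_ι, neg_zero] at Q_defect
  rw [← proj_ι (𝒱 := 𝒱) (A.q₁ _), Q_defect, map_zero]

omit [CharZero K] in
theorem defect_eq_add (F F' : Sym ℋ →ₗ[K] Sym 𝒱) (x : Sym ℋ) :
    defect R A F' x = defect R A F x + A.Q ((F' - F) x) - (F' - F) (R.Q x) := by
  simp only [defect_apply, LinearMap.sub_apply, map_sub]
  abel

section Perturbation

variable (hF : IsCoalgHom ℋ 𝒱 F) (hF' : IsCoalgHom ℋ 𝒱 F') {m : ℕ}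
  (h : ∀ k < m, ∀ x ∈ power ℋ k, proj 𝒱 ((F' - F) x) = 0)
include hF hF' h

theorem defect_eq_add_ι_q₁ (hR : R.IsQuadratic) : ∀ k < m + 1, ∀ x ∈ power ℋ k,
    defect R A F' x = defect R A F x + ι 𝒱 (A.q₁ (proj 𝒱 ((F' - F) x))) := by
  intro k hk x hx
  have hD := hF'.isCoderivationAlong_sub hF
  have sub_eq_zero := hD.eq_zero hF' hF h
  have sub_Q : (F' - F) (R.Q x) = 0 := by
    cases k with
    | zero => rw [R.Q_of_mem_power_zero hx, map_zero]
    | succ k => exact sub_eq_zero k (by omega) _ (hR.Q_mem_power hx)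
  rw [defect_eq_add F F', sub_Q, sub_zero, ← A.Q_ι,
    ← hD.eq_ι_proj hF' hF (fun l hl => sub_eq_zero l (by omega)) hx]

theorem proj_defect_eq_add {i : H →ₗ[K] V} (hi : linearPart F = i) (hi' : linearPart F' = i)
    (hm : m ≠ 0) {x : Sym ℋ} (hx : x ∈ power ℋ (m + 1)) :
    proj 𝒱 (defect R A F' x) = proj 𝒱 (defect R A F x) +
      bracketDifferential R A i (proj 𝒱 ∘ₗ (F' - F)) x + A.q₁ (proj 𝒱 ((F' - F) x)) := by
  have hD := hF'.isCoderivationAlong_sub hF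
  rw [defect_eq_add F F', map_sub, map_add,
    congr(A.Q $(hD.eq_ι_proj_add_symProd hF' hF hi' hi hm h hx)), map_add, A.Q_ι, map_smul,
    map_add, proj_ι, map_smul, bracketDifferential_apply, LinearMap.comp_apply (proj 𝒱)]
  abel

end Perturbation

end Defect

section EulerCommutator

variable {K H : Type*} [Field K] [CharZero K] [AddCommGroup H] [Module K H]
  {ℋ : ℤ → Submodule K H} [DirectSum.Decomposition ℋ] {R : LInftyStr ℋ}

theorem IsQuadratic.bracketDifferential_proj_comp (hR : R.IsQuadratic)
    {E X : Sym ℋ →ₗ[K] Sym ℋ} (hE : IsCoderivationAlong LinearMap.id LinearMap.id E)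
    (E_one : E 1 = 0) (E_ι : ∀ v, E (ι ℋ v) = ι ℋ v)
    (E_comm : E ∘ₗ (R.Q + X) - (R.Q + X) ∘ₗ E = -(R.Q + X)) {n : ℕ} (hn : n ≠ 2)
    (X_of_lt : ∀ k < n, ∀ x ∈ power ℋ k, X x = 0) {ω : Sym ℋ →ₗ[K] H}
    (X_eq : ∀ x ∈ power ℋ n, X x = ι ℋ (ω x)) {x : Sym ℋ} (hx : x ∈ power ℋ n) :
    bracketDifferential R R LinearMap.id (proj ℋ ∘ₗ E) x = (2 - n : K) • ω x := by
  have bracket_E : (2⁻¹ : K) • proj ℋ (R.Q (symProd LinearMap.id (proj ℋ ∘ₗ E) x)) =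
      proj ℋ (R.Q (E x)) := by
    rw [← hE.two_smul_powerProj, map_smul, map_smul, smul_smul, inv_mul_cancel₀ two_ne_zero,
      one_smul, ← hR.proj_Q]
  have X_E : X (E x) = (n : K) • ι ℋ (ω x) := by
    rw [← X_eq x hx, ← map_smul, ← sub_eq_zero, ← map_sub]
    exact powerLT_le (P := LinearMap.ker X) X_of_lt (hE.sub_smul_mem_powerLT E_one E_ι hx)
  have proj_comm := congr(proj ℋ ($E_comm x))
  simp only [LinearMap.sub_apply, LinearMap.comp_apply, LinearMap.add_apply, LinearMap.neg_apply,
    map_sub, map_add, map_neg, X_eq x hx, X_E, E_ι, map_smul, proj_ι, hR n hn x hx, zero_add]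
    at proj_comm
  rw [bracketDifferential_apply, bracket_E, LinearMap.comp_apply, sub_smul, two_smul]
  linear_combination (norm := abel) -proj_comm

/-- Transporting the Euler coderivation along `Φ` gives a coderivation `E` whose commutator with
the transported codifferential is minus the latter. In the lowest weight where `Φ` fails to be a
morphism, this relation says that the failure is a coboundary. -/
theorem IsQuadratic.exists_bracketDifferential_eq (hR : R.IsQuadratic) {Φ : Sym ℋ →ₗ[K] Sym ℋ}
    (hΦ : IsCoalgHom ℋ ℋ Φ) (bijective : Function.Bijective (linearPart Φ)) {n : ℕ} (hn : n ≠ 2)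
    (defect_of_lt : ∀ k < n, ∀ x ∈ power ℋ k, defect R R Φ x = 0) {ω : Sym ℋ →ₗ[K] H}
    (defect_eq : ∀ x ∈ power ℋ n, defect R R Φ x = ι ℋ (linearPart Φ (ω x))) :
    ∃ ψ : Sym ℋ →ₗ[K] H, HasDegree (grading ℋ) ℋ 0 ψ ∧
      ∀ x ∈ power ℋ n, bracketDifferential R R LinearMap.id ψ x = (2 - n : K) • ω x := by
  let Ψ : Sym ℋ ≃ₗ[K] Sym ℋ := LinearEquiv.ofBijective Φ (hΦ.bijective bijective)
  have hΨ : IsCoalgHom ℋ ℋ Ψ.symm.toLinearMap := IsCoalgHom.symm (Ψ := Ψ) hΦ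
  have symm_Φ (x : Sym ℋ) : Ψ.symm (Φ x) = x := Ψ.symm_apply_apply x
  have Φ_symm (x : Sym ℋ) : Φ (Ψ.symm x) = x := Ψ.apply_symm_apply x
  have symm_comp_Φ : Ψ.symm.toLinearMap ∘ₗ Φ = LinearMap.id := LinearMap.ext symm_Φ
  let E : Sym ℋ →ₗ[K] Sym ℋ := Ψ.symm.toLinearMap ∘ₗ euler ℋ ∘ₗ Φ
  let X : Sym ℋ →ₗ[K] Sym ℋ := Ψ.symm.toLinearMap ∘ₗ defect R R Φ
  have E_apply (x : Sym ℋ) : E x = Ψ.symm (euler ℋ (Φ x)) := rfl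
  have hE : IsCoderivationAlong LinearMap.id LinearMap.id E := by
    have := (isCoderivationAlong_euler.comp_isCoalgHom hΦ).isCoalgHom_comp hΨ
    rwa [LinearMap.id_comp, symm_comp_Φ] at this
  have hE_degree : HasDegree (grading ℋ) (grading ℋ) 0 E :=
    hΨ.degree.comp (euler_hasDegree.comp hΦ.degree (add_zero 0)) (add_zero 0)
  have Q_add_X (x : Sym ℋ) : R.Q x + X x = Ψ.symm (R.Q (Φ x)) := by
    change R.Q x + Ψ.symm (R.Q (Φ x) - Φ (R.Q x)) = _
    rw [map_sub, symm_Φ, add_sub_cancel]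
  refine ⟨proj ℋ ∘ₗ E, proj_hasDegree.comp hE_degree (add_zero 0), fun x hx =>
    hR.bracketDifferential_proj_comp hE (X := X) ?_ (fun v => ?_) ?_ hn (fun k hk x hx => ?_)
      (fun x hx => ?_) hx⟩
  · rw [E_apply, hΦ.map_one, euler_one, map_zero]
  · rw [E_apply, hΦ.map_ι, euler_ι, ← hΦ.map_ι, symm_Φ]
  · ext x
    simp only [LinearMap.sub_apply, LinearMap.comp_apply, LinearMap.neg_apply,
      LinearMap.add_apply, Q_add_X, E_apply, Φ_symm, ← map_sub, hR.euler_Q, map_neg]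
  · exact (congrArg Ψ.symm (defect_of_lt k hk x hx)).trans (map_zero _)
  · exact (congrArg Ψ.symm (defect_eq x hx)).trans <|
      (congrArg Ψ.symm (hΦ.map_ι _).symm).trans (symm_Φ _)

end EulerCommutator

end LInftyStr

namespace Sym

variable {K V W : Type*} [Field K] [CharZero K] [AddCommGroup V] [Module K V] [AddCommGroup W]
  [Module K W] {𝒱 : ℤ → Submodule K V} {𝒲 : ℤ → Submodule K W} [DirectSum.Decomposition 𝒱]
  [DirectSum.Decomposition 𝒲]

theorem IsCoalgHom.map_comm {F : Sym 𝒱 →ₗ[K] Sym 𝒲} (hF : IsCoalgHom 𝒱 𝒲 F) {a : V →ₗ[K] V}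
    (ha : HasDegree 𝒱 𝒱 0 a) {b : W →ₗ[K] W} (hb : HasDegree 𝒲 𝒲 0 b)
    (h : ∀ x, b (proj 𝒲 (F x)) = proj 𝒲 (F (map a ha x))) (x : Sym 𝒱) :
    map b hb (F x) = F (map a ha x) := by
  suffices h : (map b hb).toLinearMap ∘ₗ F = F ∘ₗ (map a ha).toLinearMap from congr($h x)
  refine ((isCoalgHom_map b hb).comp hF).ext_proj (hF.comp (isCoalgHom_map a ha)) ?_
  exact LinearMap.ext fun x => by simp [proj_map, h]

end Sym

/-! ### Semisimple representations -/

section Semisimple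

variable {K G X Y : Type*} [Field K] [Group G] [AddCommGroup X] [Module K X] [AddCommGroup Y]
  [Module K Y]

theorem exists_invariant_of_isSemisimple {τ : Representation K G X}
    (hτ : τ.IsSemisimpleRepresentation) (δ : X →ₗ[K] Y)
    (ker_stable : ∀ g x, δ x = 0 → δ (τ g x) = 0) {x : X} (hx : ∀ g, δ (τ g x) = δ x) :
    ∃ y, δ y = δ x ∧ ∀ g, τ g y = y := by
  let N : Subrepresentation τ := ⟨LinearMap.ker δ, fun g x hx => ker_stable g x hx⟩
  obtain ⟨C, hC⟩ := hτ.exists_isCompl N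
  have hx_mem : x ∈ (N ⊔ C).toSubmodule := hC.sup_eq_top ▸ Submodule.mem_top
  rw [Subrepresentation.toSubmodule_sup, Submodule.mem_sup] at hx_mem
  obtain ⟨k, hk, y, hy, rfl⟩ := hx_mem
  have δ_y : δ y = δ (k + y) := by rw [map_add, show δ k = 0 from hk, zero_add]
  refine ⟨y, δ_y, fun g => sub_eq_zero.mp ((Submodule.mem_bot K).mp ?_)⟩
  have sub_mem_inf : τ g y - y ∈ (N ⊓ C).toSubmodule := by
    refine ⟨LinearMap.mem_ker.mpr ?_, sub_mem (C.apply_mem_toSubmodule g hy) hy⟩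
    rw [map_sub, sub_eq_zero, δ_y, ← hx g, map_add, map_add, ker_stable g k hk, zero_add]
  rwa [hC.inf_eq_bot] at sub_mem_inf

theorem exists_equivariant_generalized_inverse {ρ : Representation K G X}
    {σ : Representation K G Y} (hρ : ρ.IsSemisimpleRepresentation)
    (hσ : σ.IsSemisimpleRepresentation) (d : X →ₗ[K] Y) (hd : ∀ g x, d (ρ g x) = σ g (d x)) :
    ∃ h : Y →ₗ[K] X, (∀ g y, h (σ g y) = ρ g (h y)) ∧ ∀ x, d (h (d x)) = d x := by
  rw [Representation.isSemisimpleRepresentation_iff_isSemisimpleModule_asModule] at hρ hσ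
  let D := Representation.IntertwiningMap.equivLinearMapAsModule ρ σ
    (d.intertwiningMap_of_isIntertwiningMap ρ σ hd)
  obtain ⟨s, hs⟩ := IsSemisimpleModule.lifting_property D.rangeRestrict
    D.surjective_rangeRestrict LinearMap.id
  obtain ⟨t, ht⟩ := IsSemisimpleModule.extension_property (LinearMap.range D).subtype
    Subtype.val_injective s
  let h := (Representation.IntertwiningMap.equivLinearMapAsModule σ ρ).symm t
  refine ⟨h.toLinearMap, Representation.IntertwiningMap.isIntertwining σ ρ h, fun x => ?_⟩
  have t_D : t (D x) = s ⟨D x, x, rfl⟩ := congr($ht ⟨D x, x, rfl⟩)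
  have D_s : D (s ⟨D x, x, rfl⟩) = D x := congrArg Subtype.val congr($hs ⟨D x, x, rfl⟩)
  rwa [← t_D] at D_s

variable {V : Type*} [AddCommGroup V] [Module K V] {𝒱 : ℤ → Submodule K V}

/-- An equivariant generalized inverse, of degree `-1`, of the differential `d`. -/
structure IsEquivariantHomotopy (𝒱 : ℤ → Submodule K V) (ρ : Representation K G V)
    (d h : V →ₗ[K] V) : Prop where
  degree : HasDegree 𝒱 𝒱 (-1) h
  equivariant : ∀ g v, ρ g (h v) = h (ρ g v)
  comp_comp : ∀ v, d (h (d v)) = d v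

theorem exists_isEquivariantHomotopy [DirectSum.Decomposition 𝒱] {ρ : Representation K G V}
    (hρ : IsGradedRep 𝒱 ρ)
    (hV : ∀ i : ℤ, (gradedPiece ρ hρ i).toRepresentation.IsSemisimpleRepresentation)
    {d : V →ₗ[K] V} (hd : HasDegree 𝒱 𝒱 1 d) (hdρ : ∀ g v, ρ g (d v) = d (ρ g v)) :
    ∃ h, IsEquivariantHomotopy 𝒱 ρ d h := by
  have exists_component (i : ℤ) : ∃ f : V →ₗ[K] V,
      (∀ v ∈ 𝒱 (i + 1), f v ∈ 𝒱 i ∧ ∀ g, ρ g (f v) = f (ρ g v)) ∧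
        ∀ v ∈ 𝒱 i, d (f (d v)) = d v := by
    obtain ⟨h, h_equivariant, h_inverse⟩ := exists_equivariant_generalized_inverse (hV i)
      (hV (i + 1)) (d.restrict (hd i)) fun g v => Subtype.ext (hdρ g v).symm
    obtain ⟨f, hf⟩ := ((𝒱 i).subtype ∘ₗ h).exists_extend
    have f_eq (v : 𝒱 (i + 1)) : f v = h v := congr($hf v)
    refine ⟨f, fun v hv => ⟨?_, fun g => ?_⟩, fun v hv => ?_⟩
    · rw [f_eq ⟨v, hv⟩]
      exact (h ⟨v, hv⟩).2
    · rw [f_eq ⟨v, hv⟩]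
      exact (congrArg Subtype.val (h_equivariant g ⟨v, hv⟩)).symm.trans (f_eq _).symm
    · rw [f_eq ⟨d v, hd i v hv⟩]
      exact congrArg Subtype.val (h_inverse ⟨v, hv⟩)
  choose f hf f_inverse using exists_component
  have f_sub (i : ℤ) {v : V} (hv : v ∈ 𝒱 i) :
      f (i - 1) v ∈ 𝒱 (i - 1) ∧ ∀ g, ρ g (f (i - 1) v) = f (i - 1) (ρ g v) :=
    hf (i - 1) v (by rwa [sub_add_cancel])
  let h := ofComponents 𝒱 fun i => f (i - 1)
  have h_eq {i : ℤ} {v : V} (hv : v ∈ 𝒱 i) : h v = f (i - 1) v := ofComponents_of_mem 𝒱 _ hv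
  refine ⟨h, fun i v hv => ?_, fun g v => ?_, fun v => ?_⟩
  · rw [h_eq hv]
    exact (f_sub i hv).1
  · suffices commute : ρ g ∘ₗ h = h ∘ₗ ρ g from congr($commute v)
    refine linearMap_ext_of_mem 𝒱 fun i v hv => ?_
    rw [LinearMap.comp_apply, LinearMap.comp_apply, h_eq hv, h_eq ((hρ g).map_mem hv),
      (f_sub i hv).2]
  · suffices inverse : d ∘ₗ h ∘ₗ d = d from congr($inverse v)
    refine linearMap_ext_of_mem 𝒱 fun i v hv => ?_
    rw [LinearMap.comp_apply, LinearMap.comp_apply, h_eq (hd i v hv), add_sub_cancel_right,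
      f_inverse i v hv]

end Semisimple

namespace Sym

variable {K V W : Type*} [Field K] [AddCommGroup V] [Module K V] [AddCommGroup W] [Module K W]
  {𝒱 : ℤ → Submodule K V} {𝒲 : ℤ → Submodule K W}

theorem ofComponents_power_hasDegree {j : ℤ} {f : ℕ → Sym 𝒱 →ₗ[K] W}
    (hf : ∀ n, HasDegree (grading 𝒱) 𝒲 j (f n)) :
    HasDegree (grading 𝒱) 𝒲 j (ofComponents (power 𝒱) f) := by
  intro d x hx
  obtain ⟨N, hN⟩ := exists_mem_powerLT x
  have le_eqLocus : powerLT 𝒱 N ≤ LinearMap.eqLocus (ofComponents (power 𝒱) f)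
      (∑ k ∈ Finset.range N, f k ∘ₗ powerProj 𝒱 k) := powerLT_le fun k hk x hx => by
    rw [LinearMap.mem_eqLocus, ofComponents_of_mem _ _ hx, LinearMap.sum_apply,
      Finset.sum_eq_single_of_mem k (Finset.mem_range.mpr hk) fun l _ hl => by
        rw [LinearMap.comp_apply, powerProj_of_mem_of_ne hx hl.symm, map_zero],
      LinearMap.comp_apply, powerProj_of_mem hx]
  rw [le_eqLocus hN, LinearMap.sum_apply]
  refine Submodule.sum_mem _ fun k _ => hf k d _ ?_
  simpa only [add_zero] using powerProj_hasDegree k d x hx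

end Sym

/-! ### Equivariant morphisms -/

section TaylorEquivariant

open LInfty.Sym

variable {K G V W H : Type*} [Field K] [Group G] [AddCommGroup V] [Module K V] [AddCommGroup W]
  [Module K W] [AddCommGroup H] [Module K H] {ℋ : ℤ → Submodule K H} {τ : Representation K G H}
  {hτ : IsGradedRep ℋ τ} {ρ : Representation K G V} {σ : Representation K G W}

/-- Equivariance of a linear map `S(H) → V`, regarded as the family of its restrictions to the
powers of `H`: it is how equivariance of all Taylor coefficients is expressed at once. -/
def TaylorEquivariant (hτ : IsGradedRep ℋ τ) (ρ : Representation K G V) (φ : Sym ℋ →ₗ[K] V) :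
    Prop :=
  ∀ g x, ρ g (φ x) = φ (map (τ g) (hτ g) x)

namespace TaylorEquivariant

variable {φ ψ : Sym ℋ →ₗ[K] V}

theorem add (hφ : TaylorEquivariant hτ ρ φ) (hψ : TaylorEquivariant hτ ρ ψ) :
    TaylorEquivariant hτ ρ (φ + ψ) := fun g x => by
  rw [LinearMap.add_apply, map_add, hφ, hψ, LinearMap.add_apply]

theorem neg (hφ : TaylorEquivariant hτ ρ φ) : TaylorEquivariant hτ ρ (-φ) := fun g x => by
  rw [LinearMap.neg_apply, map_neg, hφ, LinearMap.neg_apply]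

theorem comp_left (hφ : TaylorEquivariant hτ ρ φ) {f : V →ₗ[K] W}
    (hf : ∀ g v, σ g (f v) = f (ρ g v)) : TaylorEquivariant hτ σ (f ∘ₗ φ) := fun g x => by
  rw [LinearMap.comp_apply, hf, hφ, LinearMap.comp_apply]

theorem comp_powerProj (hφ : TaylorEquivariant hτ ρ φ) (n : ℕ) :
    TaylorEquivariant hτ ρ (φ ∘ₗ powerProj ℋ n) := fun g x => by
  rw [LinearMap.comp_apply, LinearMap.comp_apply, hφ]
  exact congrArg φ (powerProj_map (f := (map (τ g) (hτ g)).toLinearMap)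
    (fun n _ hx => map_mem_power _ _ n hx) n x).symm

end TaylorEquivariant

end TaylorEquivariant

namespace LInftyStr

open LInfty.Sym

variable {K G V H : Type*} [Field K] [CharZero K] [Group G] [AddCommGroup V] [Module K V]
  [AddCommGroup H] [Module K H] {𝒱 : ℤ → Submodule K V} [DirectSum.Decomposition 𝒱]
  {ℋ : ℤ → Submodule K H} [DirectSum.Decomposition ℋ]
  {ρ : Representation K G V} {τ : Representation K G H}
  {hρ : IsGradedRep 𝒱 ρ} {hτ : IsGradedRep ℋ τ} {R : LInftyStr ℋ} {A : LInftyStr 𝒱}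
  {i : H →ₗ[K] V} {F : Sym ℋ →ₗ[K] Sym 𝒱}

theorem taylorEquivariant_defect (hA : TaylorEquivariant hρ ρ (proj 𝒱 ∘ₗ A.Q))
    (hR : TaylorEquivariant hτ τ (proj ℋ ∘ₗ R.Q)) (hF : IsCoalgHom ℋ 𝒱 F)
    (hFτ : TaylorEquivariant hτ ρ (proj 𝒱 ∘ₗ F)) :
    TaylorEquivariant hτ ρ (proj 𝒱 ∘ₗ defect R A F) := fun g x => by
  simp only [TaylorEquivariant, LinearMap.comp_apply] at *
  rw [defect_apply, defect_apply, map_sub, map_sub, map_sub, hA,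
    hF.map_comm (hτ g) (hρ g) (hFτ g), hFτ, R.Q_map_comm (hτ g) (hR g)]

variable (hτ ρ R A i F) in
/-- Equivariant coalgebra morphisms with linear part `i` that commute with the codifferentials in
the weights below `n`: the approximations from which an equivariant `L∞[1]` morphism is built. -/
structure IsEquivariantMorphismBelow (n : ℕ) : Prop where
  isCoalgHom : IsCoalgHom ℋ 𝒱 F
  equivariant : TaylorEquivariant hτ ρ (proj 𝒱 ∘ₗ F)
  linearPart_eq : linearPart F = i
  proj_defect : ∀ k < n, ∀ x ∈ power ℋ k, proj 𝒱 (defect R A F x) = 0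

namespace IsEquivariantMorphismBelow

omit [CharZero K] in
theorem mono {m n : ℕ} (hF : IsEquivariantMorphismBelow ρ hτ R A i F n) (h : m ≤ n) :
    IsEquivariantMorphismBelow ρ hτ R A i F m :=
  { hF with proj_defect := fun k hk => hF.proj_defect k (by omega) }

theorem exists_perturbation {n : ℕ} (hF : IsEquivariantMorphismBelow ρ hτ R A i F n)
    {α : Sym ℋ →ₗ[K] V} (hα : HasDegree (grading ℋ) 𝒱 0 α) (hατ : TaylorEquivariant hτ ρ α)
    (α_of_lt : ∀ k < 2, ∀ x ∈ power ℋ k, α x = 0) :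
    ∃ F', IsEquivariantMorphismBelow ρ hτ R A i F' 0 ∧ proj 𝒱 ∘ₗ (F' - F) = α := by
  have f_one : (proj 𝒱 ∘ₗ F + α) 1 = 0 := by
    rw [LinearMap.add_apply, LinearMap.comp_apply, hF.isCoalgHom.proj_one,
      α_of_lt 0 two_pos 1 one_mem_power, add_zero]
  have proj_F' : proj 𝒱 ∘ₗ coexp 𝒱 (proj 𝒱 ∘ₗ F + α) = proj 𝒱 ∘ₗ F + α :=
    LinearMap.ext (proj_coexp f_one)
  refine ⟨coexp 𝒱 (proj 𝒱 ∘ₗ F + α), ⟨isCoalgHom_coexp f_one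
    ((proj_hasDegree.comp hF.isCoalgHom.degree (add_zero 0)).add hα), ?_, ?_, by simp⟩, ?_⟩
  · rw [proj_F']
    exact hF.equivariant.add hατ
  · rw [← hF.linearPart_eq, linearPart, linearPart, ← LinearMap.comp_assoc, proj_F']
    ext v
    simp [α_of_lt 1 one_lt_two _ (ι_mem_power v)]
  · rw [LinearMap.comp_sub, proj_F', add_sub_cancel_left]

theorem exists_perturbation_eq {m : ℕ} (hm : 2 ≤ m) (hR : R.IsQuadratic)
    (hF : IsEquivariantMorphismBelow ρ hτ R A i F (m + 1)) {α : Sym ℋ →ₗ[K] V}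
    (hα : HasDegree (grading ℋ) 𝒱 0 α) (hατ : TaylorEquivariant hτ ρ α)
    (α_of_ne : ∀ k ≠ m, ∀ x ∈ power ℋ k, α x = 0) (q₁_α : ∀ x, A.q₁ (α x) = 0) :
    ∃ F', IsEquivariantMorphismBelow ρ hτ R A i F' (m + 1) ∧
      (∀ k < m, ∀ x ∈ power ℋ k, F' x = F x) ∧ ∀ x ∈ power ℋ (m + 1),
        proj 𝒱 (defect R A F' x) =
          proj 𝒱 (defect R A F x) + bracketDifferential R A i α x := by
  obtain ⟨F', hF', h⟩ := hF.exists_perturbation hα hατ fun k hk => α_of_ne k (by omega)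
  have proj_sub (x : Sym ℋ) : proj 𝒱 ((F' - F) x) = α x := congr($h x)
  have proj_sub_of_lt : ∀ k < m, ∀ x ∈ power ℋ k, proj 𝒱 ((F' - F) x) = 0 :=
    fun k hk x hx => (proj_sub x).trans (α_of_ne k hk.ne x hx)
  refine ⟨F', { hF' with proj_defect := fun k hk x hx => ?_ }, fun k hk x hx => ?_,
    fun x hx => ?_⟩
  · rw [defect_eq_add_ι_q₁ hF.isCoalgHom hF'.isCoalgHom proj_sub_of_lt hR k hk x hx, proj_sub,
      q₁_α, map_zero, add_zero, hF.proj_defect k hk x hx]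
  · exact hF'.isCoalgHom.eq_of_proj_sub_eq_zero hF.isCoalgHom proj_sub_of_lt k hk x hx
  · rw [proj_defect_eq_add hF.isCoalgHom hF'.isCoalgHom proj_sub_of_lt hF.linearPart_eq
      hF'.linearPart_eq (by omega) hx, h, proj_sub, q₁_α, add_zero]

theorem exists_extension {n : ℕ} (hn : 2 ≤ n) (hR : R.IsQuadratic)
    (hA : TaylorEquivariant hρ ρ (proj 𝒱 ∘ₗ A.Q)) (hRτ : TaylorEquivariant hτ τ (proj ℋ ∘ₗ R.Q))
    {h : V →ₗ[K] V} (hh : IsEquivariantHomotopy 𝒱 ρ A.q₁ h)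
    (hF : IsEquivariantMorphismBelow ρ hτ R A i F n)
    (exact : ∀ x ∈ power ℋ n, proj 𝒱 (defect R A F x) ∈ LinearMap.range A.q₁) :
    ∃ F', IsEquivariantMorphismBelow ρ hτ R A i F' (n + 1) ∧
      ∀ k < n, ∀ x ∈ power ℋ k, F' x = F x := by
  let β : Sym ℋ →ₗ[K] V := -(h ∘ₗ (proj 𝒱 ∘ₗ defect R A F) ∘ₗ powerProj ℋ n)
  have β_of_ne (k : ℕ) (hk : k ≠ n) (x : Sym ℋ) (hx : x ∈ power ℋ k) : β x = 0 := by
    simp [β, powerProj_of_mem_of_ne hx hk]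
  have β_of_mem (x : Sym ℋ) (hx : x ∈ power ℋ n) : β x = -h (proj 𝒱 (defect R A F x)) := by
    simp [β, powerProj_of_mem hx]
  have hβ : HasDegree (grading ℋ) 𝒱 0 β :=
    (hh.degree.comp ((proj_hasDegree.comp (defect_hasDegree hF.isCoalgHom) (add_zero 1)).comp
      (powerProj_hasDegree n) (zero_add 1)) (by norm_num)).neg
  have hβτ : TaylorEquivariant hτ ρ β :=
    (((taylorEquivariant_defect hA hRτ hF.isCoalgHom hF.equivariant).comp_powerProj n).comp_left
      hh.equivariant).neg
  obtain ⟨F', hF', hsub⟩ := hF.exists_perturbation hβ hβτ fun k hk => β_of_ne k (by omega)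
  have proj_sub (x : Sym ℋ) : proj 𝒱 ((F' - F) x) = β x := congr($hsub x)
  have proj_sub_of_lt : ∀ k < n, ∀ x ∈ power ℋ k, proj 𝒱 ((F' - F) x) = 0 :=
    fun k hk x hx => (proj_sub x).trans (β_of_ne k hk.ne x hx)
  refine ⟨F', { hF' with proj_defect := fun k hk x hx => ?_ }, fun k hk x hx => ?_⟩
  · rw [defect_eq_add_ι_q₁ hF.isCoalgHom hF'.isCoalgHom proj_sub_of_lt hR k hk x hx, proj_sub,
      map_add, proj_ι]
    rcases eq_or_ne k n with rfl | hkn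
    · obtain ⟨v, hv⟩ := exact x hx
      rw [β_of_mem x hx, ← hv, map_neg, hh.comp_comp, add_neg_cancel]
    · rw [β_of_ne k hkn x hx, map_zero, add_zero, hF.proj_defect k (by omega) x hx]
  · exact hF'.isCoalgHom.eq_of_proj_sub_eq_zero hF.isCoalgHom proj_sub_of_lt k hk x hx

theorem exists_limit (hR : R.IsQuadratic) {F : ℕ → Sym ℋ →ₗ[K] Sym 𝒱}
    (hF : ∀ s, IsEquivariantMorphismBelow ρ hτ R A i (F s) (s + 1))
    (F_succ : ∀ s, ∀ k < s + 1, ∀ x ∈ power ℋ k, F (s + 1) x = F s x) :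
    ∃ F', IsMorphism R A F' ∧ TaylorEquivariant hτ ρ (proj 𝒱 ∘ₗ F') ∧ linearPart F' = i := by
  have F_add (k t : ℕ) (x : Sym ℋ) (hx : x ∈ power ℋ k) : F (k + t) x = F k x := by
    induction t with
    | zero => rfl
    | succ t ih => rw [← add_assoc, F_succ (k + t) k (by omega) x hx, ih]
  let f : Sym ℋ →ₗ[K] V := ofComponents (power ℋ) fun k => proj 𝒱 ∘ₗ F k
  have f_of_mem {k : ℕ} {x : Sym ℋ} (hx : x ∈ power ℋ k) : f x = proj 𝒱 (F k x) :=
    ofComponents_of_mem (power ℋ) _ hx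
  have f_one : f 1 = 0 := by rw [f_of_mem one_mem_power, (hF 0).isCoalgHom.proj_one]
  have hF' : IsCoalgHom ℋ 𝒱 (coexp 𝒱 f) := isCoalgHom_coexp f_one <|
    ofComponents_power_hasDegree fun k =>
      proj_hasDegree.comp (hF k).isCoalgHom.degree (add_zero 0)
  have proj_F' : proj 𝒱 ∘ₗ coexp 𝒱 f = f := LinearMap.ext (proj_coexp f_one)
  have F'_eq (s k : ℕ) (hk : k < s + 1) (x : Sym ℋ) (hx : x ∈ power ℋ k) :
      coexp 𝒱 f x = F s x := by
    refine hF'.eq_of_proj_sub_eq_zero (hF s).isCoalgHom (fun l hl y hy => ?_) k hk x hx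
    obtain ⟨t, rfl⟩ := Nat.exists_eq_add_of_le (Nat.lt_succ_iff.mp hl)
    rw [LinearMap.sub_apply, map_sub, proj_coexp f_one, f_of_mem hy, F_add l t y hy, sub_self]
  refine ⟨coexp 𝒱 f, ⟨hF', linearMap_ext_of_mem (power ℋ) fun k x hx => ?_⟩, ?_, ?_⟩
  · have defect_F := defect_eq_zero (hF k).isCoalgHom (hF k).proj_defect k k.lt_succ_self x hx
    rw [defect_apply, sub_eq_zero] at defect_F
    rw [LinearMap.comp_apply, LinearMap.comp_apply, F'_eq k k k.lt_succ_self x hx, defect_F]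
    cases k with
    | zero => rw [R.Q_of_mem_power_zero hx, map_zero, map_zero]
    | succ k => exact F'_eq (k + 1) k (by omega) _ (hR.Q_mem_power hx)
  · rw [proj_F']
    refine fun g => LinearMap.congr_fun (linearMap_ext_of_mem (f := ρ g ∘ₗ f)
      (g := f ∘ₗ (map (τ g) (hτ g)).toLinearMap) (power ℋ) fun k x hx => ?_)
    rw [LinearMap.comp_apply, f_of_mem hx]
    exact ((hF k).equivariant g x).trans (f_of_mem (map_mem_power _ _ k hx)).symm
  · rw [← (hF 1).linearPart_eq]
    exact LinearMap.ext fun v =>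
      congrArg (proj 𝒱) (F'_eq 1 1 one_lt_two _ (ι_mem_power v))

end IsEquivariantMorphismBelow

end LInftyStr

/-! ### Equivariant primitives of the obstruction -/

section ExtendPower

open LInfty.Sym

variable {K G H : Type*} [Field K] [Group G] [AddCommGroup H] [Module K H]
  {ℋ : ℤ → Submodule K H} {τ : Representation K G H} {hτ : IsGradedRep ℋ τ}

/-- The extension by zero to `S(H)` of a linear map on `H^{⊙m}`. -/
def extendPower (m : ℕ) : (power ℋ m →ₗ[K] H) →ₗ[K] Sym ℋ →ₗ[K] H :=
  LinearMap.lcomp K H ((powerProj ℋ m).codRestrict (power ℋ m) (powerProj_mem m))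

theorem extendPower_apply (m : ℕ) (φ : power ℋ m →ₗ[K] H) (x : Sym ℋ) :
    extendPower m φ x = φ ⟨powerProj ℋ m x, powerProj_mem m x⟩ := rfl

theorem extendPower_of_mem_of_ne {m k : ℕ} (φ : power ℋ m →ₗ[K] H) {x : Sym ℋ}
    (hx : x ∈ power ℋ k) (h : k ≠ m) : extendPower m φ x = 0 := by
  have x_zero : (⟨powerProj ℋ m x, powerProj_mem m x⟩ : power ℋ m) = 0 :=
    Subtype.ext (powerProj_of_mem_of_ne hx h)
  rw [extendPower_apply, x_zero, map_zero]

theorem map_map_inv (g : G) (x : Sym ℋ) : map (τ g) (hτ g) (map (τ g⁻¹) (hτ g⁻¹) x) = x :=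
  Representation.self_inv_apply (symRep τ hτ) g x

theorem map_inv_map (g : G) (x : Sym ℋ) : map (τ g⁻¹) (hτ g⁻¹) (map (τ g) (hτ g) x) = x :=
  Representation.inv_self_apply (symRep τ hτ) g x

theorem extendPower_linHom (m : ℕ) (g : G) (φ : power ℋ m →ₗ[K] H) (x : Sym ℋ) :
    extendPower m (Representation.linHom (powerRep τ hτ m).toRepresentation τ g φ)
      (map (τ g) (hτ g) x) = τ g (extendPower m φ x) := by
  have powerProj_map_map : map (τ g⁻¹) (hτ g⁻¹) (powerProj ℋ m (map (τ g) (hτ g) x)) =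
      powerProj ℋ m x :=
    (congrArg (map (τ g⁻¹) (hτ g⁻¹)) (powerProj_map (f := (map (τ g) (hτ g)).toLinearMap)
      (fun n _ hx => map_mem_power _ _ n hx) m x)).trans (map_inv_map g _)
  exact congrArg (fun y => τ g (φ y)) (Subtype.ext powerProj_map_map)

end ExtendPower

namespace LInftyStr

open LInfty.Sym

section BracketDifferential

variable {K G V H : Type*} [Field K] [AddCommGroup V] [Module K V]
  [AddCommGroup H] [Module K H] {𝒱 : ℤ → Submodule K V} [DirectSum.Decomposition 𝒱]
  {ℋ : ℤ → Submodule K H} [DirectSum.Decomposition ℋ] {R : LInftyStr ℋ} {A : LInftyStr 𝒱}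
  {i : H →ₗ[K] V}

theorem bracketDifferential_congr [CharZero K] (hR : R.IsQuadratic) {φ φ' : Sym ℋ →ₗ[K] V}
    {n : ℕ} (h : ∀ x ∈ power ℋ n, φ x = φ' x) {x : Sym ℋ} (hx : x ∈ power ℋ (n + 1)) :
    bracketDifferential R A i φ x = bracketDifferential R A i φ' x := by
  rw [bracketDifferential_apply, bracketDifferential_apply, symProd_congr i h hx,
    h _ (hR.Q_mem_power hx)]

variable [CharZero K]

theorem bracketDifferential_map {a : H →ₗ[K] H} (ha : HasDegree ℋ ℋ 0 a) {b : V →ₗ[K] V}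
    (hb : HasDegree 𝒱 𝒱 0 b) (hi : ∀ v, b (i v) = i (a v))
    (hR : ∀ x, a (proj ℋ (R.Q x)) = proj ℋ (R.Q (map a ha x)))
    (hA : ∀ x, b (proj 𝒱 (A.Q x)) = proj 𝒱 (A.Q (map b hb x))) {φ φ' : Sym ℋ →ₗ[K] V}
    (hφ : ∀ x, b (φ x) = φ' (map a ha x)) (x : Sym ℋ) :
    b (bracketDifferential R A i φ x) = bracketDifferential R A i φ' (map a ha x) := by
  rw [bracketDifferential_apply, bracketDifferential_apply, map_sub, map_smul, hA, hφ,
    map_symProd ha hb hi hφ, R.Q_map_comm ha hR]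

variable [Group G] {τ : Representation K G H} {hτ : IsGradedRep ℋ τ}

theorem bracketDifferential_extendPower_linHom (hRτ : TaylorEquivariant hτ τ (proj ℋ ∘ₗ R.Q))
    {m : ℕ} (g : G) (φ : power ℋ m →ₗ[K] H) (x : Sym ℋ) :
    bracketDifferential R R LinearMap.id
        (extendPower m (Representation.linHom (powerRep τ hτ m).toRepresentation τ g φ)) x =
      τ g (bracketDifferential R R LinearMap.id (extendPower m φ)
        (map (τ g⁻¹) (hτ g⁻¹) x)) := by
  have equivariant := bracketDifferential_map (i := LinearMap.id) (hτ g) (hτ g) (fun _ => rfl)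
    (hRτ g) (hRτ g) (fun y => (extendPower_linHom m g φ y).symm) (map (τ g⁻¹) (hτ g⁻¹) x)
  rw [map_map_inv] at equivariant
  exact equivariant.symm

theorem IsQuadratic.exists_equivariant_bracketDifferential_eq (hR : R.IsQuadratic)
    (hRτ : TaylorEquivariant hτ τ (proj ℋ ∘ₗ R.Q)) {m : ℕ}
    (hHom : (homRep τ hτ 0 m).toRepresentation.IsSemisimpleRepresentation)
    {ω : Sym ℋ →ₗ[K] H} (hω : TaylorEquivariant hτ τ ω)
    {ψ : Sym ℋ →ₗ[K] H} (hψ : HasDegree (grading ℋ) ℋ 0 ψ)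
    (h : ∀ x ∈ power ℋ (m + 1), bracketDifferential R R LinearMap.id ψ x = ω x) :
    ∃ φ : Sym ℋ →ₗ[K] H, HasDegree (grading ℋ) ℋ 0 φ ∧ TaylorEquivariant hτ τ φ ∧
      (∀ k ≠ m, ∀ x ∈ power ℋ k, φ x = 0) ∧
      ∀ x ∈ power ℋ (m + 1), bracketDifferential R R LinearMap.id φ x = ω x := by
  let δ : (homRep τ hτ 0 m).toSubmodule →ₗ[K] power ℋ (m + 1) →ₗ[K] H :=
    LinearMap.lcomp K H (power ℋ (m + 1)).subtype ∘ₗ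
      bracketDifferential R R LinearMap.id ∘ₗ extendPower m ∘ₗ (homRep τ hτ 0 m).toSubmodule.subtype
  have δ_smul (g : G) (φ : (homRep τ hτ 0 m).toSubmodule) (x : power ℋ (m + 1)) :
      δ ((homRep τ hτ 0 m).toRepresentation g φ) x =
        τ g (δ φ ⟨map (τ g⁻¹) (hτ g⁻¹) x, map_mem_power _ _ _ x.2⟩) :=
    bracketDifferential_extendPower_linHom hRτ g φ.1 x
  let ψ' : (homRep τ hτ 0 m).toSubmodule :=
    ⟨ψ ∘ₗ (power ℋ m).subtype, fun i x hx => hψ i x hx⟩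
  have extendPower_ψ' (y : Sym ℋ) (hy : y ∈ power ℋ m) : extendPower m ψ'.1 y = ψ y := by
    change ψ (powerProj ℋ m y) = ψ y
    rw [powerProj_of_mem hy]
  have δ_ψ' (x : power ℋ (m + 1)) : δ ψ' x = ω x :=
    (bracketDifferential_congr hR extendPower_ψ' x.2).trans (h x x.2)
  obtain ⟨φ, δ_φ, φ_invariant⟩ := exists_invariant_of_isSemisimple hHom δ
    (fun g φ hφ => LinearMap.ext fun x => by
      rw [δ_smul, hφ, LinearMap.zero_apply, map_zero, LinearMap.zero_apply])
    (x := ψ') fun g => LinearMap.ext fun x => by rw [δ_smul, δ_ψ', δ_ψ', hω, map_map_inv]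
  refine ⟨extendPower m φ.1, fun d x hx => ?_, fun g x => ?_,
    fun k hk x hx => extendPower_of_mem_of_ne φ.1 hx hk, fun x hx => ?_⟩
  · have powerProj_mem_grading := powerProj_hasDegree m d x hx
    rw [add_zero] at powerProj_mem_grading
    exact φ.2 d ⟨_, powerProj_mem m x⟩ powerProj_mem_grading
  · exact (extendPower_linHom m g φ.1 x).symm.trans
      congr(extendPower m $(congrArg Subtype.val (φ_invariant g)) _)
  · exact congr($δ_φ ⟨x, hx⟩).trans (δ_ψ' ⟨x, hx⟩)

end BracketDifferential

section EquivariantSection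

variable {K G V H : Type*} [Field K] [Group G] [AddCommGroup V] [Module K V]
  [AddCommGroup H] [Module K H] {𝒱 : ℤ → Submodule K V} [DirectSum.Decomposition 𝒱]
  {ℋ : ℤ → Submodule K H} [DirectSum.Decomposition ℋ]

/-- An equivariant choice of representing cocycles, where `H`, with the bracket of `R`, plays the
role of the cohomology of `A`. -/
structure IsEquivariantSection (ρ : Representation K G V) (τ : Representation K G H)
    (R : LInftyStr ℋ) (A : LInftyStr 𝒱) (i : H →ₗ[K] V) : Prop where
  degree : HasDegree ℋ 𝒱 0 i
  equivariant : ∀ g v, ρ g (i v) = i (τ g v)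
  q₁_apply : ∀ v, A.q₁ (i v) = 0
  exists_sub_mem : ∀ v, A.q₁ v = 0 → ∃ w, v - i w ∈ LinearMap.range A.q₁
  bracket : ∀ x ∈ power ℋ 2,
    proj 𝒱 (A.Q (map i degree x)) - i (proj ℋ (R.Q x)) ∈ LinearMap.range A.q₁

variable {ρ : Representation K G V} {τ : Representation K G H} {hρ : IsGradedRep 𝒱 ρ}
  {hτ : IsGradedRep ℋ τ} {R : LInftyStr ℋ} {A : LInftyStr 𝒱} {i : H →ₗ[K] V}

theorem IsQuadratic.q₁_eq_zero (hR : R.IsQuadratic) (v : H) : R.q₁ v = 0 :=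
  hR 1 (by norm_num) _ (ι_mem_power v)

theorem q₁_comm_of_taylorEquivariant (hA : TaylorEquivariant hρ ρ (proj 𝒱 ∘ₗ A.Q)) (g : G)
    (v : V) : ρ g (A.q₁ v) = A.q₁ (ρ g v) := by
  have equivariant_ι := hA g (ι 𝒱 v)
  rwa [map_ι] at equivariant_ι

namespace IsEquivariantSection

theorem exists_sub_eq {π : V →ₗ[K] H} (hi : IsEquivariantSection ρ τ R A i)
    (π_i : ∀ w, π (i w) = w) (π_q₁ : ∀ v, π (A.q₁ v) = 0) {v : V} (hv : A.q₁ v = 0) :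
    ∃ y, A.q₁ y = v - i (π v) := by
  obtain ⟨w, y, hy⟩ := hi.exists_sub_mem v hv
  have π_v : π v = w := by
    have := congrArg π hy
    rwa [π_q₁, map_sub, π_i, eq_comm, sub_eq_zero] at this
  exact ⟨y, by rw [π_v, hy]⟩

theorem taylorEquivariant_comp {π : V →ₗ[K] H} (hi : IsEquivariantSection ρ τ R A i)
    (π_i : ∀ w, π (i w) = w) (π_q₁ : ∀ v, π (A.q₁ v) = 0)
    (hA : TaylorEquivariant hρ ρ (proj 𝒱 ∘ₗ A.Q)) {φ : Sym ℋ →ₗ[K] V}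
    (hφ : TaylorEquivariant hτ ρ φ) (q₁_φ : ∀ x, A.q₁ (φ x) = 0) :
    TaylorEquivariant hτ τ (π ∘ₗ φ) := by
  intro g x
  obtain ⟨y, hy⟩ := hi.exists_sub_eq π_i π_q₁ (q₁_φ x)
  have π_sub : π (ρ g (φ x)) - τ g (π (φ x)) = 0 := by
    rw [← π_i (τ g (π (φ x))), ← hi.equivariant, ← map_sub, ← map_sub, ← hy,
      q₁_comm_of_taylorEquivariant hA, π_q₁]
  rw [LinearMap.comp_apply, LinearMap.comp_apply, ← hφ, ← sub_eq_zero.mp π_sub]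

theorem bracketDifferential_sub_mem_range (hi : IsEquivariantSection ρ τ R A i)
    (φ : Sym ℋ →ₗ[K] H) (x : Sym ℋ) :
    bracketDifferential R A i (i ∘ₗ φ) x - i (bracketDifferential R R LinearMap.id φ x) ∈
      LinearMap.range A.q₁ := by
  have id_degree : HasDegree ℋ ℋ 0 (LinearMap.id : H →ₗ[K] H) :=
    hasDegree_zero_iff.mpr fun _ _ hv => hv
  have map_id (y : Sym ℋ) : map LinearMap.id id_degree y = y := by
    suffices h : map LinearMap.id id_degree = AlgHom.id K (Sym ℋ) from congr($h y)
    exact algHom_ext _ fun v => by simp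
  have symProd_i : symProd i (i ∘ₗ φ) x = map i hi.degree (symProd LinearMap.id φ x) := by
    rw [map_symProd id_degree hi.degree (f' := i) (φ' := i ∘ₗ φ) (fun _ => rfl)
      (fun y => by rw [map_id, LinearMap.comp_apply]), map_id]
  have bracket := Submodule.smul_mem _ (2⁻¹ : K)
    (hi.bracket _ (symProd_mem_power LinearMap.id φ x))
  rwa [bracketDifferential_apply, bracketDifferential_apply, symProd_i, map_sub, map_smul,
    LinearMap.comp_apply, sub_sub_sub_cancel_right, ← smul_sub]

end IsEquivariantSection

variable [CharZero K]

/-- The given morphism `P` turns the leading defect of `F` into that of `P ∘ F`, which the Euler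
coderivation makes exact up to the factor `1 - m`. -/
theorem IsEquivariantMorphismBelow.exists_bracketDifferential_eq_neg {F : Sym ℋ →ₗ[K] Sym 𝒱}
    {m : ℕ} (hF : IsEquivariantMorphismBelow ρ hτ R A i F (m + 1)) (hm : 2 ≤ m)
    {P : Sym 𝒱 →ₗ[K] Sym ℋ} (hP : IsMorphism A R P) (hR : R.IsQuadratic) {π : V →ₗ[K] H}
    (linearPart_i_π : ∀ v, linearPart P (i (π v)) = linearPart P v)
    (bijective : Function.Bijective (linearPart P ∘ₗ i)) :
    ∃ ψ : Sym ℋ →ₗ[K] H, HasDegree (grading ℋ) ℋ 0 ψ ∧ ∀ x ∈ power ℋ (m + 1),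
      bracketDifferential R R LinearMap.id ψ x = -π (proj 𝒱 (defect R A F x)) := by
  have linearPart_comp : linearPart (P ∘ₗ F) = linearPart P ∘ₗ i := by
    rw [← hF.linearPart_eq]
    exact LinearMap.ext fun v => congr(proj ℋ (P $(hF.isCoalgHom.map_ι v)))
  have defect_comp (x : Sym ℋ) : defect R R (P ∘ₗ F) x = P (defect R A F x) := by
    have P_Q : P (A.Q (F x)) = R.Q (P (F x)) := congr($(hP.comp_Q) (F x))
    rw [defect_apply, defect_apply, map_sub, P_Q, LinearMap.comp_apply, LinearMap.comp_apply]
  obtain ⟨ψ, hψ, hψω⟩ := hR.exists_bracketDifferential_eq (hP.isCoalgHom.comp hF.isCoalgHom)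
    (by rwa [linearPart_comp]) (n := m + 1) (by omega)
    (ω := π ∘ₗ proj 𝒱 ∘ₗ defect R A F)
    (fun k hk x hx => by
      rw [defect_comp, defect_eq_zero hF.isCoalgHom hF.proj_defect k hk x hx, map_zero])
    (fun x hx => by
      rw [defect_comp, defect_eq_ι hF.isCoalgHom hF.proj_defect hx, hP.isCoalgHom.map_ι,
        linearPart_comp]
      exact congrArg (ι ℋ) (linearPart_i_π _).symm)
  have factor_ne_zero : (2 - (m + 1 : ℕ) : K) ≠ 0 := by
    rw [sub_ne_zero]
    exact_mod_cast (by omega : 2 ≠ m + 1)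
  refine ⟨_, hψ.smul (-(2 - (m + 1 : ℕ) : K)⁻¹), fun x hx => ?_⟩
  rw [map_smul, LinearMap.smul_apply, hψω x hx, smul_smul, neg_mul,
    inv_mul_cancel₀ factor_ne_zero, neg_one_smul]
  rfl

end EquivariantSection

section EquivariantMorphism

variable {K G V H : Type*} [Field K] [CharZero K] [Group G] [AddCommGroup V] [Module K V]
  [AddCommGroup H] [Module K H] {𝒱 : ℤ → Submodule K V} [DirectSum.Decomposition 𝒱]
  {ℋ : ℤ → Submodule K H} [DirectSum.Decomposition ℋ]
  {ρ : Representation K G V} {τ : Representation K G H} {hρ : IsGradedRep 𝒱 ρ}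
  {hτ : IsGradedRep ℋ τ} {R : LInftyStr ℋ} {A : LInftyStr 𝒱} {i : H →ₗ[K] V}
  {P : Sym 𝒱 →ₗ[K] Sym ℋ}

theorem IsMorphism.linearPart_q₁ (hP : IsMorphism A R P) (v : V) :
    linearPart P (A.q₁ v) = R.q₁ (linearPart P v) := by
  have comp_Q := congr(proj ℋ ($(hP.comp_Q) (ι 𝒱 v)))
  rwa [LinearMap.comp_apply, LinearMap.comp_apply, A.Q_ι, hP.isCoalgHom.map_ι v, R.Q_ι,
    proj_ι] at comp_Q

theorem IsMorphism.exists_retraction (hP : IsMorphism A R P) (hR : R.IsQuadratic)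
    (bijective : Function.Bijective (linearPart P ∘ₗ i)) :
    ∃ π : V →ₗ[K] H, (∀ w, π (i w) = w) ∧ (∀ v, π (A.q₁ v) = 0) ∧
      ∀ v, linearPart P (i (π v)) = linearPart P v := by
  let e := LinearEquiv.ofBijective _ bijective
  refine ⟨e.symm.toLinearMap ∘ₗ linearPart P, e.symm_apply_apply, fun v => ?_,
    fun v => e.apply_symm_apply _⟩
  rw [LinearMap.comp_apply, hP.linearPart_q₁, hR.q₁_eq_zero, map_zero]

theorem IsEquivariantSection.exists_next (hi : IsEquivariantSection ρ τ R A i)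
    (hR : R.IsQuadratic) (hA : TaylorEquivariant hρ ρ (proj 𝒱 ∘ₗ A.Q))
    (hRτ : TaylorEquivariant hτ τ (proj ℋ ∘ₗ R.Q)) {h : V →ₗ[K] V}
    (hh : IsEquivariantHomotopy 𝒱 ρ A.q₁ h) (hP : IsMorphism A R P)
    (bijective : Function.Bijective (linearPart P ∘ₗ i)) {m : ℕ} (hm : 2 ≤ m)
    (hHom : (homRep τ hτ 0 m).toRepresentation.IsSemisimpleRepresentation)
    {F : Sym ℋ →ₗ[K] Sym 𝒱} (hF : IsEquivariantMorphismBelow ρ hτ R A i F (m + 1)) :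
    ∃ F', IsEquivariantMorphismBelow ρ hτ R A i F' (m + 2) ∧
      ∀ k < m, ∀ x ∈ power ℋ k, F' x = F x := by
  obtain ⟨π, π_i, π_q₁, linearPart_i_π⟩ := hP.exists_retraction hR bijective
  let D : Sym ℋ →ₗ[K] V := (proj 𝒱 ∘ₗ defect R A F) ∘ₗ powerProj ℋ (m + 1)
  have q₁_D (x : Sym ℋ) : A.q₁ (D x) = 0 :=
    q₁_proj_defect hR hF.isCoalgHom hF.proj_defect (powerProj_mem _ x)
  have D_of_mem {x : Sym ℋ} (hx : x ∈ power ℋ (m + 1)) : D x = proj 𝒱 (defect R A F x) :=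
    congrArg (proj 𝒱 ∘ₗ defect R A F) (powerProj_of_mem hx)
  have hD : TaylorEquivariant hτ ρ D :=
    (taylorEquivariant_defect hA hRτ hF.isCoalgHom hF.equivariant).comp_powerProj (m + 1)
  obtain ⟨ψ, hψ, bracketDifferential_ψ⟩ :=
    hF.exists_bracketDifferential_eq_neg hm hP hR linearPart_i_π bijective
  obtain ⟨φ, hφ, hφτ, φ_of_ne, bracketDifferential_φ⟩ :=
    hR.exists_equivariant_bracketDifferential_eq hRτ hHom
      (hi.taylorEquivariant_comp π_i π_q₁ hA hD q₁_D).neg hψ fun x hx => by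
        rw [bracketDifferential_ψ x hx, ← D_of_mem hx]; rfl
  obtain ⟨F₁, hF₁, F₁_of_lt, proj_defect_F₁⟩ := hF.exists_perturbation_eq hm hR
    (hi.degree.comp hφ (add_zero 0)) (hφτ.comp_left fun g v => hi.equivariant g v)
    (fun k hk x hx => by rw [LinearMap.comp_apply, φ_of_ne k hk x hx, map_zero])
    fun x => hi.q₁_apply _
  obtain ⟨F', hF', F'_of_lt⟩ := hF₁.exists_extension (by omega) hR hA hRτ hh fun x hx => by
    obtain ⟨y, hy⟩ := hi.exists_sub_eq π_i π_q₁ (q₁_D x)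
    have mem_range := add_mem (LinearMap.mem_range.mpr ⟨y, hy⟩)
      (hi.bracketDifferential_sub_mem_range φ x)
    have primitive : bracketDifferential R R LinearMap.id φ x = -π (D x) :=
      bracketDifferential_φ x hx
    rw [primitive, map_neg, sub_neg_eq_add, sub_add_add_cancel] at mem_range
    rwa [proj_defect_F₁ x hx, ← D_of_mem hx]
  exact ⟨F', hF', fun k hk x hx =>
    (F'_of_lt k (by omega) x hx).trans (F₁_of_lt k hk x hx)⟩

theorem IsEquivariantSection.isEquivariantMorphismBelow_map
    (hi : IsEquivariantSection ρ τ R A i) (hR : R.IsQuadratic) :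
    IsEquivariantMorphismBelow ρ hτ R A i (map i hi.degree).toLinearMap 2 where
  isCoalgHom := isCoalgHom_map i hi.degree
  equivariant g x := by
    simp only [LinearMap.comp_apply, AlgHom.toLinearMap_apply, proj_map, hi.equivariant]
  linearPart_eq := LinearMap.ext fun v => by simp [linearPart, proj_ι]
  proj_defect k hk x hx := by
    rw [defect_apply, map_sub, AlgHom.toLinearMap_apply, AlgHom.toLinearMap_apply, proj_map,
      hR k (by omega) x hx, map_zero, sub_zero]
    match k with
    | 0 =>
      obtain ⟨c, rfl⟩ := exists_eq_smul_one_of_mem_power_zero hx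
      rw [map_smul, map_one, map_smul, A.Q_one, smul_zero, map_zero]
    | 1 =>
      obtain ⟨v, rfl⟩ := exists_eq_ι_of_mem_power_one hx
      rw [map_ι, A.Q_ι, hi.q₁_apply, map_zero, map_zero]

theorem IsEquivariantSection.exists_equivariant_morphism (hi : IsEquivariantSection ρ τ R A i)
    (hR : R.IsQuadratic) (hA : TaylorEquivariant hρ ρ (proj 𝒱 ∘ₗ A.Q))
    (hRτ : TaylorEquivariant hτ τ (proj ℋ ∘ₗ R.Q))
    (hHom : ∀ n, 2 ≤ n → (homRep τ hτ 0 n).toRepresentation.IsSemisimpleRepresentation)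
    {h : V →ₗ[K] V} (hh : IsEquivariantHomotopy 𝒱 ρ A.q₁ h) (hP : IsMorphism A R P)
    (bijective : Function.Bijective (linearPart P ∘ₗ i)) :
    ∃ F : Sym ℋ →ₗ[K] Sym 𝒱, IsMorphism R A F ∧ TaylorEquivariant hτ ρ (proj 𝒱 ∘ₗ F) ∧
      linearPart F = i := by
  obtain ⟨F₀, hF₀, -⟩ := (hi.isEquivariantMorphismBelow_map (hτ := hτ) hR).exists_extension
    le_rfl hR hA hRτ hh fun x hx => by
      rw [defect_apply, map_sub, AlgHom.toLinearMap_apply, AlgHom.toLinearMap_apply, proj_map]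
      exact hi.bracket x hx
  have step (s : ℕ) (F : {F // IsEquivariantMorphismBelow ρ hτ R A i F (s + 3)}) :
      ∃ F' : {F // IsEquivariantMorphismBelow ρ hτ R A i F (s + 1 + 3)},
        ∀ k < s + 2, ∀ x ∈ power ℋ k, F'.1 x = F.1 x := by
    obtain ⟨F', hF', F'_of_lt⟩ := hi.exists_next hR hA hRτ hh hP bijective (m := s + 2)
      (by omega) (hHom _ (by omega)) F.2
    exact ⟨⟨F', hF'⟩, F'_of_lt⟩
  choose next next_of_lt using step
  let F (s : ℕ) : {F // IsEquivariantMorphismBelow ρ hτ R A i F (s + 3)} :=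
    Nat.rec ⟨F₀, hF₀⟩ next s
  exact IsEquivariantMorphismBelow.exists_limit hR (F := fun s => (F s).1)
    (fun s => (F s).2.mono (by omega)) fun s k hk => next_of_lt s (F s) k (by omega)

end EquivariantMorphism

section Equivariance

variable {K G V W H : Type*} [Field K] [Group G] [AddCommGroup V] [Module K V] [AddCommGroup W]
  [Module K W] [AddCommGroup H] [Module K H] {𝒱 : ℤ → Submodule K V} {𝒲 : ℤ → Submodule K W}
  {ℋ : ℤ → Submodule K H} {ρ : Representation K G V} {σ : Representation K G W}
  {τ : Representation K G H} {hρ : IsGradedRep 𝒱 ρ} {hτ : IsGradedRep ℋ τ}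

theorem taylorEquivariant_of_isEquivariant [DirectSum.Decomposition 𝒱] {F : Sym 𝒱 →ₗ[K] Sym 𝒲}
    (hF : LInfty.IsEquivariant ρ σ F) (F_one : proj 𝒲 (F 1) = 0) :
    TaylorEquivariant hρ σ (proj 𝒲 ∘ₗ F) := fun g => by
  refine LinearMap.congr_fun (linearMap_ext_of_mem (f := σ g ∘ₗ proj 𝒲 ∘ₗ F)
    (g := (proj 𝒲 ∘ₗ F) ∘ₗ (map (ρ g) (hρ g)).toLinearMap) (power 𝒱) fun n x hx => ?_)
  cases n with
  | zero =>
    obtain ⟨c, rfl⟩ := exists_eq_smul_one_of_mem_power_zero hx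
    simp [F_one]
  | succ n =>
    refine power_le_of_prod_mem (n + 1) (P := LinearMap.eqLocus (σ g ∘ₗ proj 𝒲 ∘ₗ F)
      ((proj 𝒲 ∘ₗ F) ∘ₗ (map (ρ g) (hρ g)).toLinearMap)) (fun v => ?_) hx
    rw [LinearMap.mem_eqLocus, LinearMap.comp_apply (g := (map (ρ g) (hρ g)).toLinearMap),
      AlgHom.toLinearMap_apply, Sym.map_prod]
    exact hF g (n + 1) (by omega) v

theorem IsEquivariantSection.taylorEquivariant [DirectSum.Decomposition 𝒱]
    [DirectSum.Decomposition ℋ] {R : LInftyStr ℋ} {A : LInftyStr 𝒱} {i : H →ₗ[K] V}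
    (hi : IsEquivariantSection ρ τ R A i) (eq_zero_of_mem_range : ∀ w, i w ∈ A.q₁.range → w = 0)
    (hR : R.IsQuadratic) (hA : TaylorEquivariant hρ ρ (proj 𝒱 ∘ₗ A.Q)) :
    TaylorEquivariant hτ τ (proj ℋ ∘ₗ R.Q) := fun g => by
  have map_map_i (x : Sym ℋ) : map (ρ g) (hρ g) (map i hi.degree x) =
      map i hi.degree (map (τ g) (hτ g) x) := by
    suffices h : (map (ρ g) (hρ g)).comp (map i hi.degree) =
      (map i hi.degree).comp (map (τ g) (hτ g)) from congr($h x)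
    exact algHom_ext _ fun v => by simp [hi.equivariant]
  refine LinearMap.congr_fun (linearMap_ext_of_mem (f := τ g ∘ₗ proj ℋ ∘ₗ R.Q)
    (g := (proj ℋ ∘ₗ R.Q) ∘ₗ (map (τ g) (hτ g)).toLinearMap) (power ℋ) fun n x hx => ?_)
  have map_mem : map (τ g) (hτ g) x ∈ power ℋ n := map_mem_power _ _ n hx
  simp only [LinearMap.comp_apply, AlgHom.toLinearMap_apply]
  rcases eq_or_ne n 2 with rfl | hn
  · obtain ⟨y, hy⟩ := hi.bracket _ hx
    obtain ⟨z, hz⟩ := hi.bracket _ map_mem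
    have equivariant_bracket := hA g (map i hi.degree x)
    simp only [LinearMap.comp_apply] at equivariant_bracket
    refine (sub_eq_zero.mp (eq_zero_of_mem_range _ ⟨ρ g y - z, ?_⟩)).symm
    rw [map_sub, ← q₁_comm_of_taylorEquivariant hA, hy, hz, map_sub, equivariant_bracket,
      map_map_i, hi.equivariant, map_sub]
    abel
  · rw [hR n hn x hx, hR n hn _ map_mem, map_zero]

end Equivariance

/-! ### Cocycles representing the cohomology -/

section CocycleSection

variable {K G V : Type*} [Field K] [Group G] [AddCommGroup V] [Module K V]
  {𝒱 : ℤ → Submodule K V} [DirectSum.Decomposition 𝒱] {ρ : Representation K G V}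
  {A : LInftyStr 𝒱}

theorem q₁_comm (hA : A.IsEquivariant ρ) (g : G) (v : V) : ρ g (A.q₁ v) = A.q₁ (ρ g v) := by
  simpa only [taylor_one] using! hA g 1 le_rfl fun _ => v

/-- The choice `[z] ↦ z - q₁ (h z)` of representing cocycles that a generalized inverse `h` of the
differential provides. -/
def cocycleSection (A : LInftyStr 𝒱) (h : V →ₗ[K] V) (q₁_h_q₁ : ∀ v, A.q₁ (h (A.q₁ v)) = A.q₁ v) :
    A.H →ₗ[K] V :=
  Submodule.liftQ _ ((LinearMap.id - A.q₁ ∘ₗ h) ∘ₗ (LinearMap.ker A.q₁).subtype) fun x hx => by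
    obtain ⟨y, hy⟩ : ∃ y, A.q₁ y = x := hx
    rw [LinearMap.mem_ker, LinearMap.comp_apply, Submodule.subtype_apply, ← hy,
      LinearMap.sub_apply, LinearMap.comp_apply, q₁_h_q₁, LinearMap.id_apply, sub_self]

variable {h : V →ₗ[K] V} (q₁_h_q₁ : ∀ v, A.q₁ (h (A.q₁ v)) = A.q₁ v)

theorem cocycleSection_mk (z : LinearMap.ker A.q₁) :
    A.cocycleSection h q₁_h_q₁ (Cohomology.mk A.q₁ z) = z - A.q₁ (h z) := rfl

theorem sub_cocycleSection_mk_mem_range (z : LinearMap.ker A.q₁) :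
    (z : V) - A.cocycleSection h q₁_h_q₁ (Cohomology.mk A.q₁ z) ∈ LinearMap.range A.q₁ :=
  ⟨h z, by rw [cocycleSection_mk, sub_sub_cancel]⟩

theorem cocycleSection_hasDegree (hh : HasDegree 𝒱 𝒱 (-1) h) :
    HasDegree A.gradingH 𝒱 0 (A.cocycleSection h q₁_h_q₁) := by
  rintro d _ ⟨z, hz, rfl⟩
  have z_mem : (z : V) ∈ 𝒱 d := hz
  have q₁_h_mem := A.q₁_hasDegree _ _ (hh d z z_mem)
  rw [neg_add_cancel_right] at q₁_h_mem
  rw [cocycleSection_mk, add_zero]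
  exact sub_mem z_mem q₁_h_mem

theorem cocycleSection_comm (hA : A.IsEquivariant ρ) (hρh : ∀ g v, ρ g (h v) = h (ρ g v)) (g : G)
    (w : A.H) :
    ρ g (A.cocycleSection h q₁_h_q₁ w) = A.cocycleSection h q₁_h_q₁ (A.repH hA g w) := by
  obtain ⟨z, rfl⟩ := Submodule.mkQ_surjective _ w
  have q₁_ρ_z : A.q₁ (ρ g z) = 0 := by rw [← q₁_comm hA, LinearMap.mem_ker.mp z.2, map_zero]
  have repH_mk : A.repH hA g (Cohomology.mk A.q₁ z) = Cohomology.mk A.q₁ ⟨ρ g z, q₁_ρ_z⟩ := rfl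
  rw [repH_mk, cocycleSection_mk, cocycleSection_mk, map_sub, q₁_comm hA, hρh]

variable [CharZero K]

theorem q₁_q₁ (A : LInftyStr 𝒱) (v : V) : A.q₁ (A.q₁ v) = 0 := by
  have Q_square := congr(proj 𝒱 ($(A.Q_comp_Q) (ι 𝒱 v)))
  rwa [LinearMap.comp_apply, A.Q_ι, A.Q_ι, proj_ι, LinearMap.zero_apply, map_zero] at Q_square

theorem q₁_cocycleSection (w : A.H) : A.q₁ (A.cocycleSection h q₁_h_q₁ w) = 0 := by
  obtain ⟨z, rfl⟩ := Submodule.mkQ_surjective _ w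
  rw [cocycleSection_mk, map_sub, LinearMap.mem_ker.mp z.2, q₁_q₁, sub_zero]

theorem mk_cocycleSection (w : A.H) :
    Cohomology.mk A.q₁ ⟨A.cocycleSection h q₁_h_q₁ w, q₁_cocycleSection q₁_h_q₁ w⟩ = w := by
  obtain ⟨z, rfl⟩ := Submodule.mkQ_surjective _ w
  exact ((Submodule.Quotient.eq ((LinearMap.range A.q₁).submoduleOf _)).mpr
    (sub_cocycleSection_mk_mem_range q₁_h_q₁ z)).symm

theorem eq_zero_of_cocycleSection_mem_range {w : A.H}
    (hw : A.cocycleSection h q₁_h_q₁ w ∈ LinearMap.range A.q₁) : w = 0 := by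
  rw [← mk_cocycleSection q₁_h_q₁ w]
  exact (Submodule.Quotient.mk_eq_zero _).mpr hw

theorem cocycleSection_bracket_sub_mem_range (hh : HasDegree 𝒱 𝒱 (-1) h)
    {R : LInftyStr A.gradingH} (hR : A.IsInducedBracket R) {x : Sym A.gradingH}
    (hx : x ∈ power A.gradingH 2) :
    proj 𝒱 (A.Q (map (A.cocycleSection h q₁_h_q₁) (cocycleSection_hasDegree q₁_h_q₁ hh) x)) -
      A.cocycleSection h q₁_h_q₁ (proj A.gradingH (R.Q x)) ∈ LinearMap.range A.q₁ := by
  let i := A.cocycleSection h q₁_h_q₁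
  refine power_le_of_prod_mem 2 (P := (LinearMap.range A.q₁).comap
    (proj 𝒱 ∘ₗ A.Q ∘ₗ (map i (cocycleSection_hasDegree q₁_h_q₁ hh)).toLinearMap -
      i ∘ₗ proj A.gradingH ∘ₗ R.Q)) (fun v => ?_) hx
  obtain ⟨q_mem, r_eq⟩ := hR.two ⟨_, q₁_cocycleSection q₁_h_q₁ (v 0)⟩
    ⟨_, q₁_cocycleSection q₁_h_q₁ (v 1)⟩
  rw [mk_cocycleSection, mk_cocycleSection,
    show ![v 0, v 1] = v by ext k; fin_cases k <;> rfl] at r_eq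
  have proj_Q_prod : proj A.gradingH (R.Q (prod A.gradingH 2 v)) = _ := r_eq
  have comp_i : (fun k => i (v k)) = ![i (v 0), i (v 1)] := by ext k; fin_cases k <;> rfl
  rw [Submodule.mem_comap, LinearMap.sub_apply]
  simp only [LinearMap.comp_apply, AlgHom.toLinearMap_apply]
  rw [Sym.map_prod, proj_Q_prod, comp_i]
  exact sub_cocycleSection_mk_mem_range q₁_h_q₁ ⟨_, q_mem⟩

theorem isEquivariantSection_cocycleSection (hA : A.IsEquivariant ρ)
    (hh : IsEquivariantHomotopy 𝒱 ρ A.q₁ h) {R : LInftyStr A.gradingH}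
    (hR : A.IsInducedBracket R) :
    IsEquivariantSection ρ (A.repH hA) R A (A.cocycleSection h hh.comp_comp) where
  degree := cocycleSection_hasDegree hh.comp_comp hh.degree
  equivariant := cocycleSection_comm hh.comp_comp hA hh.equivariant
  q₁_apply := q₁_cocycleSection hh.comp_comp
  exists_sub_mem v hv := ⟨_, sub_cocycleSection_mk_mem_range hh.comp_comp ⟨v, hv⟩⟩
  bracket _ hx := cocycleSection_bracket_sub_mem_range hh.comp_comp hh.degree hR hx

theorem bijective_linearPart_comp_cocycleSection {R : LInftyStr A.gradingH} (hR : R.IsQuadratic)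
    {P : Sym 𝒱 →ₗ[K] Sym A.gradingH} (hP : IsQuasiIso A.q₁ R.q₁ (linearPart P)) :
    Function.Bijective (linearPart P ∘ₗ A.cocycleSection h q₁_h_q₁) := by
  obtain ⟨comm, injective, surjective⟩ := hP
  have map_eq (w : A.H) : Cohomology.map (linearPart P) comm w =
      Cohomology.mk R.q₁ ⟨linearPart P (A.cocycleSection h q₁_h_q₁ w), hR.q₁_eq_zero _⟩ := by
    conv_lhs => rw [← mk_cocycleSection q₁_h_q₁ w]
    rfl
  refine ⟨(injective_iff_map_eq_zero _).mpr fun w hw => injective ?_, fun u => ?_⟩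
  · rw [map_zero, map_eq]
    exact (Submodule.Quotient.mk_eq_zero _).mpr ⟨0, by rw [map_zero]; exact hw.symm⟩
  · obtain ⟨w, hw⟩ := surjective (Cohomology.mk R.q₁ ⟨u, hR.q₁_eq_zero u⟩)
    rw [map_eq] at hw
    obtain ⟨y, hy⟩ := (Submodule.Quotient.eq _).mp hw
    rw [hR.q₁_eq_zero] at hy
    exact ⟨w, sub_eq_zero.mp hy.symm⟩

theorem isQuasiIso_cocycleSection {R : LInftyStr A.gradingH} (hR : R.IsQuadratic) :
    IsQuasiIso R.q₁ A.q₁ (A.cocycleSection h q₁_h_q₁) := by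
  have comm : A.cocycleSection h q₁_h_q₁ ∘ₗ R.q₁ = A.q₁ ∘ₗ A.cocycleSection h q₁_h_q₁ :=
    LinearMap.ext fun v => by
      rw [LinearMap.comp_apply, LinearMap.comp_apply, hR.q₁_eq_zero, map_zero, q₁_cocycleSection]
  have map_mk (z : LinearMap.ker R.q₁) :
      Cohomology.map _ comm (Cohomology.mk R.q₁ z) = z := mk_cocycleSection q₁_h_q₁ z.1
  refine ⟨comm, (injective_iff_map_eq_zero _).mpr fun w hw => ?_,
    fun w => ⟨Cohomology.mk R.q₁ ⟨w, hR.q₁_eq_zero w⟩, map_mk _⟩⟩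
  obtain ⟨z, rfl⟩ := Submodule.mkQ_surjective _ w
  have z_eq_zero : z = 0 := Subtype.ext ((map_mk z).symm.trans hw)
  rw [z_eq_zero, map_zero]

end CocycleSection

end LInftyStr

end LInfty

open LInfty LInfty.LInftyStr in
theorem mainTheorem6_general {K G V : Type*} [Field K] [CharZero K] [Group G] [AddCommGroup V]
    [Module K V] (𝒱 : ℤ → Submodule K V) [DirectSum.Decomposition 𝒱]
    (ρ : Representation K G V) (hρ : LInfty.IsGradedRep 𝒱 ρ)
    (A : LInfty.LInftyStr 𝒱) (hA : A.IsEquivariant ρ)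
    (hV : ∀ i : ℤ, (LInfty.gradedPiece ρ hρ i).toRepresentation.IsSemisimpleRepresentation)
    (hHom : ∀ n : ℕ, 2 ≤ n →
      (LInfty.homRep (A.repH hA) (A.repH_isGradedRep hA hρ) 0
        n).toRepresentation.IsSemisimpleRepresentation)
    (hformal : A.IsFormal) :
    A.IsEquivariantlyFormal hA := by
  obtain ⟨R, hR, P, hP⟩ := hformal
  have quadratic : R.IsQuadratic := isQuadratic_of_q_eq_zero hR.ne_two
  have hAρ := taylorEquivariant_of_isEquivariant (hρ := hρ) hA A.proj_Q_one
  obtain ⟨h, hh⟩ := exists_isEquivariantHomotopy hρ hV A.q₁_hasDegree (q₁_comm hA)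
  have hi := isEquivariantSection_cocycleSection hA hh hR
  obtain ⟨F, hF, hFτ, linearPart_F⟩ := hi.exists_equivariant_morphism quadratic hAρ
    (hi.taylorEquivariant (fun _ => eq_zero_of_cocycleSection_mem_range hh.comp_comp) quadratic hAρ)
    hHom hh hP.isMorphism
    (bijective_linearPart_comp_cocycleSection hh.comp_comp quadratic hP.isQuasiIso)
  refine ⟨R, hR, F, ⟨hF, ?_⟩, fun g n _ v => ?_⟩
  · rw [linearPart_F]
    exact isQuasiIso_cocycleSection hh.comp_comp quadratic
  · have equivariant := hFτ g (Sym.prod A.gradingH n v)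
    rwa [Sym.map_prod] at equivariant

theorem mainTheorem6 {K G V : Type*} [Field K] [CharZero K] [Group G] [AddCommGroup V] [Module K V]
    (𝒱 : ℤ → Submodule K V) [DirectSum.Decomposition 𝒱]
    (ρ : Representation K G V) (hρ : LInfty.IsGradedRep 𝒱 ρ)
    (A : LInfty.LInftyStr 𝒱) (hA : A.IsEquivariant ρ)
    (hV : ∀ i : ℤ, (LInfty.gradedPiece ρ hρ i).toRepresentation.IsSemisimpleRepresentation)
    (hHom : ∀ j : ℤ, j = 0 ∨ j = 1 → ∀ n : ℕ, 2 ≤ n →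
      (LInfty.homRep (A.repH hA) (A.repH_isGradedRep hA hρ) j
        n).toRepresentation.IsSemisimpleRepresentation)
    (hformal : A.IsFormal) :
    A.IsEquivariantlyFormal hA :=
  mainTheorem6_general 𝒱 ρ hρ A hA hV (hHom 0 (Or.inl rfl)) hformal

end
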